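/- Let $d\ge 2$. For a set $X\subset\mathbb{R}^{d-1}\times\mathbb{R}$ and $(v,h)\in X$ let $$C((v,h),X)=\{w\in\mathbb{R}^{d-1}:\|w-v\|^2+h\le\|w-v'\|^2+h'\text{ for all }(v',h')\in X\}$$ be its Laguerre cell, and let $\mathcal{L}^*(X)$ be the system of all simplices $\operatorname{conv}(v_1,\dots,v_d)$ for which $(v_1,h_1),\dots,(v_d,h_d)$ are distinct points of $X$ whose Laguerre cells all have non-empty interior and share a common point. For a system $\mathcal{M}$ of subsets of $\mathbb{R}^{d-1}$ put $\operatorname{skel}(\mathcal{M})=\bigcup_{c\in\mathcal{M}}\partial c$. A point process is identified with its set of points. For $\beta>0$ let $\eta_\beta$ be a Poisson point process on $\mathbb{R}^{d-1}\times[0,\infty)$ with intensity density $\sqrt{2\beta}\,c_{d,\beta}h^\beta$, where $c_{d,\beta}=\frac{\Gamma(d/2+\beta+1)}{\pi^{d/2}\Gamma(\beta+1)}$; for $\beta>(d+1)/2$ let $\eta'_\beta$ be a Poisson point process on $\mathbb{R}^{d-1}\times(-\infty,0)$ with intensity density $\sqrt{2\beta}\,c'_{d,\beta}(-h)^{-\beta}$,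 where $c'_{d,\beta}=\frac{\Gamma(\beta)}{\pi^{d/2}\Gamma(\beta-d/2)}$; and let $\zeta$ be a Poisson point process on $\mathbb{R}^{d-1}\times\mathbb{R}$ with intensity density $(2\pi)^{-d/2}e^{h/2}$ (all densities with respect to Lebesgue measure in $(v,h)$). Let $\mathcal{D}_\beta=\mathcal{L}^*(\eta_\beta)$ and $\mathcal{D}'_\beta=\mathcal{L}^*(\eta'_\beta)$ be the $\beta$- and $\beta'$-Delaunay tessellations and $\mathcal{D}=\mathcal{L}^*(\zeta)$ the Gaussian-Delaunay tessellation. Let $\zeta_\beta$ be the image of $\eta_\beta$ under $(v,h)\mapsto(\sqrt{2\beta}\,v,2\beta(h-1))$ and $\zeta'_\beta$ the image of $\eta'_\beta$ under $(v,h)\mapsto(\sqrt{2\beta}\,v,2\beta(h+1))$. Put $$\widetilde D_\beta=\operatorname{skel}(\mathcal{L}^*(\zeta_\beta)),\qquad \widetilde D'_\beta=\operatorname{skel}(\mathcal{L}^*(\zeta'_\beta)),\qquad D=\operatorname{skel}(\mathcal{D}).$$ Then $\widetilde D_\beta$, $\widetilde D'_\beta$ and $D$ are random closed sets in $\mathbb{R}^{d-1}$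 (almost surely closed, and measurable up to null sets for the Borel $\sigma$-field of the Fell topology); $\widetilde D_\beta=\sqrt{2\beta}\,\operatorname{skel}(\mathcal{D}_\beta)$ and $\widetilde D'_\beta=\sqrt{2\beta}\,\operatorname{skel}(\mathcal{D}'_\beta)$; and, as $\beta\to\infty$: 1. $\widetilde D_\beta$ and $\widetilde D'_\beta$ converge weakly to $D$ with respect to the Fell topology on the space of closed subsets of $\mathbb{R}^{d-1}$; 2. for every compact $C\subset\mathbb{R}^{d-1}$, $\mathbb{P}(\widetilde D_\beta\cap C\ne\varnothing)\to\mathbb{P}(D\cap C\neq\varnothing)$ and $\mathbb{P}(\widetilde D'_\beta\cap C\ne\varnothing)\to\mathbb{P}(D\cap C\neq\varnothing)$; 3. convergence holds in the stronger topology of local coincidence, in which a set $U$ of closed sets is open if for each $F\in U$ there is $R>0$ such that $U$ contains all closed sets $B$ with $B\cap B_R=F\cap B_R$, where $B_R$ is the closed ball of radius $R$ about $0$: for every bounded function $f$ on the closed sets that is continuous for this topology and Borel measurable for the Fell topology, $\mathbb{E}f(\widetilde D_\beta)\to\mathbb{E}f(D)$ and $\mathbb{E}f(\widetilde D'_\beta)\to\mathbb{E}f(D)$;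 4. there is one probability space carrying versions of all the processes $\eta_\beta$, $\eta'_\beta$ and $\zeta$ such that, for the skeletons built from these versions and every $R>0$, $\mathbb{P}(\widetilde D_\beta\cap B_R\neq D\cap B_R)\to0$ and $\mathbb{P}(\widetilde D'_\beta\cap B_R\neq D\cap B_R)\to 0$. -/

import Mathlib

open MeasureTheory ProbabilityTheory Filter Topology Set
open scoped ENNReal

noncomputable section

/-! ### Point processes -/

/-- A `σ`-finite counting measure: a `σ`-finite measure which is a countable sum of Dirac masses
(repetitions allowed). -/
def IsCountingMeasure {X : Type*} [MeasurableSpace X] (m : Measure X) : Prop :=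
  SigmaFinite m ∧
    ∃ (ι : Type) (_ : Countable ι) (x : ι → X), m = Measure.sum fun i => Measure.dirac (x i)

/-- The Poisson distribution with mean `r ∈ [0, ∞]`, as a measure on `[0, ∞]`; the Poisson
distribution with mean `∞` is the point mass at `∞`. -/
def poissonLaw (r : ℝ≥0∞) : Measure ℝ≥0∞ :=
  open Classical in
  if r = ∞ then Measure.dirac ∞
  else (poissonMeasure r.toNNReal).map (fun k : ℕ => (k : ℝ≥0∞))

/-- `η` is a Poisson point process with intensity measure `μ`, defined on the probability space
`(Ω, P)`. The measurable structure on `Measure X` is the one generated by the evaluations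
`m ↦ m B`, with `B` measurable. -/
structure IsPoissonProcess {X Ω : Type*} [MeasurableSpace X] [MeasurableSpace Ω]
    (η : Ω → Measure X) (μ : Measure X) (P : Measure Ω) : Prop where
  measurable : Measurable η
  counting : ∀ ω, IsCountingMeasure (η ω)
  law : ∀ B : Set X, MeasurableSet B → HasLaw (fun ω => η ω B) (poissonLaw (μ B)) P
  indep : ∀ (n : ℕ) (B : Fin n → Set X), (∀ i, MeasurableSet (B i)) →
    Pairwise (fun i j => Disjoint (B i) (B j)) → iIndepFun (fun i ω => η ω (B i)) P

/-- The set of points charged by a counting measure. -/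
def atoms {X : Type*} [MeasurableSpace X] (m : Measure X) : Set X := {x | m {x} ≠ 0}

/-! ### Laguerre diagrams, dual Laguerre tessellations, skeletons -/

/-- The space `ℝ^{d-1}` in which the tessellations live. -/
abbrev Space (d : ℕ) : Type := EuclideanSpace ℝ (Fin (d - 1))

/-- The power of `w` with respect to the weighted point `x = (v, h)`. -/
def power {d : ℕ} (w : Space d) (x : Space d × ℝ) : ℝ := ‖w - x.1‖ ^ 2 + x.2

/-- The Laguerre cell of the weighted point `x` with respect to `X`. -/
def laguerreCell {d : ℕ} (x : Space d × ℝ) (X : Set (Space d × ℝ)) : Set (Space d) :=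
  {w | ∀ y ∈ X, power w x ≤ power w y}

/-- The dual `L^*(X)` of the Laguerre diagram of `X`: the system of all simplices
`conv(v₁, …, v_d)` for which `(v₁, h₁), …, (v_d, h_d)` are distinct points of `X` whose Laguerre
cells all have non-empty interior and share a common point. -/
def dualLaguerre (d : ℕ) (X : Set (Space d × ℝ)) : Set (Set (Space d)) :=
  {c | ∃ x : Fin d → Space d × ℝ, Function.Injective x ∧ (∀ i, x i ∈ X) ∧
    (∀ i, (interior (laguerreCell (x i) X)).Nonempty) ∧
    (⋂ i, laguerreCell (x i) X).Nonempty ∧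
    c = convexHull ℝ (range fun i => (x i).1)}

/-- The skeleton of a system of sets: the union of the boundaries of its members. -/
def skel {X : Type*} [TopologicalSpace X] (M : Set (Set X)) : Set X := ⋃ c ∈ M, frontier c

/-- The skeleton of the dual Laguerre tessellation `L^*(m)` of a counting measure `m`. -/
def delaunaySkel (d : ℕ) (m : Measure (Space d × ℝ)) : Set (Space d) :=
  skel (dualLaguerre d (atoms m))

/-! ### The intensity measures and the rescaling -/

/-- The constant `c_{d,β}`. -/
def cBeta (d : ℕ) (β : ℝ) : ℝ :=
  Real.Gamma ((d : ℝ) / 2 + β + 1) / (Real.pi ^ ((d : ℝ) / 2) * Real.Gamma (β + 1))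

/-- The constant `c'_{d,β}`. -/
def cBeta' (d : ℕ) (β : ℝ) : ℝ :=
  Real.Gamma β / (Real.pi ^ ((d : ℝ) / 2) * Real.Gamma (β - (d : ℝ) / 2))

/-- The intensity measure of `η_{β,γ}`: density `γ c_{d,β} h^β` on `ℝ^{d-1} × [0, ∞)`. -/
def betaIntensity (d : ℕ) (β γ : ℝ) : Measure (Space d × ℝ) :=
  volume.withDensity fun x =>
    ENNReal.ofReal (if 0 ≤ x.2 then γ * cBeta d β * x.2 ^ β else 0)

/-- The intensity measure of `η'_{β,γ}`: density `γ c'_{d,β} (-h)^{-β}` on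
`ℝ^{d-1} × (-∞, 0)`. -/
def betaIntensity' (d : ℕ) (β γ : ℝ) : Measure (Space d × ℝ) :=
  volume.withDensity fun x =>
    ENNReal.ofReal (if x.2 < 0 then γ * cBeta' d β * (-x.2) ^ (-β) else 0)

/-- The intensity measure of `ζ`: density `(2π)^{-d/2} e^{h/2}` on `ℝ^{d-1} × ℝ`. -/
def gaussIntensity (d : ℕ) : Measure (Space d × ℝ) :=
  volume.withDensity fun x =>
    ENNReal.ofReal ((2 * Real.pi) ^ (-((d : ℝ) / 2)) * Real.exp (x.2 / 2))

/-- The transformation `Q_β`. -/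
def rescale (d : ℕ) (β : ℝ) (x : Space d × ℝ) : Space d × ℝ :=
  (√(2 * β) • x.1, 2 * β * (x.2 - 1))

/-- The transformation `Q'_β`. -/
def rescale' (d : ℕ) (β : ℝ) (x : Space d × ℝ) : Space d × ℝ :=
  (√(2 * β) • x.1, 2 * β * (x.2 + 1))

/-! ### Closed sets, the Fell topology, and the topology of local coincidence -/

/-- The closed subsets of a topological space. (Mathlib's `TopologicalSpace.Closeds` is not used
because on a metric space it carries the topology of the Hausdorff distance.) -/
structure ClosedSubset (X : Type*) [TopologicalSpace X] where
  carrier : Set X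
  isClosed_carrier : IsClosed carrier

namespace ClosedSubset

/-- The Fell topology, generated by the sets `{F | F ∩ K = ∅}` with `K` compact and
`{F | F ∩ G ≠ ∅}` with `G` open. -/
instance fellTopology (X : Type*) [TopologicalSpace X] : TopologicalSpace (ClosedSubset X) :=
  TopologicalSpace.generateFrom
    ({U | ∃ K : Set X, IsCompact K ∧ U = {F | F.carrier ∩ K = ∅}} ∪
      {U | ∃ G : Set X, IsOpen G ∧ U = {F | (F.carrier ∩ G).Nonempty}})

/-- The Borel `σ`-field of the Fell topology. -/
instance (X : Type*) [TopologicalSpace X] : MeasurableSpace (ClosedSubset X) :=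
  borel (ClosedSubset X)

instance (X : Type*) [TopologicalSpace X] : BorelSpace (ClosedSubset X) := ⟨rfl⟩

/-- The topology of local coincidence on the closed subsets of `ℝ^{d-1}`: a set `U` of closed sets
is open if for each `F ∈ U` there is `R > 0` such that `U` contains every closed set which
coincides with `F` in the closed ball of radius `R` about the origin. -/
abbrev localTopology (d : ℕ) : TopologicalSpace (ClosedSubset (Space d)) where
  IsOpen U := ∀ F ∈ U, ∃ R : ℝ, 0 < R ∧ ∀ B : ClosedSubset (Space d),
    B.carrier ∩ Metric.closedBall 0 R = F.carrier ∩ Metric.closedBall 0 R → B ∈ U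
  isOpen_univ := fun _ _ => ⟨1, one_pos, fun _ _ => mem_univ _⟩
  isOpen_inter := by
    rintro U V hU hV F ⟨hFU, hFV⟩
    obtain ⟨R, hR, h⟩ := hU F hFU
    obtain ⟨R', hR', h'⟩ := hV F hFV
    refine ⟨max R R', lt_max_of_lt_left hR, fun B hB => ⟨h B ?_, h' B ?_⟩⟩
    · have hs : Metric.closedBall (0 : Space d) R ⊆ Metric.closedBall 0 (max R R') :=
        Metric.closedBall_subset_closedBall (le_max_left _ _)
      rw [← inter_eq_self_of_subset_right hs, ← inter_assoc, hB, inter_assoc]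
    · have hs : Metric.closedBall (0 : Space d) R' ⊆ Metric.closedBall 0 (max R R') :=
        Metric.closedBall_subset_closedBall (le_max_right _ _)
      rw [← inter_eq_self_of_subset_right hs, ← inter_assoc, hB, inter_assoc]
  isOpen_sUnion := by
    rintro S hS F ⟨U, hU, hF⟩
    obtain ⟨R, hR, h⟩ := hS U hU F hF
    exact ⟨R, hR, fun B hB => ⟨U, hU, h B hB⟩⟩

end ClosedSubset

/-- The closure of a set, as an element of the space of closed sets. -/
def toClosed {X : Type*} [TopologicalSpace X] (s : Set X) : ClosedSubset X :=
  ⟨closure s, isClosed_closure⟩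

/-- `Z` is a random closed set: almost surely closed, and (up to a null set) Borel measurable for
the Fell topology. -/
def IsRandomClosedSet {Ω X : Type*} [MeasurableSpace Ω] [TopologicalSpace X] (Z : Ω → Set X)
    (P : Measure Ω) : Prop :=
  (∀ᵐ ω ∂P, IsClosed (Z ω)) ∧ AEMeasurable (fun ω => toClosed (Z ω)) P

/-- The capacity functional `T_Z(C) = P(Z ∩ C ≠ ∅)`. -/
def capacity {Ω X : Type*} [MeasurableSpace Ω] (Z : Ω → Set X) (P : Measure Ω) (C : Set X) :
    ℝ≥0∞ :=
  P {ω | (Z ω ∩ C).Nonempty}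

end

/-! After rescaling, the intensity densities depend on the height `h` only: they are `betaConst d β
* (1 + h/(2β))^β` and, below the height `2β`, `betaConst' d β * (1 - h/(2β))^(-β)`. Both converge
pointwise to the density of `ζ`: the powers converge to `exp (h/2)`, and the constants converge by
the asymptotics `Γ(x + n/2) ~ Γ(x) x^(n/2)`. For fixed `b` with `t < 2b`, all the densities are
eventually dominated below the height `t` by a multiple of `(2b - h)^(-b)`. If `b > (d+1)/2` this is
integrable over every `powerRegion`, a paraboloid-like region containing all weighted points with
power at most `t` at some centre of norm at most `r`. Hence the densities converge in `L¹` on these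
regions.

All processes are coupled by thinning one Poisson process on `(ℝ^{d-1} × ℝ) × ℝ` with Lebesgue
intensity: a point `(x, y)` contributes `x` to the process of density `f` if `0 < y ≤ f x`. Two
thinnings differ on a region with probability at most the `L¹` distance of their densities there
(`prod_betweenGraphs`, `atoms_thin_inter_eq`).

The skeleton is a local functional. If a simplex spanned by minimizers of the power at `w` meets a
ball and the configuration surrounds that ball, then `w` is bounded
(`two_mul_norm_le_of_convexHull`). So for almost every realization of `ζ` and every `R`, the
skeleton in `B_R` depends only on the points in some power region (`eventually_stabilizes`,
`Stabilizes.skel_inter_eq`). Borel–Cantelli along subsequences then gives almost sure eventual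
coincidence of the coupled skeletons in every ball (`exists_subseq_ae_skel_eq`), from which all the
modes of convergence follow. Only the limit has to stabilize, so the accumulation of points of
`ζ'_β` at the height `2β` does no harm in this step.

Two matters remain. The skeleton must be a random closed set whose law depends on the intensity
only: it is measurable as a function of sequences of points, and a Lusin–Souslin argument passes to
counting measures (`exists_measurableSet_of_diracSeq`). And it must be almost surely closed, which
for `ζ'_β` requires a covering estimate close to the singular height
(`isTessellationIntensity_singularDensity`). -/

noncomputable section

/-! ### The function `x ↦ exp (-x)` on `[0, ∞]` -/

/-- The function `x ↦ exp (-x)` on `[0, ∞]`. -/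
def expNeg (x : ℝ≥0∞) : ℝ≥0∞ := EReal.exp (-(x : EReal))

@[simp] lemma expNeg_zero : expNeg 0 = 1 := by simp [expNeg]

@[simp] lemma expNeg_top : expNeg ∞ = 0 := by simp [expNeg]

lemma expNeg_add (x y : ℝ≥0∞) : expNeg (x + y) = expNeg x * expNeg y := by
  simp only [expNeg, EReal.coe_ennreal_add]
  rw [EReal.neg_add (Or.inl (by simp)) (Or.inr (by simp)), sub_eq_add_neg, EReal.exp_add]

lemma expNeg_le_one (x : ℝ≥0∞) : expNeg x ≤ 1 := by
  rw [expNeg, EReal.exp_le_one_iff]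
  simpa using EReal.coe_ennreal_nonneg x

lemma expNeg_ne_top (x : ℝ≥0∞) : expNeg x ≠ ∞ :=
  ((expNeg_le_one x).trans_lt ENNReal.one_lt_top).ne

lemma continuous_expNeg : Continuous expNeg :=
  ENNReal.continuous_exp.comp (continuous_neg.comp continuous_coe_ennreal_ereal)

lemma measurable_expNeg : Measurable expNeg := continuous_expNeg.measurable

lemma expNeg_injective : Function.Injective expNeg := by
  intro x y h
  have := EReal.exp_strictMono.injective h
  exact EReal.coe_ennreal_injective (neg_injective this)

lemma expNeg_antitone : Antitone expNeg := by
  intro x y h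
  exact EReal.exp_monotone (by simpa using h)

lemma expNeg_ofReal {r : ℝ} (hr : 0 ≤ r) :
    expNeg (ENNReal.ofReal r) = ENNReal.ofReal (Real.exp (-r)) := by
  rw [expNeg, EReal.coe_ennreal_ofReal, max_eq_left hr, ← EReal.coe_neg, EReal.exp_coe]

lemma expNeg_sum {ι : Type*} (s : Finset ι) (f : ι → ℝ≥0∞) :
    expNeg (∑ i ∈ s, f i) = ∏ i ∈ s, expNeg (f i) := by
  classical
  induction s using Finset.induction_on with
  | empty => simp
  | insert a s ha ih => rw [Finset.sum_insert ha, Finset.prod_insert ha, expNeg_add, ih]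

lemma expNeg_nat_mul (n : ℕ) (x : ℝ≥0∞) : expNeg (n * x) = expNeg x ^ n := by
  have := expNeg_sum (Finset.range n) (fun _ => x)
  simpa using this

lemma one_sub_expNeg_le (x : ℝ≥0∞) : 1 - expNeg x ≤ x := by
  rcases eq_or_ne x ∞ with rfl | hx
  · simp
  · obtain ⟨r, rfl⟩ : ∃ r : NNReal, x = r := ⟨x.toNNReal, (ENNReal.coe_toNNReal hx).symm⟩
    have h1 : (r : ℝ≥0∞) = ENNReal.ofReal r := by simp
    rw [h1, expNeg_ofReal r.coe_nonneg, ← ENNReal.ofReal_one,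
      ← ENNReal.ofReal_sub _ (Real.exp_pos _).le]
    apply ENNReal.ofReal_le_ofReal
    have := Real.add_one_le_exp (-(r : ℝ))
    linarith

/-! ### Laplace transforms determine finite measures on `[0, ∞]^n` -/

/-- The functions `expNeg (x i)` separate the points of the compact space `[0, ∞]^n`. By
Stone–Weierstrass their polynomials are dense in the continuous functions, so integrals of monomials
determine a finite measure. -/
lemma measure_ext_of_laplace {ι : Type*} [Fintype ι] {P Q : Measure (ι → ℝ≥0∞)}
    [IsFiniteMeasure P] [IsFiniteMeasure Q]
    (h : ∀ m : ι → ℕ, ∫⁻ x, ∏ i, expNeg (x i) ^ m i ∂P = ∫⁻ x, ∏ i, expNeg (x i) ^ m i ∂Q) :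
    P = Q := by
  classical
  let g : ι → C(ι → ℝ≥0∞, ℝ) := fun i =>
    ⟨fun x => (expNeg (x i)).toReal, by
      refine ENNReal.continuousOn_toReal.comp_continuous
        (continuous_expNeg.comp (continuous_apply i)) fun x => expNeg_ne_top _⟩
  let A : Subalgebra ℝ C(ι → ℝ≥0∞, ℝ) := Algebra.adjoin ℝ (range g)
  have hsep : A.SeparatesPoints := by
    intro x y hxy
    obtain ⟨i, hi⟩ := Function.ne_iff.1 hxy
    refine ⟨g i, ⟨g i, Algebra.subset_adjoin ⟨i, rfl⟩, rfl⟩, fun he => hi ?_⟩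
    exact expNeg_injective
      ((ENNReal.toReal_eq_toReal_iff' (expNeg_ne_top _) (expNeg_ne_top _)).1 he)
  have htop := ContinuousMap.subalgebra_topologicalClosure_eq_top_of_separatesPoints A hsep
  have hInt : ∀ (R : Measure (ι → ℝ≥0∞)) [IsFiniteMeasure R] (f : C(ι → ℝ≥0∞, ℝ)),
      Integrable f R := fun R _ f =>
    (BoundedContinuousFunction.mkOfCompact f).integrable R
  have hmon : ∀ f ∈ Submonoid.closure (range g), ∃ m : ι → ℕ, ∀ x,
      f x = (∏ i, expNeg (x i) ^ m i).toReal := by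
    intro f hf
    induction hf using Submonoid.closure_induction with
    | mem f hf =>
      obtain ⟨j, rfl⟩ := hf
      refine ⟨Pi.single j 1, fun x => ?_⟩
      rw [Finset.prod_eq_single j]
      · simp [g]
      · intro b _ hb
        simp [hb]
      · simp
    | one => exact ⟨0, fun x => by simp⟩
    | mul f f' _ _ h1 h2 =>
      obtain ⟨m, hm⟩ := h1
      obtain ⟨m', hm'⟩ := h2
      refine ⟨m + m', fun x => ?_⟩
      simp [hm, hm', pow_add, Finset.prod_mul_distrib]
  have hA : ∀ f ∈ (A : Set C(ι → ℝ≥0∞, ℝ)), ∫ x, f x ∂P = ∫ x, f x ∂Q := by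
    intro f hf
    have hf' : f ∈ Submodule.span ℝ (Submonoid.closure (range g) : Set C(ι → ℝ≥0∞, ℝ)) := by
      rw [← Algebra.adjoin_eq_span]; exact hf
    clear hf
    induction hf' using Submodule.span_induction with
    | mem f hf' =>
      obtain ⟨m, hm⟩ := hmon f hf'
      have hmeas : Measurable fun x : ι → ℝ≥0∞ => ∏ i, expNeg (x i) ^ m i :=
        Finset.measurable_prod _ fun i _ =>
          (measurable_expNeg.comp (measurable_pi_apply i)).pow_const _
      have hlt : ∀ x : ι → ℝ≥0∞, ∏ i, expNeg (x i) ^ m i < ∞ := fun x =>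
        ENNReal.prod_lt_top fun i _ => ENNReal.pow_lt_top (expNeg_ne_top _).lt_top
      simp_rw [hm]
      rw [integral_toReal hmeas.aemeasurable (ae_of_all _ hlt),
        integral_toReal hmeas.aemeasurable (ae_of_all _ hlt), h m]
    | zero => simp
    | add f f' _ _ e1 e2 =>
      simp only [ContinuousMap.add_apply]
      rw [integral_add (hInt P f) (hInt P f'), integral_add (hInt Q f) (hInt Q f'), e1, e2]
    | smul c f _ e1 =>
      simp only [ContinuousMap.smul_apply, smul_eq_mul]
      rw [integral_const_mul, integral_const_mul, e1]
  apply ext_of_forall_integral_eq_of_IsFiniteMeasure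
  intro f
  have hf : f.toContinuousMap ∈ closure (A : Set C(ι → ℝ≥0∞, ℝ)) := by
    rw [← Subalgebra.topologicalClosure_coe, htop]; trivial
  have hcont : ∀ (ρ : Measure (ι → ℝ≥0∞)) [IsFiniteMeasure ρ],
      Continuous fun f : C(ι → ℝ≥0∞, ℝ) => (∫ x, f x ∂ρ) := by
    intro ρ _
    refine Metric.continuous_iff.2 fun f ε hε => ?_
    refine ⟨ε / (ρ.real univ + 1), by positivity, fun f' hf' => ?_⟩
    rw [Real.dist_eq, ← integral_sub (hInt ρ f') (hInt ρ f)]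
    have hb : ∀ x, ‖f' x - f x‖ ≤ dist f' f := fun x => by
      rw [← dist_eq_norm]; exact ContinuousMap.dist_apply_le_dist x
    calc |∫ x, (f' x - f x) ∂ρ| ≤ dist f' f * ρ.real univ :=
          norm_integral_le_of_norm_le_const (ae_of_all _ hb)
      _ ≤ dist f' f * (ρ.real univ + 1) := by gcongr; linarith
      _ < ε / (ρ.real univ + 1) * (ρ.real univ + 1) := by gcongr
      _ = ε := by field_simp
  exact closure_minimal hA (isClosed_eq (hcont P) (hcont Q)) hf

/-! ### Poisson laws and their Laplace transforms -/

lemma lintegral_pow_poissonMeasure (r : NNReal) {u : ℝ≥0∞} (hu : u ≤ 1) :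
    ∫⁻ k, u ^ k ∂poissonMeasure r = expNeg (r * (1 - u)) := by
  obtain ⟨v, rfl⟩ : ∃ v : NNReal, u = v :=
    ⟨u.toNNReal, (ENNReal.coe_toNNReal (hu.trans_lt ENNReal.one_lt_top).ne).symm⟩
  have hv : (v : ℝ) ≤ 1 := by exact_mod_cast hu
  have h1 : (r : ℝ≥0∞) * (1 - v) = ENNReal.ofReal (r * (1 - v)) := by
    rw [ENNReal.ofReal_mul r.coe_nonneg, ENNReal.ofReal_sub _ v.coe_nonneg]
    simp
  rw [h1, expNeg_ofReal (mul_nonneg r.coe_nonneg (by linarith)), poissonMeasure,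
    lintegral_sum_measure]
  have h2 : ∀ n : ℕ, ∫⁻ k, (v : ℝ≥0∞) ^ k
      ∂(ENNReal.ofReal (Real.exp (-r) * r ^ n / n.factorial) • Measure.dirac n) =
      ENNReal.ofReal (Real.exp (-r) * ((r * v) ^ n / n.factorial)) := by
    intro n
    rw [lintegral_smul_measure, lintegral_dirac, smul_eq_mul,
      ← ENNReal.ofReal_coe_nnreal (p := v), ← ENNReal.ofReal_pow v.coe_nonneg,
      ← ENNReal.ofReal_mul (by positivity)]
    congr 1
    rw [mul_pow]; ring
  simp_rw [h2]
  have hs : HasSum (fun n : ℕ => Real.exp (-r) * ((r * v : ℝ) ^ n / n.factorial))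
      (Real.exp (-r) * Real.exp (r * v)) := by
    have := NormedSpace.expSeries_div_hasSum_exp (r * v : ℝ)
    rw [← Real.exp_eq_exp_ℝ] at this
    exact this.mul_left _
  rw [← ENNReal.ofReal_tsum_of_nonneg (fun n => by positivity) hs.summable, hs.tsum_eq,
    ← Real.exp_add]
  congr 2
  ring

instance isProbabilityMeasure_poissonLaw (r : ℝ≥0∞) : IsProbabilityMeasure (poissonLaw r) := by
  rw [poissonLaw]
  split_ifs
  · infer_instance
  · exact Measure.isProbabilityMeasure_map (measurable_of_countable _).aemeasurable

lemma lintegral_expNeg_pow_poissonLaw (r : ℝ≥0∞) (m : ℕ) :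
    ∫⁻ x, expNeg x ^ m ∂poissonLaw r = expNeg (r * (1 - expNeg m)) := by
  rw [poissonLaw]
  split_ifs with hr
  · rw [lintegral_dirac, hr]
    -- For `m = 0` the convention `∞ * 0 = 0` makes both sides `1`; for `m > 0` both sides vanish.
    rcases Nat.eq_zero_or_pos m with rfl | hm
    · simp
    · have : expNeg (m : ℝ≥0∞) ≠ 1 := by
        rw [← expNeg_zero]
        intro h
        have := expNeg_injective h
        simp at this
        omega
      have h1 : 1 - expNeg (m : ℝ≥0∞) ≠ 0 := by
        rw [Ne, tsub_eq_zero_iff_le, not_le]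
        exact lt_of_le_of_ne (expNeg_le_one _) this
      rw [ENNReal.top_mul h1]
      simp [hm.ne']
  · rw [lintegral_map (measurable_expNeg.pow_const _) (measurable_of_countable _)]
    have h1 : ∀ k : ℕ, expNeg (k : ℝ≥0∞) ^ m = expNeg (m : ℝ≥0∞) ^ k := by
      intro k
      rw [← expNeg_nat_mul, ← expNeg_nat_mul, mul_comm]
    simp_rw [h1]
    rw [lintegral_pow_poissonMeasure _ (expNeg_le_one _), ENNReal.coe_toNNReal hr]

lemma poissonLaw_top : poissonLaw ∞ = Measure.dirac ∞ := by simp [poissonLaw]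

lemma poissonLaw_apply_top {r : ℝ≥0∞} (hr : r ≠ ∞) : poissonLaw r {∞} = 0 := by
  rw [poissonLaw, if_neg hr, Measure.map_apply (measurable_of_countable _)
    (measurableSet_singleton _)]
  have : (fun k : ℕ => (k : ℝ≥0∞)) ⁻¹' {∞} = ∅ := by ext; simp
  simp [this]

lemma poissonLaw_apply_zero (r : ℝ≥0∞) : poissonLaw r {0} = expNeg r := by
  rw [poissonLaw]
  split_ifs with hr
  · simp [hr]
  · rw [Measure.map_apply (measurable_of_countable _) (measurableSet_singleton _)]
    have : (fun k : ℕ => (k : ℝ≥0∞)) ⁻¹' {0} = {0} := by ext; simp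
    rw [this, poissonMeasure_singleton]
    have h2 : r = ENNReal.ofReal r.toNNReal := by
      rw [ENNReal.ofReal_coe_nnreal, ENNReal.coe_toNNReal hr]
    conv_rhs => rw [h2]
    rw [expNeg_ofReal (NNReal.coe_nonneg _)]
    simp

/-! ### Processes with independent Poisson counts -/

section

variable {X Ω : Type*} [MeasurableSpace X] [MeasurableSpace Ω]

/-- The test function `∑ m i • 1_{B i}` turns the Laplace functional into the joint Laplace
transform of the counts. Since the sets are disjoint, `1 - expNeg f` splits over them, and the
transform factors into Poisson transforms. -/
lemma map_counts_eq_pi_of_laplace {P : Measure Ω} [IsProbabilityMeasure P] {η : Ω → Measure X}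
    {μ : Measure X} (hη : Measurable η)
    (hL : ∀ f : X → ℝ≥0∞, Measurable f →
      ∫⁻ ω, expNeg (∫⁻ x, f x ∂η ω) ∂P = expNeg (∫⁻ x, (1 - expNeg (f x)) ∂μ))
    {ι : Type*} [Fintype ι] (B : ι → Set X) (hB : ∀ i, MeasurableSet (B i))
    (hd : Pairwise fun i j => Disjoint (B i) (B j)) :
    P.map (fun ω i => η ω (B i)) = Measure.pi fun i => poissonLaw (μ (B i)) := by
  classical
  have hm : Measurable fun ω i => η ω (B i) :=
    measurable_pi_lambda _ fun i => (Measure.measurable_coe (hB i)).comp hη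
  have := Measure.isProbabilityMeasure_map hm.aemeasurable (μ := P)
  apply measure_ext_of_laplace
  intro m
  have hmm : Measurable fun x : ι → ℝ≥0∞ => ∏ i, expNeg (x i) ^ m i :=
    Finset.measurable_prod _ fun i _ => (measurable_expNeg.comp (measurable_pi_apply i)).pow_const _
  rw [lintegral_map hmm hm]
  have hr : ∫⁻ x : ι → ℝ≥0∞, ∏ i, expNeg (x i) ^ m i ∂(Measure.pi fun i => poissonLaw (μ (B i)))
      = ∏ i, ∫⁻ x, expNeg x ^ m i ∂poissonLaw (μ (B i)) := by
    have hind := iIndepFun_pi (μ := fun i => poissonLaw (μ (B i)))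
      (X := fun i x => expNeg x ^ m i) (fun i => (measurable_expNeg.pow_const _).aemeasurable)
    rw [lintegral_prod_eq_prod_lintegral_of_indepFun Finset.univ _ hind
      (fun i => (measurable_expNeg.comp (measurable_pi_apply i)).pow_const _)]
    refine Finset.prod_congr rfl fun i _ => ?_
    exact (measurePreserving_eval (fun i => poissonLaw (μ (B i))) i).lintegral_comp
      (measurable_expNeg.pow_const _)
  rw [hr]
  simp_rw [lintegral_expNeg_pow_poissonLaw]
  rw [← expNeg_sum]
  let f : X → ℝ≥0∞ := fun x => ∑ i, (B i).indicator (fun _ => (m i : ℝ≥0∞)) x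
  have hf : Measurable f :=
    Finset.measurable_sum _ fun i _ => measurable_const.indicator (hB i)
  have h1 : ∀ ω, ∏ i, expNeg (η ω (B i)) ^ m i = expNeg (∫⁻ x, f x ∂η ω) := by
    intro ω
    rw [lintegral_finsetSum _ fun i _ => measurable_const.indicator (hB i), expNeg_sum]
    refine Finset.prod_congr rfl fun i _ => ?_
    rw [lintegral_indicator_const (hB i), expNeg_nat_mul]
  have h2 : ∀ x, 1 - expNeg (f x) =
      ∑ i, (B i).indicator (fun _ => (1 - expNeg (m i) : ℝ≥0∞)) x := by
    intro x
    by_cases hx : ∃ i, x ∈ B i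
    · obtain ⟨i, hi⟩ := hx
      have hne : ∀ j, j ≠ i → x ∉ B j := fun j hj hxj =>
        Set.disjoint_left.1 (hd hj) hxj hi
      simp only [f]
      rw [Finset.sum_eq_single i, Finset.sum_eq_single i]
      · simp [hi]
      all_goals first | simp; done | exact fun j _ hj => by simp [hne j hj]
    · push Not at hx
      simp [f, hx]
  simp_rw [h1]
  rw [hL f hf]
  congr 1
  simp_rw [h2]
  rw [lintegral_finsetSum _ fun i _ => measurable_const.indicator (hB i)]
  refine Finset.sum_congr rfl fun i _ => ?_
  rw [lintegral_indicator_const (hB i), mul_comm]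

lemma hasLaw_count_of_laplace {P : Measure Ω} [IsProbabilityMeasure P] {η : Ω → Measure X}
    {μ : Measure X} (hη : Measurable η)
    (hL : ∀ f : X → ℝ≥0∞, Measurable f →
      ∫⁻ ω, expNeg (∫⁻ x, f x ∂η ω) ∂P = expNeg (∫⁻ x, (1 - expNeg (f x)) ∂μ))
    {B : Set X} (hB : MeasurableSet B) : HasLaw (fun ω => η ω B) (poissonLaw (μ B)) P := by
  have hm : Measurable fun ω => η ω B := (Measure.measurable_coe hB).comp hη
  refine ⟨hm.aemeasurable, ?_⟩
  have h := map_counts_eq_pi_of_laplace hη hL (fun _ : Unit => B) (fun _ => hB)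
    (fun i j hij => (hij rfl).elim)
  have h2 := congrArg (fun ν => Measure.map (fun x : Unit → ℝ≥0∞ => x ()) ν) h
  rw [Measure.map_map (measurable_pi_apply _) (measurable_pi_lambda _ fun _ => hm)] at h2
  rw [(measurePreserving_eval (fun _ : Unit => poissonLaw (μ B)) ()).map_eq] at h2
  exact h2

lemma iIndepFun_counts_of_laplace {P : Measure Ω} [IsProbabilityMeasure P] {η : Ω → Measure X}
    {μ : Measure X} (hη : Measurable η)
    (hL : ∀ f : X → ℝ≥0∞, Measurable f →
      ∫⁻ ω, expNeg (∫⁻ x, f x ∂η ω) ∂P = expNeg (∫⁻ x, (1 - expNeg (f x)) ∂μ))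
    {ι : Type*} [Fintype ι] (B : ι → Set X) (hB : ∀ i, MeasurableSet (B i))
    (hd : Pairwise fun i j => Disjoint (B i) (B j)) :
    iIndepFun (fun i ω => η ω (B i)) P := by
  have hm : ∀ i, AEMeasurable (fun ω => η ω (B i)) P :=
    fun i => ((Measure.measurable_coe (hB i)).comp hη).aemeasurable
  rw [iIndepFun_iff_map_fun_eq_pi_map hm,
    map_counts_eq_pi_of_laplace hη hL B hB hd]
  congr 1
  ext1 i
  exact (hasLaw_count_of_laplace hη hL (hB i)).map_eq.symm

/-- The counting measure `m` is a countable sum of Dirac masses. -/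
def IsDiracSum (m : Measure X) : Prop :=
  ∃ (ι : Type) (_ : Countable ι) (x : ι → X), m = Measure.sum fun i => Measure.dirac (x i)

open Classical in
/-- The process `η` set to zero where it is infinite on one of the spanning sets of `μ`. -/
def truncProcess (η : Ω → Measure X) (μ : Measure X) [SigmaFinite μ] (ω : Ω) : Measure X :=
  if ∀ k, η ω (spanningSets μ k) < ∞ then η ω else 0

lemma ae_forall_count_lt_top {P : Measure Ω} {η : Ω → Measure X} {μ : Measure X} {B : Set X}
    (hlaw : HasLaw (fun ω => η ω B) (poissonLaw (μ B)) P) (hB : μ B ≠ ∞) :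
    ∀ᵐ ω ∂P, η ω B < ∞ := by
  have h1 : ∀ᵐ x ∂(poissonLaw (μ B)), x < ∞ := by
    rw [ae_iff]
    have : {a : ℝ≥0∞ | ¬ a < ∞} = {∞} := by ext; simp
    rw [this, poissonLaw_apply_top hB]
  rw [← hlaw.map_eq] at h1
  exact ae_of_ae_map hlaw.aemeasurable h1

lemma ae_count_eq_top {P : Measure Ω} {η : Ω → Measure X} {μ : Measure X} {B : Set X}
    (hlaw : HasLaw (fun ω => η ω B) (poissonLaw (μ B)) P) (hB : μ B = ∞) :
    ∀ᵐ ω ∂P, η ω B = ∞ := by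
  have h1 : ∀ᵐ x ∂(poissonLaw (μ B)), x = ∞ := by
    rw [hB, poissonLaw_top, ae_dirac_eq]; rfl
  rw [← hlaw.map_eq] at h1
  exact ae_of_ae_map hlaw.aemeasurable h1

lemma measure_count_eq_zero {P : Measure Ω} {η : Ω → Measure X} {μ : Measure X} {B : Set X}
    (hlaw : HasLaw (fun ω => η ω B) (poissonLaw (μ B)) P) :
    P {ω | η ω B = 0} = expNeg (μ B) := by
  rw [← poissonLaw_apply_zero, ← hlaw.map_eq,
    Measure.map_apply_of_aemeasurable hlaw.aemeasurable (measurableSet_singleton _)]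
  rfl

lemma measure_count_ne_zero_le {P : Measure Ω} [IsProbabilityMeasure P] {η : Ω → Measure X}
    (hη : Measurable η) {μ : Measure X} {B : Set X} (hBm : MeasurableSet B)
    (hlaw : HasLaw (fun ω => η ω B) (poissonLaw (μ B)) P) :
    P {ω | η ω B ≠ 0} ≤ μ B := by
  have hm : MeasurableSet {ω | η ω B = 0} :=
    ((Measure.measurable_coe hBm).comp hη) (measurableSet_singleton 0)
  have : {ω | η ω B ≠ 0} = {ω | η ω B = 0}ᶜ := rfl
  rw [this, prob_compl_eq_one_sub hm, measure_count_eq_zero hlaw]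
  exact one_sub_expNeg_le _

lemma truncProcess_ae_eq {P : Measure Ω} {η : Ω → Measure X} {μ : Measure X} [SigmaFinite μ]
    (hlaw : ∀ B : Set X, MeasurableSet B → HasLaw (fun ω => η ω B) (poissonLaw (μ B)) P) :
    ∀ᵐ ω ∂P, truncProcess η μ ω = η ω := by
  have : ∀ᵐ ω ∂P, ∀ k, η ω (spanningSets μ k) < ∞ := by
    rw [ae_all_iff]
    exact fun k => ae_forall_count_lt_top (hlaw _ (measurableSet_spanningSets μ k))
      (measure_spanningSets_lt_top μ k).ne
  filter_upwards [this] with ω hω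
  simp only [truncProcess]
  rw [if_pos hω]

lemma sigmaFinite_of_spanningSets {m μ : Measure X} [SigmaFinite μ]
    (h : ∀ k, m (spanningSets μ k) < ∞) : SigmaFinite m :=
  ⟨⟨⟨spanningSets μ, fun _ => trivial, h, iUnion_spanningSets μ⟩⟩⟩

/-- The definition demands σ-finiteness for every `ω`, whereas the counts of the spanning sets are
finite only almost surely. The truncation changes `η` on a null set, which affects neither laws nor
independence. -/
lemma isPoissonProcess_truncProcess {P : Measure Ω} {η : Ω → Measure X} {μ : Measure X}
    [SigmaFinite μ] (hη : Measurable η) (hc : ∀ ω, IsDiracSum (η ω))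
    (hlaw : ∀ B : Set X, MeasurableSet B → HasLaw (fun ω => η ω B) (poissonLaw (μ B)) P)
    (hind : ∀ (n : ℕ) (B : Fin n → Set X), (∀ i, MeasurableSet (B i)) →
      Pairwise (fun i j => Disjoint (B i) (B j)) → iIndepFun (fun i ω => η ω (B i)) P) :
    IsPoissonProcess (truncProcess η μ) μ P := by
  classical
  have hae := truncProcess_ae_eq hlaw
  refine ⟨?_, ?_, ?_, ?_⟩
  · refine Measurable.ite ?_ hη measurable_const
    rw [show {a | ∀ k, η a (spanningSets μ k) < ∞} = ⋂ k, {a | η a (spanningSets μ k) < ∞} by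
      ext; simp]
    exact MeasurableSet.iInter fun k => measurableSet_lt
      ((Measure.measurable_coe (measurableSet_spanningSets μ k)).comp hη) measurable_const
  · intro ω
    simp only [truncProcess]
    split_ifs with h
    · exact ⟨sigmaFinite_of_spanningSets h, hc ω⟩
    · exact ⟨inferInstance, Empty, inferInstance, Empty.elim, by simp⟩
  · intro B hB
    refine (hlaw B hB).congr ?_
    filter_upwards [hae] with ω hω
    rw [hω]
  · intro n B hB hd
    refine (hind n B hB hd).congr fun i => ?_
    filter_upwards [hae] with ω hω
    rw [hω]

end

/-! ### Existence of Poisson processes -/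

section

variable {Y : Type*} [MeasurableSpace Y]

/-- The point process which consists, for each `k`, of the first `(w k).1` points of the sequence
`(w k).2`. -/
def samplePoints (w : ℕ → ℕ × (ℕ → Y)) : Measure Y :=
  Measure.sum fun i : (Σ k : ℕ, Fin (w k).1) => Measure.dirac ((w i.1).2 i.2)

lemma isDiracSum_samplePoints (w : ℕ → ℕ × (ℕ → Y)) : IsDiracSum (samplePoints w) :=
  ⟨_, inferInstance, _, rfl⟩

lemma lintegral_samplePoints (w : ℕ → ℕ × (ℕ → Y)) {f : Y → ℝ≥0∞} (hf : Measurable f) :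
    ∫⁻ y, f y ∂samplePoints w = ∑' k, ∑ j ∈ Finset.range (w k).1, f ((w k).2 j) := by
  rw [samplePoints, lintegral_sum_measure,
    ENNReal.tsum_sigma' fun i : (Σ k : ℕ, Fin (w k).1) =>
      ∫⁻ y, f y ∂Measure.dirac ((w i.1).2 i.2)]
  congr 1
  ext1 k
  rw [tsum_fintype, ← Fin.sum_univ_eq_sum_range (fun j => f ((w k).2 j))]
  refine Finset.sum_congr rfl fun j _ => ?_
  rw [lintegral_dirac' _ hf]

lemma measurable_sum_range_sample {f : Y → ℝ≥0∞} (hf : Measurable f) :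
    Measurable fun z : ℕ × (ℕ → Y) => ∑ j ∈ Finset.range z.1, f (z.2 j) :=
  measurable_from_prod_countable_right fun n =>
    Finset.measurable_fun_sum (Finset.range n) fun j _ => hf.comp (measurable_pi_apply j)

lemma measurable_samplePoints : Measurable (samplePoints : (ℕ → ℕ × (ℕ → Y)) → Measure Y) := by
  refine Measure.measurable_of_measurable_coe _ fun B hB => ?_
  have h1 : ∀ w : ℕ → ℕ × (ℕ → Y), samplePoints w B =
      ∑' k, ∑ j ∈ Finset.range (w k).1, B.indicator 1 ((w k).2 j) := by
    intro w
    rw [← lintegral_samplePoints w (measurable_one.indicator hB), lintegral_indicator_one hB]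
  simp_rw [h1]
  exact Measurable.tsum fun k =>
    (measurable_sum_range_sample (measurable_one.indicator hB)).comp (measurable_pi_apply k)

/-- Given that `n` points are sampled, independence yields the `n`-th power of the mean of `g`;
averaging over `n` is an evaluation of the Poisson generating function. -/
lemma lintegral_prod_range_sample (p : Measure Y) [IsProbabilityMeasure p] (r : NNReal)
    {g : Y → ℝ≥0∞} (hg : Measurable g) (hg1 : ∀ y, g y ≤ 1) :
    ∫⁻ z : ℕ × (ℕ → Y), ∏ j ∈ Finset.range z.1, g (z.2 j)
      ∂((poissonMeasure r).prod (Measure.infinitePi fun _ : ℕ => p)) =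
    expNeg (∫⁻ y, (1 - g y) ∂((r : ℝ≥0∞) • p)) := by
  have hm : Measurable fun z : ℕ × (ℕ → Y) => ∏ j ∈ Finset.range z.1, g (z.2 j) :=
    measurable_from_prod_countable_right fun n =>
      Finset.measurable_fun_prod (Finset.range n) fun j _ => hg.comp (measurable_pi_apply j)
  rw [lintegral_prod _ hm.aemeasurable]
  have hle : ∫⁻ y, g y ∂p ≤ 1 := by
    calc ∫⁻ y, g y ∂p ≤ ∫⁻ _, 1 ∂p := lintegral_mono hg1
      _ = 1 := by simp
  have h1 : ∀ n : ℕ, ∫⁻ y : ℕ → Y, ∏ j ∈ Finset.range n, g (y j)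
      ∂(Measure.infinitePi fun _ : ℕ => p) = (∫⁻ y, g y ∂p) ^ n := by
    intro n
    have hind := iIndepFun_infinitePi (P := fun _ : ℕ => p) (X := fun _ => g) (fun _ => hg)
    rw [lintegral_prod_eq_prod_lintegral_of_indepFun _ _ hind
      fun j => hg.comp (measurable_pi_apply j)]
    have : ∀ j : ℕ, ∫⁻ y : ℕ → Y, g (y j) ∂(Measure.infinitePi fun _ : ℕ => p) = ∫⁻ y, g y ∂p :=
      fun j => (measurePreserving_eval_infinitePi (fun _ : ℕ => p) j).lintegral_comp hg
    simp [this]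
  simp_rw [h1]
  rw [lintegral_pow_poissonMeasure _ hle, lintegral_smul_measure,
    lintegral_sub hg (hle.trans_lt ENNReal.one_lt_top).ne (ae_of_all _ hg1)]
  simp

/-- Superposition of independent pieces: for the first `K` pieces the functional factors, and `K →
∞` is a bounded limit because `expNeg` is continuous on `[0, ∞]`. -/
lemma lintegral_expNeg_samplePoints (p : ℕ → Measure Y) [∀ k, IsProbabilityMeasure (p k)]
    (r : ℕ → NNReal) {f : Y → ℝ≥0∞} (hf : Measurable f) :
    ∫⁻ w, expNeg (∫⁻ y, f y ∂samplePoints w) ∂(Measure.infinitePi fun k =>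
      (poissonMeasure (r k)).prod (Measure.infinitePi fun _ : ℕ => p k)) =
    expNeg (∫⁻ y, (1 - expNeg (f y)) ∂(Measure.sum fun k => (r k : ℝ≥0∞) • p k)) := by
  set Q := fun k => (poissonMeasure (r k)).prod (Measure.infinitePi fun _ : ℕ => p k) with hQ
  simp_rw [lintegral_samplePoints _ hf]
  have hS : ∀ k : ℕ, Measurable fun w : ℕ → ℕ × (ℕ → Y) =>
      ∑ j ∈ Finset.range (w k).1, f ((w k).2 j) := fun k =>
    (measurable_sum_range_sample hf).comp (measurable_pi_apply k)
  have hlim : Tendsto (fun K => ∫⁻ w, expNeg (∑ k ∈ Finset.range K,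
      ∑ j ∈ Finset.range (w k).1, f ((w k).2 j)) ∂(Measure.infinitePi Q)) atTop
      (𝓝 (∫⁻ w, expNeg (∑' k, ∑ j ∈ Finset.range (w k).1, f ((w k).2 j))
        ∂(Measure.infinitePi Q))) := by
    refine tendsto_lintegral_of_dominated_convergence (fun _ => 1) (fun K => ?_) (fun K => ?_) ?_ ?_
    · exact measurable_expNeg.comp (Finset.measurable_sum _ fun k _ => hS k)
    · exact ae_of_all _ fun w => expNeg_le_one _
    · simp
    · exact ae_of_all _ fun w => (continuous_expNeg.tendsto _).comp
        (ENNReal.tendsto_nat_tsum _)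
  have hval : ∀ K, ∫⁻ w, expNeg (∑ k ∈ Finset.range K,
      ∑ j ∈ Finset.range (w k).1, f ((w k).2 j)) ∂(Measure.infinitePi Q) =
      expNeg (∑ k ∈ Finset.range K, ∫⁻ y, (1 - expNeg (f y)) ∂((r k : ℝ≥0∞) • p k)) := by
    intro K
    have hmg : Measurable fun z : ℕ × (ℕ → Y) => ∏ j ∈ Finset.range z.1, expNeg (f (z.2 j)) :=
      measurable_from_prod_countable_right fun n =>
        Finset.measurable_fun_prod (Finset.range n) fun j _ =>
          (measurable_expNeg.comp hf).comp (measurable_pi_apply j)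
    have hind := iIndepFun_infinitePi (P := Q) (X := fun _ (z : ℕ × (ℕ → Y)) =>
      ∏ j ∈ Finset.range z.1, expNeg (f (z.2 j))) (fun _ => hmg)
    simp_rw [expNeg_sum]
    rw [lintegral_prod_eq_prod_lintegral_of_indepFun _ _ hind
      fun k => hmg.comp (measurable_pi_apply k)]
    refine Finset.prod_congr rfl fun k _ => ?_
    rw [(measurePreserving_eval_infinitePi Q k).lintegral_comp hmg]
    exact lintegral_prod_range_sample (p k) (r k) (measurable_expNeg.comp hf)
      fun y => expNeg_le_one _
  simp_rw [hval] at hlim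
  refine tendsto_nhds_unique hlim ?_
  rw [lintegral_sum_measure]
  exact (continuous_expNeg.tendsto _).comp (ENNReal.tendsto_nat_tsum _)

lemma exists_sum_smul_probability [Nonempty Y] (μ : Measure Y) [SFinite μ] :
    ∃ (r : ℕ → NNReal) (p : ℕ → Measure Y), (∀ k, IsProbabilityMeasure (p k)) ∧
      μ = Measure.sum fun k => (r k : ℝ≥0∞) • p k := by
  classical
  have h : ∀ k, ∃ (r : NNReal) (p : Measure Y), IsProbabilityMeasure p ∧
      sfiniteSeq μ k = (r : ℝ≥0∞) • p := by
    intro k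
    by_cases h0 : sfiniteSeq μ k = 0
    -- A vanishing piece has weight `0`, so any probability measure will do; this is where a point
    -- of `Y` is needed.
    · exact ⟨0, Measure.dirac (Classical.arbitrary Y), inferInstance, by simp [h0]⟩
    · have hu : sfiniteSeq μ k univ ≠ 0 := by simpa using h0
      refine ⟨(sfiniteSeq μ k univ).toNNReal, (sfiniteSeq μ k univ)⁻¹ • sfiniteSeq μ k,
        ⟨?_⟩, ?_⟩
      · rw [Measure.smul_apply, smul_eq_mul, ENNReal.inv_mul_cancel hu (measure_ne_top _ _)]
      · rw [ENNReal.coe_toNNReal (measure_ne_top _ _), smul_smul,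
          ENNReal.mul_inv_cancel hu (measure_ne_top _ _), one_smul]
  choose r p hp hr using h
  refine ⟨r, p, hp, ?_⟩
  conv_lhs => rw [← sum_sfiniteSeq μ]
  congr 1
  ext1 k
  exact hr k

end

/-- Every `s`-finite measure is the intensity of a process with Poisson Laplace functional. -/
lemma exists_poisson_laplace {Y : Type} [MeasurableSpace Y] [Nonempty Y] (μ : Measure Y)
    [SFinite μ] :
    ∃ (W : Type) (_ : MeasurableSpace W) (Pr : Measure W) (_ : IsProbabilityMeasure Pr)
      (N : W → Measure Y), Measurable N ∧ (∀ w, IsDiracSum (N w)) ∧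
      ∀ f : Y → ℝ≥0∞, Measurable f →
        ∫⁻ w, expNeg (∫⁻ x, f x ∂N w) ∂Pr = expNeg (∫⁻ x, (1 - expNeg (f x)) ∂μ) := by
  obtain ⟨r, p, hp, hμ⟩ := exists_sum_smul_probability μ
  refine ⟨ℕ → ℕ × (ℕ → Y), inferInstance, Measure.infinitePi fun k =>
      (poissonMeasure (r k)).prod (Measure.infinitePi fun _ : ℕ => p k), inferInstance,
    samplePoints, measurable_samplePoints, isDiracSum_samplePoints, fun f hf => ?_⟩
  rw [lintegral_expNeg_samplePoints p r hf, ← hμ]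

/-! ### The law of a Poisson process is determined by its intensity -/

section

variable {X : Type*} [MeasurableSpace X]

/-- The cell of the partition generated by the sets `B i` which lies in exactly the sets `B i`
with `i ∈ s`. -/
def partCell {X ι : Type*} (B : ι → Set X) (s : Set ι) : Set X := {x | ∀ i, x ∈ B i ↔ i ∈ s}

lemma measurableSet_partCell {ι : Type*} [Finite ι] {B : ι → Set X}
    (hB : ∀ i, MeasurableSet (B i)) (s : Set ι) : MeasurableSet (partCell B s) := by
  have : partCell B s = ⋂ i, {x | x ∈ B i ↔ i ∈ s} := by ext; simp [partCell]
  rw [this]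
  refine MeasurableSet.iInter fun i => ?_
  by_cases hi : i ∈ s
  · simp only [hi, iff_true]; exact hB i
  · simp only [hi, iff_false]; exact (hB i).compl

lemma disjoint_partCell {X ι : Type*} (B : ι → Set X) {s t : Set ι} (h : s ≠ t) :
    Disjoint (partCell B s) (partCell B t) := by
  rw [Set.disjoint_left]
  intro x hs ht
  exact h (Set.ext fun i => (hs i).symm.trans (ht i))

lemma measure_eq_sum_partCell {ι : Type*} [Fintype ι] [DecidableEq ι] {B : ι → Set X}
    (hB : ∀ i, MeasurableSet (B i)) (m : Measure X) (i : ι) :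
    m (B i) = ∑ s : Finset ι, if i ∈ s then m (partCell B s) else 0 := by
  rw [← Finset.sum_filter, ← measure_biUnion_finset]
  · congr 1
    ext x
    classical
    simp only [Finset.mem_filter, Finset.mem_univ, true_and, mem_iUnion, exists_prop]
    constructor
    · intro hx
      exact ⟨Finset.univ.filter fun j => x ∈ B j, by simpa using hx, fun j => by simp⟩
    · rintro ⟨s, hs, hx⟩
      exact (hx i).2 hs
  · intro s _ t _ hst
    exact disjoint_partCell B fun h => hst (Finset.coe_injective h)
  · exact fun s _ => measurableSet_partCell hB _

variable {Ω Ω' : Type*} [MeasurableSpace Ω] [MeasurableSpace Ω']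

lemma IsPoissonProcess.iIndepFun_counts {η : Ω → Measure X} {μ : Measure X} {P : Measure Ω}
    (h : IsPoissonProcess η μ P) {ι : Type*} [Fintype ι] (B : ι → Set X)
    (hB : ∀ i, MeasurableSet (B i)) (hd : Pairwise fun i j => Disjoint (B i) (B j)) :
    iIndepFun (fun i ω => η ω (B i)) P := by
  let e := Fintype.equivFin ι
  have h1 := h.indep (Fintype.card ι) (B ∘ e.symm) (fun i => hB _)
    (fun i j hij => hd (fun he => hij (e.symm.injective he)))
  have h2 := h1.precomp e.injective
  simpa [Function.comp_def] using h2

lemma IsPoissonProcess.measurable_count {η : Ω → Measure X} {μ : Measure X} {P : Measure Ω}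
    (h : IsPoissonProcess η μ P) {B : Set X} (hB : MeasurableSet B) :
    Measurable fun ω => η ω B := (Measure.measurable_coe hB).comp h.measurable

/-- Counts of overlapping sets are sums of the independent counts of the cells of the partition they
generate. The right-hand side involves the process through `μ` alone. -/
lemma IsPoissonProcess.map_counts {η : Ω → Measure X} {μ : Measure X} {P : Measure Ω}
    [IsProbabilityMeasure P]
    (h : IsPoissonProcess η μ P) {ι : Type*} [Fintype ι] [DecidableEq ι] (B : ι → Set X)
    (hB : ∀ i, MeasurableSet (B i)) :
    P.map (fun ω i => η ω (B i)) =
      (Measure.pi fun s : Finset ι => poissonLaw (μ (partCell B s))).map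
        fun x i => ∑ s : Finset ι, if i ∈ s then x s else 0 := by
  have hm : ∀ s : Finset ι, Measurable fun ω => η ω (partCell B s) := fun s =>
    h.measurable_count (measurableSet_partCell hB _)
  have h1 : P.map (fun ω (s : Finset ι) => η ω (partCell B s)) =
      Measure.pi fun s : Finset ι => poissonLaw (μ (partCell B s)) := by
    have hi := h.iIndepFun_counts (fun s : Finset ι => partCell B s)
      (fun s => measurableSet_partCell hB _)
      (fun s t hst => disjoint_partCell B fun he => hst (Finset.coe_injective he))
    rw [hi.map_fun_eq_pi_map fun s => (hm s).aemeasurable]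
    congr 1
    ext1 s
    exact (h.law _ (measurableSet_partCell hB _)).map_eq
  rw [← h1, Measure.map_map]
  · congr 1
    ext ω i
    exact measure_eq_sum_partCell hB (η ω) i
  · refine measurable_pi_lambda _ fun i => Finset.measurable_sum _ fun s _ => ?_
    split_ifs
    · exact measurable_pi_apply s
    · exact measurable_const
  · exact measurable_pi_lambda _ hm

/-- Two Poisson processes with the same intensity measure have the same law. -/
theorem IsPoissonProcess.map_eq_map {η : Ω → Measure X} {η' : Ω' → Measure X} {μ : Measure X}
    {P : Measure Ω} {P' : Measure Ω'} [IsProbabilityMeasure P] [IsProbabilityMeasure P']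
    (h : IsPoissonProcess η μ P) (h' : IsPoissonProcess η' μ P') :
    P.map η = P'.map η' := by
  classical
  let E : Type _ := {B : Set X // MeasurableSet B}
  let ev : Measure X → E → ℝ≥0∞ := fun m B => m B.1
  have hev : Measurable ev := measurable_pi_lambda _ fun B => Measure.measurable_coe B.2
  -- The `σ`-field on measures is pulled back along the family of all counts, so it suffices to
  -- compare laws on a product space. There finite-dimensional projections decide.
  have hcomap : (Measure.instMeasurableSpace : MeasurableSpace (Measure X)) =
      MeasurableSpace.comap ev MeasurableSpace.pi := by
    refine le_antisymm ?_ hev.comap_le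
    refine iSup₂_le fun B hB => ?_
    have : (fun m : Measure X => m B) = (fun x : E → ℝ≥0∞ => x ⟨B, hB⟩) ∘ ev := rfl
    rw [this, ← MeasurableSpace.comap_comp]
    exact MeasurableSpace.comap_mono (measurable_pi_apply _).comap_le
  have hfd : ∀ I : Finset E, P.map (fun ω (i : I) => η ω i.1.1) =
      P'.map (fun ω (i : I) => η' ω i.1.1) := by
    intro I
    rw [h.map_counts (fun i : I => i.1.1) (fun i => i.1.2),
      h'.map_counts (fun i : I => i.1.1) (fun i => i.1.2)]
  have heq : (P.map η).map ev = (P'.map η').map ev := by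
    have hp : IsProbabilityMeasure (P'.map η') :=
      Measure.isProbabilityMeasure_map h'.measurable.aemeasurable
    have hp2 : IsProbabilityMeasure ((P'.map η').map ev) :=
      Measure.isProbabilityMeasure_map hev.aemeasurable
    refine IsProjectiveLimit.unique (P := fun I => ((P'.map η').map ev).map I.restrict)
      (fun I => ?_) (fun I => rfl)
    beta_reduce
    rw [Measure.map_map hev h.measurable, Measure.map_map hev h'.measurable,
      Measure.map_map (Finset.measurable_restrict I) (hev.comp h.measurable),
      Measure.map_map (Finset.measurable_restrict I) (hev.comp h'.measurable)]
    exact hfd I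
  ext V hV
  rw [hcomap] at hV
  obtain ⟨V', hV', rfl⟩ := hV
  rw [← Measure.map_apply hev hV', ← Measure.map_apply hev hV', heq]

end

/-! ### Geometry of dual Laguerre tessellations -/

section

variable {d : ℕ}

/-- A region which contains all weighted points `x` with `power w x ≤ t` for some `w` with
`‖w‖ ≤ r`. -/
def powerRegion (d : ℕ) (r t : ℝ) : Set (Space d × ℝ) :=
  {x | x.2 ≤ t ∧ ‖x.1‖ ≤ r + √(t - x.2)}

lemma isClosed_powerRegion (r t : ℝ) : IsClosed (powerRegion d r t) :=
  (isClosed_le continuous_snd continuous_const).inter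
    (isClosed_le (continuous_fst.norm) (by fun_prop))

lemma mem_powerRegion {r t : ℝ} {w : Space d} {x : Space d × ℝ} (hw : ‖w‖ ≤ r)
    (h : power w x ≤ t) : x ∈ powerRegion d r t := by
  have h0 : ‖w - x.1‖ ^ 2 + x.2 ≤ t := h
  have h1 : 0 ≤ ‖w - x.1‖ ^ 2 := sq_nonneg _
  refine ⟨by linarith, ?_⟩
  have h2 : ‖w - x.1‖ ≤ √(t - x.2) := Real.le_sqrt_of_sq_le (by linarith)
  have h3 : ‖x.1‖ ≤ ‖w‖ + ‖w - x.1‖ := by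
    have := norm_sub_le w (w - x.1)
    simpa using this
  linarith

/-- The quadratic term in `w` is the same for all weighted points, so comparing two powers is an
affine condition on `w`. Convexity of cells and the bound on common points rest on this. -/
lemma power_eq (w : Space d) (x : Space d × ℝ) :
    power w x = ‖w‖ ^ 2 - 2 * inner ℝ w x.1 + power 0 x := by
  simp only [power, zero_sub, norm_neg]
  rw [norm_sub_sq_real]
  ring

lemma power_le (w : Space d) (x : Space d × ℝ) : power w x ≤ (‖w‖ + ‖x.1‖) ^ 2 + x.2 := by
  simp only [power]
  gcongr
  exact norm_sub_le _ _

lemma isClosed_laguerreCell (x : Space d × ℝ) (X : Set (Space d × ℝ)) :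
    IsClosed (laguerreCell x X) := by
  have : laguerreCell x X = ⋂ y ∈ X, {w | power w x ≤ power w y} := by
    ext; simp [laguerreCell]
  rw [this]
  refine isClosed_biInter fun y _ => isClosed_le ?_ ?_ <;> (unfold power; fun_prop)

lemma convex_laguerreCell (x : Space d × ℝ) (X : Set (Space d × ℝ)) :
    Convex ℝ (laguerreCell x X) := by
  have : laguerreCell x X = ⋂ y ∈ X, {w : Space d |
      (2 • (innerSL ℝ (y.1 - x.1)).toLinearMap) w ≤ power 0 y - power 0 x} := by
    ext w
    simp only [laguerreCell, mem_ofPred_eq, mem_iInter]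
    refine forall₂_congr fun y _ => ?_
    rw [power_eq w x, power_eq w y]
    simp only [LinearMap.smul_apply, ContinuousLinearMap.coe_coe, innerSL_apply_apply,
      inner_sub_left, nsmul_eq_mul, Nat.cast_ofNat]
    rw [real_inner_comm w y.1, real_inner_comm w x.1]
    constructor <;> intro h <;> linarith
  rw [this]
  exact convex_iInter₂ fun y _ => convex_halfSpace_le (LinearMap.isLinear _) _

/-- If a simplex spanned by minimizers of the power at `w` meets the ball of radius `R`, and the
points of `X` surround that ball, then `w` cannot be far from the origin. -/
lemma two_mul_norm_le_of_convexHull {ι : Type*} {X : Set (Space d × ℝ)} {x : ι → Space d × ℝ}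
    {w u : Space d} {R C g : ℝ} (hx : ∀ i, x i ∈ X) (hw : ∀ i, w ∈ laguerreCell (x i) X)
    (hu : u ∈ convexHull ℝ (range fun i => (x i).1)) (huR : ‖u‖ ≤ R)
    (hC : ∀ w : Space d, ∃ y ∈ X, (R + 1) * ‖w‖ ≤ inner ℝ w y.1 ∧ power 0 y ≤ C)
    (hg : ∀ y ∈ X, g ≤ power 0 y) : 2 * ‖w‖ ≤ C - g := by
  obtain ⟨y, hy, hy1, hy2⟩ := hC w
  -- Comparison with the surrounding point `y` puts all vertices, hence `u`, into a half-space
  -- normal to `w`. There `y` contributes `2 (R + 1) ‖w‖` while `u` reaches at most `2 R ‖w‖`; the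
  -- surplus `2 ‖w‖` comes from the margin `1`.
  have hsub : convexHull ℝ (range fun i => (x i).1) ⊆
      {z : Space d | ‖w‖ ^ 2 + g - power w y ≤ (2 • (innerSL ℝ w).toLinearMap) z} := by
    refine convexHull_min ?_ (convex_halfSpace_ge (LinearMap.isLinear _) _)
    rintro _ ⟨i, rfl⟩
    have h1 := hw i y hy
    rw [power_eq w (x i)] at h1
    have h2 := hg _ (hx i)
    simp only [mem_ofPred_eq, LinearMap.smul_apply, ContinuousLinearMap.coe_coe,
      innerSL_apply_apply, nsmul_eq_mul, Nat.cast_ofNat]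
    linarith
  have h3 := hsub hu
  simp only [mem_ofPred_eq, LinearMap.smul_apply, ContinuousLinearMap.coe_coe,
    innerSL_apply_apply, nsmul_eq_mul, Nat.cast_ofNat] at h3
  rw [power_eq w y] at h3
  have h4 := real_inner_le_norm w u
  have h5 : ‖w‖ * ‖u‖ ≤ ‖w‖ * R := by gcongr
  nlinarith

/-! ### Stabilization of the skeleton in a ball -/

/-- The configuration `X` determines its skeleton in the ball of radius `R` by its points in
`powerRegion d r t`. -/
structure Stabilizes (R r t : ℝ) (X : Set (Space d × ℝ)) : Prop where
  nonneg : 0 ≤ r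
  cover : ∀ w : Space d, ‖w‖ ≤ r → ∃ x ∈ X, power w x ≤ t
  surround : ∃ C g : ℝ, (∀ w : Space d, ∃ y ∈ X, (R + 1) * ‖w‖ ≤ inner ℝ w y.1 ∧ power 0 y ≤ C ∧
    y ∈ powerRegion d r t) ∧ (∀ y ∈ X, g ≤ power 0 y) ∧ g ≤ t ∧ C - g < 2 * r

/-- All points witnessing `cover` and `surround` lie in the region, and a point outside it has power
above `t ≥ g` at the origin. Hence stabilization itself depends only on the points in the region. -/
lemma Stabilizes.of_inter_eq {R r t : ℝ} {X Y : Set (Space d × ℝ)} (hX : Stabilizes R r t X)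
    (h : X ∩ powerRegion d r t = Y ∩ powerRegion d r t) : Stabilizes R r t Y := by
  have hXY : ∀ x ∈ X, x ∈ powerRegion d r t → x ∈ Y := fun x hx hp =>
    (h ▸ (⟨hx, hp⟩ : x ∈ X ∩ powerRegion d r t) : x ∈ Y ∩ powerRegion d r t).1
  have hYX : ∀ x ∈ Y, x ∈ powerRegion d r t → x ∈ X := fun x hx hp =>
    (h.symm ▸ (⟨hx, hp⟩ : x ∈ Y ∩ powerRegion d r t) : x ∈ X ∩ powerRegion d r t).1
  obtain ⟨C, g, h1, h2, h3, h4⟩ := hX.surround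
  refine ⟨hX.nonneg, fun w hw => ?_, C, g, fun w => ?_, fun y hy => ?_, h3, h4⟩
  · obtain ⟨x, hx, hp⟩ := hX.cover w hw
    exact ⟨x, hXY x hx (mem_powerRegion hw hp), hp⟩
  · obtain ⟨y, hy, ha, hb, hc⟩ := h1 w
    exact ⟨y, hXY y hy hc, ha, hb, hc⟩
  · by_cases hp : y ∈ powerRegion d r t
    · exact h2 y (hYX y hy hp)
    · by_contra hlt
      exact hp (mem_powerRegion (w := 0) (by simpa using hX.nonneg) (by linarith))

lemma frontier_subset_convexHull_range {ι : Type*} [Finite ι] (v : ι → Space d) :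
    frontier (convexHull ℝ (range v)) ⊆ convexHull ℝ (range v) := by
  have hc : IsClosed (convexHull ℝ (range v)) :=
    ((finite_range v).isCompact_convexHull ℝ).isClosed
  exact hc.frontier_subset

/-- Over the ball of radius `r` the least power is at most `t`: minimizers lie in the region, and
points outside it cannot undercut them. Membership in cells therefore transfers from `X` to `Y` over
this ball, and the common point of a relevant simplex lies strictly inside it. -/
lemma Stabilizes.skel_inter_subset {R r t : ℝ} {X Y : Set (Space d × ℝ)}
    (hX : Stabilizes R r t X)
    (h : X ∩ powerRegion d r t = Y ∩ powerRegion d r t) :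
    skel (dualLaguerre d X) ∩ Metric.closedBall 0 R ⊆ skel (dualLaguerre d Y) := by
  have hXY : ∀ x ∈ X, x ∈ powerRegion d r t → x ∈ Y := fun x hx hp =>
    (h ▸ (⟨hx, hp⟩ : x ∈ X ∩ powerRegion d r t) : x ∈ Y ∩ powerRegion d r t).1
  have hYX : ∀ x ∈ Y, x ∈ powerRegion d r t → x ∈ X := fun x hx hp =>
    (h.symm ▸ (⟨hx, hp⟩ : x ∈ Y ∩ powerRegion d r t) : x ∈ X ∩ powerRegion d r t).1
  have hcell : ∀ x w, ‖w‖ ≤ r → w ∈ laguerreCell x X →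
      power w x ≤ t ∧ w ∈ laguerreCell x Y := by
    intro x w hw hx
    obtain ⟨z, hz, hzt⟩ := hX.cover w hw
    have hxt := (hx z hz).trans hzt
    refine ⟨hxt, fun y hy => ?_⟩
    by_cases hp : y ∈ powerRegion d r t
    · exact hx y (hYX y hy hp)
    · by_contra hlt
      exact hp (mem_powerRegion hw (by linarith))
  rintro u ⟨hu, huR⟩
  simp only [skel, mem_iUnion] at hu ⊢
  obtain ⟨c, ⟨x, hinj, hx, hInt, ⟨w, hw⟩, rfl⟩, huc⟩ := hu
  rw [mem_iInter] at hw
  obtain ⟨C, g, h1, h2, h3, h4⟩ := hX.surround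
  have hwr : ‖w‖ < r := by
    have := two_mul_norm_le_of_convexHull hx hw (frontier_subset_convexHull_range _ huc)
      (by simpa using huR)
      (fun w => by obtain ⟨y, a, b, c, _⟩ := h1 w; exact ⟨y, a, b, c⟩) h2
    linarith
  refine ⟨_, ⟨x, hinj, fun i => ?_, fun i => ?_, ⟨w, ?_⟩, rfl⟩, huc⟩
  · exact hXY _ (hx i) (mem_powerRegion hwr.le (hcell _ w hwr.le (hw i)).1)
  · obtain ⟨z, hz⟩ := hInt i
    -- The given interior point may be far away. But a convex cell with non-empty interior lies in
    -- the closure of its interior, so interior points occur close to `w`, where membership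
    -- transfers.
    have hwcl : w ∈ closure (interior (laguerreCell (x i) X)) := by
      rw [(convex_laguerreCell (x i) X).closure_interior_eq_closure_of_nonempty_interior ⟨z, hz⟩]
      exact subset_closure (hw i)
    obtain ⟨z', hz', hz''⟩ := mem_closure_iff.1 hwcl (Metric.ball 0 r) Metric.isOpen_ball
      (by simpa using hwr)
    refine ⟨z', interior_maximal (t := Metric.ball 0 r ∩ interior (laguerreCell (x i) X)) ?_
      (Metric.isOpen_ball.inter isOpen_interior) ⟨hz', hz''⟩⟩
    rintro a ⟨ha, hai⟩
    exact (hcell _ a (by simpa using (mem_ball_zero_iff.1 ha).le) (interior_subset hai)).2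
  · rw [mem_iInter]
    exact fun i => (hcell _ w hwr.le (hw i)).2

lemma Stabilizes.skel_inter_eq {R r t : ℝ} {X Y : Set (Space d × ℝ)} (hX : Stabilizes R r t X)
    (h : X ∩ powerRegion d r t = Y ∩ powerRegion d r t) :
    skel (dualLaguerre d X) ∩ Metric.closedBall 0 R =
      skel (dualLaguerre d Y) ∩ Metric.closedBall 0 R :=
  Subset.antisymm (subset_inter (hX.skel_inter_subset h) inter_subset_right)
    (subset_inter ((hX.of_inter_eq h).skel_inter_subset h.symm) inter_subset_right)

/-- By density some point of `X` projects far out in any given unit direction; compactness of the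
sphere leaves finitely many points, and homogeneity in `w` does the rest. An extra point `y₀` serves
`w = 0`. -/
lemma exists_finset_surround {X : Set (Space d × ℝ)} (hX : Dense (Prod.fst '' X)) (R : ℝ) :
    ∃ F : Finset (Space d × ℝ), ↑F ⊆ X ∧
      ∀ w : Space d, ∃ y ∈ F, (R + 1) * ‖w‖ ≤ inner ℝ w y.1 := by
  classical
  obtain ⟨_, y₀, hy₀, -⟩ := hX.nonempty
  have hcov : Metric.sphere (0 : Space d) 1 ⊆
      ⋃ y : X, {e : Space d | R + 1 < inner ℝ e y.1.1} := by
    intro e he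
    have he1 : ‖e‖ = 1 := by simpa using he
    have ho : IsOpen {z : Space d | R + 1 < inner ℝ e z} :=
      isOpen_lt continuous_const (by fun_prop)
    obtain ⟨z, hz, ⟨y, hy, rfl⟩⟩ := hX.inter_open_nonempty _ ho ⟨(R + 2) • e, by
      simp only [mem_ofPred_eq, inner_smul_right, real_inner_self_eq_norm_sq, he1]
      linarith⟩
    exact mem_iUnion.2 ⟨⟨y, hy⟩, hz⟩
  obtain ⟨T, hT⟩ := (isCompact_sphere (0 : Space d) 1).elim_finite_subcover _
    (fun y : X => isOpen_lt continuous_const (by fun_prop)) hcov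
  refine ⟨insert y₀ (T.image Subtype.val), ?_, fun w => ?_⟩
  · intro y hy
    simp only [Finset.coe_insert, Finset.coe_image, mem_insert_iff, mem_image] at hy
    rcases hy with rfl | ⟨z, _, rfl⟩
    · exact hy₀
    · exact z.2
  · by_cases hw : w = 0
    · exact ⟨y₀, by simp, by simp [hw]⟩
    · have hw' : 0 < ‖w‖ := norm_pos_iff.2 hw
      have hs : ‖w‖⁻¹ • w ∈ Metric.sphere (0 : Space d) 1 := by
        simp [norm_smul, hw'.ne']
      obtain ⟨y, hy, hyw⟩ := mem_iUnion₂.1 (hT hs)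
      refine ⟨y, by simp [hy], ?_⟩
      simp only [mem_ofPred_eq, inner_smul_left, RCLike.conj_to_real] at hyw
      rw [inv_mul_eq_div, lt_div_iff₀ hw'] at hyw
      exact hyw.le

/-! ### Local finiteness and closedness -/

/-- A configuration whose dual Laguerre tessellation is locally finite. -/
structure IsAdmissible (X : Set (Space d × ℝ)) : Prop where
  dense : Dense (Prod.fst '' X)
  exists_level : ∀ r : ℝ, ∃ t : ℝ, (∀ w : Space d, ‖w‖ ≤ r → ∃ x ∈ X, power w x ≤ t) ∧
    (X ∩ powerRegion d r t).Finite

lemma exists_le_power_zero {X : Set (Space d × ℝ)} {t : ℝ}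
    (hf : (X ∩ powerRegion d 0 t).Finite) : ∃ g ≤ t, ∀ y ∈ X, g ≤ power 0 y := by
  obtain ⟨b, hb⟩ := (hf.image (power 0)).bddBelow
  refine ⟨min b t, min_le_right _ _, fun y hy => ?_⟩
  by_cases hp : y ∈ powerRegion d 0 t
  · exact (min_le_left _ _).trans (hb ⟨y, ⟨hy, hp⟩, rfl⟩)
  · by_contra hlt
    exact hp (mem_powerRegion (w := 0) (by simp)
      ((not_le.1 hlt).le.trans (min_le_right _ _)))

lemma exists_forall_power_zero_le (F : Finset (Space d × ℝ)) :
    ∃ C, ∀ y ∈ F, power 0 y ≤ C := by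
  obtain ⟨C, hC⟩ := (F.finite_toSet.image (power 0)).bddAbove
  exact ⟨C, fun y hy => hC ⟨y, hy, rfl⟩⟩

/-- The common point of the cells of such a simplex is bounded, so all `d` vertices come from one
finite set `X ∩ powerRegion d r t`. -/
lemma IsAdmissible.finite_dualLaguerre {X : Set (Space d × ℝ)} (hX : IsAdmissible X) (R : ℝ) :
    {c ∈ dualLaguerre d X | (frontier c ∩ Metric.closedBall 0 R).Nonempty}.Finite := by
  obtain ⟨F, hFX, hF⟩ := exists_finset_surround hX.dense R
  obtain ⟨C, hC⟩ := exists_forall_power_zero_le F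
  obtain ⟨t₀, -, ht₀⟩ := hX.exists_level 0
  obtain ⟨g, -, hg⟩ := exists_le_power_zero ht₀
  obtain ⟨t, ht, hfin⟩ := hX.exists_level ((C - g) / 2)
  refine ((Set.Finite.pi' fun _ : Fin d => hfin).image
    fun x => convexHull ℝ (range fun i => (x i).1)).subset ?_
  rintro c ⟨⟨x, -, hx, -, ⟨w, hw⟩, rfl⟩, u, huc, huR⟩
  rw [mem_iInter] at hw
  have hwr : ‖w‖ ≤ (C - g) / 2 := by
    have := two_mul_norm_le_of_convexHull hx hw (frontier_subset_convexHull_range _ huc)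
      (by simpa using huR)
      (fun w => by obtain ⟨y, a, b⟩ := hF w; exact ⟨y, hFX a, b, hC y a⟩) hg
    linarith
  refine ⟨x, fun i => ⟨hx i, ?_⟩, rfl⟩
  obtain ⟨z, hz, hzt⟩ := ht w hwr
  exact mem_powerRegion hwr ((hw i z hz).trans hzt)

lemma IsAdmissible.isClosed_skel {X : Set (Space d × ℝ)} (hX : IsAdmissible X) :
    IsClosed (skel (dualLaguerre d X)) := by
  have : skel (dualLaguerre d X) = ⋃ c : dualLaguerre d X, frontier c.1 := by
    simp [skel, iUnion_subtype]
  rw [this]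
  refine LocallyFinite.isClosed_iUnion (fun z => ?_) fun c => isClosed_frontier
  refine ⟨Metric.closedBall z 1, Metric.closedBall_mem_nhds _ one_pos, ?_⟩
  refine ((hX.finite_dualLaguerre (‖z‖ + 1)).preimage Subtype.val_injective.injOn).subset ?_
  rintro c ⟨u, hu, huz⟩
  refine ⟨c.2, u, hu, ?_⟩
  rw [mem_closedBall_zero_iff]
  rw [mem_closedBall_iff_norm] at huz
  have := norm_add_le (u - z) z
  simp only [sub_add_cancel] at this
  linarith

/-- `C` and `g` do not depend on the radius `k`. The level `k ^ 3` is chosen to outgrow the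
quadratic bound `(2k)² + |h|` on the power of one fixed point over the ball of radius `k`. -/
lemma eventually_stabilizes {X : Set (Space d × ℝ)} (hX : Dense (Prod.fst '' X))
    (hf : ∀ r t : ℝ, (X ∩ powerRegion d r t).Finite) (R : ℝ) :
    ∀ᶠ k : ℕ in atTop, Stabilizes R k ((k : ℝ) ^ 3) X := by
  obtain ⟨F, hFX, hF⟩ := exists_finset_surround hX R
  obtain ⟨C, hC⟩ := exists_forall_power_zero_le F
  obtain ⟨g, hg0, hg⟩ := exists_le_power_zero (hf 0 0)
  obtain ⟨_, y, hy, -⟩ := hX.nonempty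
  have hk : Tendsto (fun k : ℕ => (k : ℝ)) atTop atTop := tendsto_natCast_atTop_atTop
  filter_upwards [hk.eventually_ge_atTop C, hk.eventually_gt_atTop ((C - g) / 2),
    hk.eventually_ge_atTop (5 + |y.2|), hk.eventually_ge_atTop ‖y.1‖] with k h1 h2 h3 h4
  have hk1 : (5 : ℝ) ≤ k := by linarith [abs_nonneg y.2]
  have hk3 : (k : ℝ) ≤ (k : ℝ) ^ 3 := by nlinarith [sq_nonneg (k : ℝ)]
  refine ⟨by positivity, fun w hw => ⟨y, hy, (power_le w y).trans ?_⟩, C, g, fun w => ?_, hg,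
    hg0.trans (by positivity), by linarith⟩
  · have h5 : (‖w‖ + ‖y.1‖) ^ 2 ≤ (k + k) ^ 2 := by gcongr
    have h6 := le_abs_self y.2
    nlinarith [sq_nonneg (k : ℝ)]
  · obtain ⟨z, hz, hzw⟩ := hF w
    exact ⟨z, hFX hz, hzw, hC z hz, mem_powerRegion (w := 0) (by simp)
      ((hC z hz).trans (h1.trans hk3))⟩

/-! ### Scaling -/

/-- The similarity `(v, h) ↦ (s v, s² (h + a))` of weighted points. -/
def weightedScale (d : ℕ) (s a : ℝ) (hs : s ≠ 0) : (Space d × ℝ) ≃ₜ (Space d × ℝ) :=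
  (Homeomorph.smulOfNeZero s hs).prodCongr
    ((Homeomorph.addRight a).trans (Homeomorph.mulLeft₀ (s ^ 2) (pow_ne_zero 2 hs)))

lemma weightedScale_apply (s a : ℝ) (hs : s ≠ 0) (x : Space d × ℝ) :
    weightedScale d s a hs x = (s • x.1, s ^ 2 * (x.2 + a)) := rfl

/-- Powers change by an increasing affine map, so all comparisons between them survive. The factor
`s²` on heights is forced by this. -/
lemma power_weightedScale (s a : ℝ) (hs : s ≠ 0) (w : Space d) (x : Space d × ℝ) :
    power (s • w) (weightedScale d s a hs x) = s ^ 2 * (power w x + a) := by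
  simp only [power, weightedScale_apply]
  rw [← smul_sub, norm_smul, mul_pow, Real.norm_eq_abs, sq_abs]
  ring

lemma laguerreCell_weightedScale (s a : ℝ) (hs : s ≠ 0) (x : Space d × ℝ)
    (X : Set (Space d × ℝ)) :
    laguerreCell (weightedScale d s a hs x) (weightedScale d s a hs '' X) =
      Homeomorph.smulOfNeZero s hs '' laguerreCell x X := by
  ext w
  obtain ⟨z, rfl⟩ := (Homeomorph.smulOfNeZero s hs).surjective w
  rw [(Homeomorph.smulOfNeZero s hs).injective.mem_set_image]
  have hs2 : 0 < s ^ 2 := by positivity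
  simp only [laguerreCell, mem_ofPred_eq, forall_mem_image, Homeomorph.smulOfNeZero_apply,
    power_weightedScale, mul_le_mul_iff_right₀ hs2, add_le_add_iff_right]

lemma dualLaguerre_weightedScale (s a : ℝ) (hs : s ≠ 0) (X : Set (Space d × ℝ)) :
    dualLaguerre d (weightedScale d s a hs '' X) =
      (fun c => Homeomorph.smulOfNeZero s hs '' c) '' dualLaguerre d X := by
  have hconv : ∀ x : Fin d → Space d × ℝ,
      convexHull ℝ (range fun i => (weightedScale d s a hs (x i)).1) =
        Homeomorph.smulOfNeZero s hs '' convexHull ℝ (range fun i => (x i).1) := by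
    intro x
    have h1 : (Homeomorph.smulOfNeZero s hs : Space d → Space d) =
        (LinearMap.lsmul ℝ (Space d) s : Space d →ₗ[ℝ] Space d) := rfl
    rw [h1, LinearMap.image_convexHull, ← range_comp]
    rfl
  have key : ∀ x : Fin d → Space d × ℝ,
      (⋂ i, laguerreCell (weightedScale d s a hs (x i)) (weightedScale d s a hs '' X)).Nonempty ↔
        (⋂ i, laguerreCell (x i) X).Nonempty := by
    intro x
    simp_rw [laguerreCell_weightedScale]
    constructor
    · rintro ⟨w, hw⟩
      obtain ⟨z, rfl⟩ := (Homeomorph.smulOfNeZero s hs).surjective w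
      simp only [mem_iInter, (Homeomorph.smulOfNeZero s hs).injective.mem_set_image] at hw
      exact ⟨z, mem_iInter.2 hw⟩
    · rintro ⟨z, hz⟩
      rw [mem_iInter] at hz
      exact ⟨_, mem_iInter.2 fun i => ⟨z, hz i, rfl⟩⟩
  have key2 : ∀ x : Space d × ℝ,
      (interior (laguerreCell (weightedScale d s a hs x) (weightedScale d s a hs '' X))).Nonempty ↔
        (interior (laguerreCell x X)).Nonempty := by
    intro x
    rw [laguerreCell_weightedScale, ← Homeomorph.image_interior, image_nonempty]
  ext c
  constructor
  · rintro ⟨x, hinj, hx, hInt, hne, rfl⟩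
    choose y hy hyx using hx
    obtain rfl : (fun i => weightedScale d s a hs (y i)) = x := funext hyx
    refine ⟨_, ⟨y, fun i j h => hinj (by simp [h]), hy, fun i => (key2 _).1 (hInt i),
      (key y).1 hne, rfl⟩, (hconv y).symm⟩
  · rintro ⟨_, ⟨y, hinj, hy, hInt, hne, rfl⟩, rfl⟩
    exact ⟨fun i => weightedScale d s a hs (y i),
      fun i j h => hinj ((weightedScale d s a hs).injective h),
      fun i => mem_image_of_mem _ (hy i), fun i => (key2 _).2 (hInt i), (key y).2 hne,
      (hconv y).symm⟩

lemma skel_dualLaguerre_weightedScale (s a : ℝ) (hs : s ≠ 0) (X : Set (Space d × ℝ)) :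
    skel (dualLaguerre d (weightedScale d s a hs '' X)) =
      (fun v => s • v) '' skel (dualLaguerre d X) := by
  rw [dualLaguerre_weightedScale]
  simp only [skel, biUnion_image, image_iUnion₂]
  refine iUnion₂_congr fun c _ => ?_
  rw [← Homeomorph.image_frontier]
  rfl

lemma atoms_map_equiv {X Y : Type*} [MeasurableSpace X] [MeasurableSpace Y] (e : X ≃ᵐ Y)
    (m : Measure X) : atoms (m.map e) = e '' atoms m := by
  ext y
  obtain ⟨x, rfl⟩ := e.surjective y
  rw [e.injective.mem_set_image]
  simp only [atoms, mem_ofPred_eq, e.map_apply]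
  rw [← image_singleton, e.injective.preimage_image]

lemma delaunaySkel_map_weightedScale (s a : ℝ) (hs : s ≠ 0) (m : Measure (Space d × ℝ)) :
    delaunaySkel d (m.map (weightedScale d s a hs)) = (fun v => s • v) '' delaunaySkel d m := by
  have := atoms_map_equiv (weightedScale d s a hs).toMeasurableEquiv m
  rw [Homeomorph.toMeasurableEquiv_coe] at this
  rw [delaunaySkel, this, skel_dualLaguerre_weightedScale, delaunaySkel]

end

/-! ### Atoms of counting measures -/

section

variable {X : Type*} [MeasurableSpace X]

lemma atoms_sum_dirac [MeasurableSingletonClass X] {ι : Type*} (x : ι → X) :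
    atoms (Measure.sum fun i => Measure.dirac (x i)) = range x := by
  ext y
  simp only [atoms, mem_ofPred_eq, Measure.sum_apply _ (measurableSet_singleton y), Ne,
    ENNReal.tsum_eq_zero, Measure.dirac_apply' _ (measurableSet_singleton y), mem_range]
  push Not
  simp [Set.indicator]

lemma IsDiracSum.finite_atoms_inter [MeasurableSingletonClass X] {m : Measure X}
    (hm : IsDiracSum m) {B : Set X} (hB : MeasurableSet B) (hlt : m B < ∞) :
    (atoms m ∩ B).Finite := by
  obtain ⟨ι, _, x, rfl⟩ := hm
  rw [Measure.sum_apply _ hB] at hlt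
  have h := ENNReal.finite_const_le_of_tsum_ne_top hlt.ne one_ne_zero
  rw [atoms_sum_dirac]
  refine (h.image x).subset ?_
  rintro _ ⟨⟨i, rfl⟩, hi⟩
  exact ⟨i, by simp [Measure.dirac_apply' _ hB, hi], rfl⟩

lemma IsDiracSum.nonempty_atoms_inter [MeasurableSingletonClass X] {m : Measure X}
    (hm : IsDiracSum m) {B : Set X} (hB : MeasurableSet B) (h0 : m B ≠ 0) :
    (atoms m ∩ B).Nonempty := by
  obtain ⟨ι, _, x, rfl⟩ := hm
  rw [Measure.sum_apply _ hB, Ne, ENNReal.tsum_eq_zero] at h0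
  push Not at h0
  obtain ⟨i, hi⟩ := h0
  rw [atoms_sum_dirac]
  refine ⟨x i, ⟨i, rfl⟩, ?_⟩
  rw [Measure.dirac_apply' _ hB] at hi
  by_contra hx
  simp [hx] at hi

/-- The counting measure of a sequence of points. -/
def diracSeq (w : ℕ → X) : Measure X := Measure.sum fun i => Measure.dirac (w i)

lemma measurable_diracSeq : Measurable (diracSeq : (ℕ → X) → Measure X) := by
  refine Measure.measurable_of_measurable_coe _ fun B hB => ?_
  simp only [diracSeq, Measure.sum_apply _ hB]
  refine Measurable.tsum fun i => ?_
  exact (Measure.measurable_coe hB).comp (Measure.measurable_dirac.comp (measurable_pi_apply i))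

lemma IsDiracSum.exists_diracSeq {m : Measure X} (hm : IsDiracSum m) (h : m univ = ∞) :
    ∃ w, diracSeq w = m := by
  obtain ⟨ι, _, x, rfl⟩ := hm
  have hinf : Infinite ι := by
    by_contra hfin
    rw [not_infinite_iff_finite] at hfin
    have := Fintype.ofFinite ι
    rw [Measure.sum_apply _ MeasurableSet.univ, tsum_fintype] at h
    simp at h
  obtain ⟨e⟩ : Nonempty (ℕ ≃ ι) := by
    have := Encodable.ofCountable ι
    have := Denumerable.ofEncodableOfInfinite ι
    exact ⟨(Denumerable.eqv ι).symm⟩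
  refine ⟨x ∘ e, ?_⟩
  ext B hB
  simp only [diracSeq, Measure.sum_apply _ hB]
  exact e.tsum_eq (fun i => Measure.dirac (x i) B)

/-! ### Measurability of functionals of Poisson processes -/

/-- A countable generating algebra is a `π`-system, so its counts inside each spanning set determine
the measure as soon as these sets have finite mass. -/
lemma hasCountableSeparatingOn_measure [MeasurableSpace.CountablyGenerated X]
    (μ : Measure X) [SigmaFinite μ] :
    HasCountableSeparatingOn (Measure X) MeasurableSet {m | ∀ k, m (spanningSets μ k) < ∞} := by
  obtain ⟨b, hbc, hb⟩ := MeasurableSpace.CountablyGenerated.isCountablyGenerated (α := X)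
  let 𝒞 := generateSetAlgebra b
  have hC : 𝒞.Countable := countable_generateSetAlgebra hbc
  have hgen : ‹MeasurableSpace X› = MeasurableSpace.generateFrom 𝒞 := by
    rw [generateFrom_generateSetAlgebra_eq, ← hb]
  have hmeas : ∀ B ∈ 𝒞, MeasurableSet B := by
    intro B hB
    rw [hgen]
    exact MeasurableSpace.measurableSet_generateFrom hB
  have hCa : IsSetAlgebra 𝒞 := isSetAlgebra_generateSetAlgebra
  obtain ⟨S, hSc, hSm, hS⟩ := exists_countable_separating ℝ≥0∞ MeasurableSet univ
  refine ⟨(fun p : (Set X × ℕ) × Set ℝ≥0∞ =>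
    {m : Measure X | m (p.1.1 ∩ spanningSets μ p.1.2) ∈ p.2}) '' ((𝒞 ×ˢ univ) ×ˢ S),
    ((hC.prod countable_univ).prod hSc).image _, ?_, ?_⟩
  · rintro _ ⟨⟨⟨B, k⟩, V⟩, ⟨⟨hB, -⟩, hV⟩, rfl⟩
    exact (Measure.measurable_coe ((hmeas B hB).inter (measurableSet_spanningSets μ k))) (hSm V hV)
  · intro m hm m' hm' h
    have heq : ∀ B ∈ 𝒞, ∀ k, m (B ∩ spanningSets μ k) = m' (B ∩ spanningSets μ k) := by
      intro B hB k
      refine hS _ (mem_univ _) _ (mem_univ _) fun V hV => ?_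
      exact h _ ⟨⟨⟨B, k⟩, V⟩, ⟨⟨hB, mem_univ _⟩, hV⟩, rfl⟩
    refine Measure.ext_of_iUnion_eq_univ (iUnion_spanningSets μ) fun k => ?_
    have hfin : IsFiniteMeasure (m.restrict (spanningSets μ k)) :=
      ⟨by simpa using hm k⟩
    refine ext_of_generate_finite 𝒞 hgen (fun s hs t ht _ => hCa.inter_mem hs ht) ?_ ?_
    · intro B hB
      rw [Measure.restrict_apply (hmeas B hB), Measure.restrict_apply (hmeas B hB), heq B hB k]
    · have := heq univ hCa.univ_mem k
      simpa using this

variable {Ω Ω' : Type*} [MeasurableSpace Ω] [MeasurableSpace Ω']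

lemma IsPoissonProcess.isDiracSum {η : Ω → Measure X} {μ : Measure X} {P : Measure Ω}
    (h : IsPoissonProcess η μ P) (ω : Ω) : IsDiracSum (η ω) := (h.counting ω).2

/-- A set of counting measures which is measurable in terms of sequences of points coincides, on
the infinite counting measures which are finite on the spanning sets of `μ`, with a measurable set
of measures. -/
lemma exists_measurableSet_of_diracSeq [StandardBorelSpace X] {μ : Measure X} [SigmaFinite μ]
    {A : Set (Measure X)} (hA : MeasurableSet (diracSeq ⁻¹' A)) :
    ∃ V : Set (Measure X), MeasurableSet V ∧ ∀ m : Measure X, IsDiracSum m →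
      (∀ k, m (spanningSets μ k) < ∞) → m univ = ∞ → (m ∈ A ↔ m ∈ V) := by
  let W : Set (ℕ → X) := {w | ∀ k, diracSeq w (spanningSets μ k) < ∞}
  have hW : MeasurableSet W := by
    rw [show W = ⋂ k, {w | diracSeq w (spanningSets μ k) < ∞} by ext; simp [W]]
    exact MeasurableSet.iInter fun k => measurableSet_lt
      ((Measure.measurable_coe (measurableSet_spanningSets μ k)).comp measurable_diracSeq)
      measurable_const
  have := hW.standardBorel
  let f : W → Measure X := fun w => diracSeq w.1
  have hf : Measurable f := measurable_diracSeq.comp measurable_subtype_coe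
  have hsep : MeasurableSpace.CountablySeparated (range f) := by
    rw [MeasurableSpace.CountablySeparated.subtype_iff]
    obtain ⟨S, h1, h2, h3⟩ := (hasCountableSeparatingOn_measure μ).exists_countable_separating
    refine ⟨S, h1, h2, ?_⟩
    rintro _ ⟨w, rfl⟩ _ ⟨w', rfl⟩
    exact h3 _ w.2 _ w'.2
  have hpre : MeasurableSet (f ⁻¹' A) := by
    have : f ⁻¹' A = Subtype.val ⁻¹' (diracSeq ⁻¹' A) := rfl
    rw [this]
    exact measurable_subtype_coe hA
  -- The Lusin–Souslin step: `W` is standard Borel and the range of `f` is countably separated, so a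
  -- subset of the range is measurable once its preimage is. Injectivity, which fails under
  -- reordering of the points, is not needed.
  rw [hf.measurableSet_preimage_iff_preimage_val] at hpre
  obtain ⟨V, hV, hVA⟩ := hpre
  refine ⟨V, hV, fun m hm hm1 hm2 => ?_⟩
  obtain ⟨w, hw⟩ := hm.exists_diracSeq hm2
  have hwW : w ∈ W := by intro k; rw [hw]; exact hm1 k
  have hr : m ∈ range f := ⟨⟨w, hwW⟩, hw⟩
  exact (Set.ext_iff.1 hVA ⟨m, hr⟩).symm

lemma IsPoissonProcess.ae_spanning {μ : Measure X} [SigmaFinite μ] (hμ : μ univ = ∞)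
    {η : Ω → Measure X} {P : Measure Ω} (hη : IsPoissonProcess η μ P) :
    ∀ᵐ ω ∂P, (∀ k, η ω (spanningSets μ k) < ∞) ∧ η ω univ = ∞ := by
  have h1 : ∀ᵐ ω ∂P, ∀ k, η ω (spanningSets μ k) < ∞ := by
    rw [ae_all_iff]
    exact fun k => ae_forall_count_lt_top (hη.law _ (measurableSet_spanningSets μ k))
      (measure_spanningSets_lt_top μ k).ne
  exact h1.and (ae_count_eq_top (hη.law univ MeasurableSet.univ) hμ)

lemma IsPoissonProcess.aemeasurable_comp [StandardBorelSpace X] {μ : Measure X} [SigmaFinite μ]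
    (hμ : μ univ = ∞) {β : Type*} [MeasurableSpace β] [MeasurableSpace.CountablyGenerated β]
    {Z : Measure X → β} (hZ : Measurable (Z ∘ diracSeq)) {η : Ω → Measure X} {P : Measure Ω}
    (h : IsPoissonProcess η μ P) : AEMeasurable (fun ω => Z (η ω)) P := by
  refine NullMeasurable.aemeasurable fun U hU => ?_
  obtain ⟨V, hV, hVA⟩ := exists_measurableSet_of_diracSeq (μ := μ) (A := Z ⁻¹' U) (hZ hU)
  refine (h.measurable hV).nullMeasurableSet.congr ?_
  filter_upwards [h.ae_spanning hμ] with ω hω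
  exact propext (hVA _ (h.isDiracSum ω) hω.1 hω.2).symm

/-- This allows the skeleton of any given Poisson process to be replaced, in law, by that of a
coupled version with the same intensity. -/
lemma IsPoissonProcess.map_comp_eq [StandardBorelSpace X] {μ : Measure X} [SigmaFinite μ]
    (hμ : μ univ = ∞) {β : Type*} [MeasurableSpace β] [MeasurableSpace.CountablyGenerated β]
    {Z : Measure X → β} (hZ : Measurable (Z ∘ diracSeq)) {η : Ω → Measure X} {P : Measure Ω}
    [IsProbabilityMeasure P] (h : IsPoissonProcess η μ P) {η' : Ω' → Measure X} {P' : Measure Ω'}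
    [IsProbabilityMeasure P'] (h' : IsPoissonProcess η' μ P') :
    P.map (fun ω => Z (η ω)) = P'.map (fun ω => Z (η' ω)) := by
  ext U hU
  obtain ⟨V, hV, hVA⟩ := exists_measurableSet_of_diracSeq (μ := μ) (A := Z ⁻¹' U) (hZ hU)
  rw [Measure.map_apply_of_aemeasurable (h.aemeasurable_comp hμ hZ) hU,
    Measure.map_apply_of_aemeasurable (h'.aemeasurable_comp hμ hZ) hU]
  have e1 : P ((fun ω => Z (η ω)) ⁻¹' U) = P (η ⁻¹' V) := by
    refine measure_congr ?_
    filter_upwards [h.ae_spanning hμ] with ω hω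
    exact propext (hVA _ (h.isDiracSum ω) hω.1 hω.2)
  have e2 : P' ((fun ω => Z (η' ω)) ⁻¹' U) = P' (η' ⁻¹' V) := by
    refine measure_congr ?_
    filter_upwards [h'.ae_spanning hμ] with ω hω
    exact propext (hVA _ (h'.isDiracSum ω) hω.1 hω.2)
  rw [e1, e2, ← Measure.map_apply h.measurable hV, ← Measure.map_apply h'.measurable hV,
    h.map_eq_map h']

end

/-! ### The Fell topology -/

namespace ClosedSubset

section

variable {E : Type*} [MetricSpace E]

/-- A countable subbasis of the Fell topology, of sets defined by closed and open balls. -/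
def ballSubbasis (E : Type*) [MetricSpace E] [TopologicalSpace.SeparableSpace E] [Nonempty E] :
    Set (Set (ClosedSubset E)) :=
  (range fun p : ℕ × ℕ => {F : ClosedSubset E | F.carrier ∩
    Metric.closedBall (TopologicalSpace.denseSeq E p.1) (1 / ((p.2 : ℝ) + 1)) = ∅}) ∪
  (range fun p : ℕ × ℕ => {F : ClosedSubset E | (F.carrier ∩
    Metric.ball (TopologicalSpace.denseSeq E p.1) (1 / ((p.2 : ℝ) + 1))).Nonempty})

lemma exists_denseSeq_ball [TopologicalSpace.SeparableSpace E] [Nonempty E] {x : E} {U : Set E}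
    (hU : IsOpen U) (hx : x ∈ U) : ∃ n m : ℕ,
      x ∈ Metric.ball (TopologicalSpace.denseSeq E n) (1 / ((m : ℝ) + 1)) ∧
      Metric.closedBall (TopologicalSpace.denseSeq E n) (1 / ((m : ℝ) + 1)) ⊆ U := by
  obtain ⟨ε, hε, hεU⟩ := Metric.isOpen_iff.1 hU x hx
  obtain ⟨m, hm⟩ := exists_nat_one_div_lt (half_pos hε)
  have hm0 : (0 : ℝ) < 1 / ((m : ℝ) + 1) := by positivity
  obtain ⟨n, hn⟩ := (TopologicalSpace.denseRange_denseSeq E).exists_dist_lt x hm0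
  refine ⟨n, m, Metric.mem_ball.2 hn, fun y hy => hεU ?_⟩
  rw [Metric.mem_closedBall] at hy
  rw [Metric.mem_ball]
  have := dist_triangle y (TopologicalSpace.denseSeq E n) x
  rw [dist_comm (TopologicalSpace.denseSeq E n) x] at this
  linarith

lemma isOpen_miss {K : Set E} (hK : IsCompact K) :
    IsOpen {F : ClosedSubset E | F.carrier ∩ K = ∅} :=
  TopologicalSpace.isOpen_generateFrom_of_mem (Or.inl ⟨K, hK, rfl⟩)

lemma isOpen_hit {G : Set E} (hG : IsOpen G) :
    IsOpen {F : ClosedSubset E | (F.carrier ∩ G).Nonempty} :=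
  TopologicalSpace.isOpen_generateFrom_of_mem (Or.inr ⟨G, hG, rfl⟩)

variable [ProperSpace E]

/-- A compact set missed by `F` is covered by finitely many small balls whose closed versions are
also missed. The resulting countable subbasis makes the Borel `σ`-field countably generated. -/
lemma fellTopology_eq_generateFrom [Nonempty E] :
    fellTopology E = TopologicalSpace.generateFrom (ballSubbasis E) := by
  refine le_antisymm ?_ ?_
  · refine le_generateFrom ?_
    rintro U (⟨p, rfl⟩ | ⟨p, rfl⟩)
    · exact isOpen_miss (isCompact_closedBall _ _)
    · exact isOpen_hit Metric.isOpen_ball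
  · refine le_generateFrom ?_
    rintro U (⟨K, hK, rfl⟩ | ⟨G, hG, rfl⟩)
    · refine (@isOpen_iff_forall_mem_open _
        (TopologicalSpace.generateFrom (ballSubbasis E)) _).2 ?_
      intro F hF
      have hFK : K ⊆ F.carrierᶜ := by
        intro x hx hxF
        exact (Set.eq_empty_iff_forall_notMem.1 hF x) ⟨hxF, hx⟩
      choose! n m h1 h2 using fun x (hx : x ∈ K) =>
        exists_denseSeq_ball F.isClosed_carrier.isOpen_compl (hFK hx)
      obtain ⟨T, hTK, hT⟩ := hK.elim_nhds_subcover
        (fun x => Metric.ball (TopologicalSpace.denseSeq E (n x)) (1 / ((m x : ℝ) + 1)))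
        (fun x hx => Metric.isOpen_ball.mem_nhds (h1 x hx))
      refine ⟨⋂ x ∈ T, {F : ClosedSubset E | F.carrier ∩
        Metric.closedBall (TopologicalSpace.denseSeq E (n x)) (1 / ((m x : ℝ) + 1)) = ∅},
        ?_, ?_, ?_⟩
      · intro F' hF'
        rw [mem_iInter₂] at hF'
        refine Set.eq_empty_iff_forall_notMem.2 ?_
        rintro z ⟨hz, hzK⟩
        obtain ⟨x, hx, hzx⟩ := mem_iUnion₂.1 (hT hzK)
        exact (Set.eq_empty_iff_forall_notMem.1 (hF' x hx) z)
          ⟨hz, Metric.ball_subset_closedBall hzx⟩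
      · refine @isOpen_biInter_finset _ _ (TopologicalSpace.generateFrom (ballSubbasis E)) _ _
          fun x _ => ?_
        exact TopologicalSpace.isOpen_generateFrom_of_mem (Or.inl ⟨(n x, m x), rfl⟩)
      · rw [mem_iInter₂]
        intro x hx
        refine Set.eq_empty_iff_forall_notMem.2 ?_
        rintro z ⟨hz, hzx⟩
        exact h2 x (hTK x hx) hzx hz
    · refine (@isOpen_iff_forall_mem_open _
        (TopologicalSpace.generateFrom (ballSubbasis E)) _).2 ?_
      rintro F ⟨x, hxF, hxG⟩
      obtain ⟨n, m, h1, h2⟩ := exists_denseSeq_ball hG hxG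
      refine ⟨{F : ClosedSubset E | (F.carrier ∩
        Metric.ball (TopologicalSpace.denseSeq E n) (1 / ((m : ℝ) + 1))).Nonempty}, ?_, ?_,
        ⟨x, hxF, h1⟩⟩
      · rintro F' ⟨z, hz, hzb⟩
        exact ⟨z, hz, h2 (Metric.ball_subset_closedBall hzb)⟩
      · exact TopologicalSpace.isOpen_generateFrom_of_mem (Or.inr ⟨(n, m), rfl⟩)

instance [Nonempty E] : SecondCountableTopology (ClosedSubset E) :=
  ⟨⟨ballSubbasis E, (countable_range _).union (countable_range _), fellTopology_eq_generateFrom⟩⟩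

/-- In a proper space the distance to a non-empty closed set is attained, so missing a closed ball
leaves a gap. Thus missing compact balls reduces to hitting open ones. -/
lemma inter_closedBall_eq_empty_iff (F : ClosedSubset E) (q : E) (r : ℝ) :
    F.carrier ∩ Metric.closedBall q r = ∅ ↔
      ∃ n : ℕ, ¬ (F.carrier ∩ Metric.ball q (r + 1 / ((n : ℝ) + 1))).Nonempty := by
  constructor
  · intro h
    rcases F.carrier.eq_empty_or_nonempty with h0 | h0
    · exact ⟨0, by simp [h0]⟩
    · obtain ⟨y, hy, hyd⟩ := F.isClosed_carrier.exists_infDist_eq_dist h0 q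
      have hr : r < dist q y := by
        by_contra hle
        exact Set.eq_empty_iff_forall_notMem.1 h y ⟨hy, by
          rw [Metric.mem_closedBall, dist_comm]; exact not_lt.1 hle⟩
      obtain ⟨n, hn⟩ := exists_nat_one_div_lt (sub_pos.2 hr)
      refine ⟨n, ?_⟩
      rintro ⟨z, hz, hzb⟩
      have := Metric.infDist_le_dist_of_mem (x := q) hz
      rw [Metric.mem_ball, dist_comm] at hzb
      linarith
  · rintro ⟨n, hn⟩
    refine Set.eq_empty_iff_forall_notMem.2 ?_
    rintro z ⟨hz, hzb⟩
    refine hn ⟨z, hz, ?_⟩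
    rw [Metric.mem_closedBall] at hzb
    rw [Metric.mem_ball]
    have : (0 : ℝ) < 1 / ((n : ℝ) + 1) := by positivity
    linarith

lemma measurable_of_hit_ball [Nonempty E] {Ω : Type*} [MeasurableSpace Ω]
    {Z : Ω → ClosedSubset E}
    (h : ∀ q r, MeasurableSet {ω | ((Z ω).carrier ∩ Metric.ball q r).Nonempty}) :
    Measurable Z := by
  have hb : (inferInstance : MeasurableSpace (ClosedSubset E)) =
      MeasurableSpace.generateFrom (ballSubbasis E) :=
    borel_eq_generateFrom_of_subbasis fellTopology_eq_generateFrom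
  change @Measurable _ _ _ (inferInstance : MeasurableSpace (ClosedSubset E)) Z
  rw [hb]
  refine measurable_generateFrom ?_
  rintro _ (⟨p, rfl⟩ | ⟨p, rfl⟩)
  · have : Z ⁻¹' {F : ClosedSubset E | F.carrier ∩ Metric.closedBall
        (TopologicalSpace.denseSeq E p.1) (1 / ((p.2 : ℝ) + 1)) = ∅} =
        ⋃ n : ℕ, {ω | ((Z ω).carrier ∩ Metric.ball (TopologicalSpace.denseSeq E p.1)
          (1 / ((p.2 : ℝ) + 1) + 1 / ((n : ℝ) + 1))).Nonempty}ᶜ := by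
      ext ω
      simp only [mem_preimage, mem_ofPred_eq, inter_closedBall_eq_empty_iff, mem_iUnion,
        mem_compl_iff]
    rw [this]
    exact MeasurableSet.iUnion fun n => (h _ _).compl
  · exact h _ _

/-- Coincidence of two closed sets in a closed ball is measurable. -/
lemma measurableSet_inter_closedBall_eq [Nonempty E] (x : E) (R : ℝ) :
    MeasurableSet {p : ClosedSubset E × ClosedSubset E |
      p.1.carrier ∩ Metric.closedBall x R = p.2.carrier ∩ Metric.closedBall x R} := by
  -- If a point of `A` in the ball lies outside `B`, a small closed ball from the countable family
  -- contains it and misses `B`. Inclusion thus becomes countably many conditions.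
  have key : ∀ A B : ClosedSubset E, A.carrier ∩ Metric.closedBall x R ⊆ B.carrier ↔
      ∀ p : ℕ × ℕ, B.carrier ∩ Metric.closedBall (TopologicalSpace.denseSeq E p.1)
        (1 / ((p.2 : ℝ) + 1)) = ∅ → A.carrier ∩ (Metric.closedBall x R ∩
          Metric.closedBall (TopologicalSpace.denseSeq E p.1) (1 / ((p.2 : ℝ) + 1))) = ∅ := by
    intro A B
    constructor
    · intro h p hp
      refine Set.eq_empty_iff_forall_notMem.2 ?_
      rintro z ⟨hz, hz1, hz2⟩
      exact Set.eq_empty_iff_forall_notMem.1 hp z ⟨h ⟨hz, hz1⟩, hz2⟩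
    · rintro h z ⟨hz, hz1⟩
      by_contra hzB
      obtain ⟨n, m, h1, h2⟩ := exists_denseSeq_ball B.isClosed_carrier.isOpen_compl hzB
      have := h (n, m) (Set.eq_empty_iff_forall_notMem.2 fun y hy => h2 hy.2 hy.1)
      exact Set.eq_empty_iff_forall_notMem.1 this z ⟨hz, hz1, Metric.ball_subset_closedBall h1⟩
  have hmiss : ∀ K : Set E, IsCompact K →
      MeasurableSet {F : ClosedSubset E | F.carrier ∩ K = ∅} := fun K hK =>
    (isOpen_miss hK).measurableSet
  have hsub : MeasurableSet {p : ClosedSubset E × ClosedSubset E |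
      p.1.carrier ∩ Metric.closedBall x R ⊆ p.2.carrier} := by
    simp_rw [key]
    rw [show {p : ClosedSubset E × ClosedSubset E | ∀ q : ℕ × ℕ,
        p.2.carrier ∩ Metric.closedBall (TopologicalSpace.denseSeq E q.1)
        (1 / ((q.2 : ℝ) + 1)) = ∅ → p.1.carrier ∩ (Metric.closedBall x R ∩
          Metric.closedBall (TopologicalSpace.denseSeq E q.1) (1 / ((q.2 : ℝ) + 1))) = ∅} =
        ⋂ q : ℕ × ℕ, ((Prod.snd ⁻¹' {F : ClosedSubset E | F.carrier ∩
          Metric.closedBall (TopologicalSpace.denseSeq E q.1) (1 / ((q.2 : ℝ) + 1)) = ∅})ᶜ ∪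
          Prod.fst ⁻¹' {F : ClosedSubset E | F.carrier ∩ (Metric.closedBall x R ∩
          Metric.closedBall (TopologicalSpace.denseSeq E q.1) (1 / ((q.2 : ℝ) + 1))) = ∅}) by
      ext p
      simp [imp_iff_not_or]]
    exact MeasurableSet.iInter fun q =>
      ((measurable_snd (hmiss _ (isCompact_closedBall _ _))).compl).union
      (measurable_fst (hmiss _ ((isCompact_closedBall _ _).inter_right Metric.isClosed_closedBall)))
  have heq : {p : ClosedSubset E × ClosedSubset E |
      p.1.carrier ∩ Metric.closedBall x R = p.2.carrier ∩ Metric.closedBall x R} =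
      {p | p.1.carrier ∩ Metric.closedBall x R ⊆ p.2.carrier} ∩
      Prod.swap ⁻¹' {p | p.1.carrier ∩ Metric.closedBall x R ⊆ p.2.carrier} := by
    ext p
    constructor
    · intro h
      exact ⟨fun z hz => (Set.ext_iff.1 h z).1 hz |>.1, fun z hz => (Set.ext_iff.1 h z).2 hz |>.1⟩
    · rintro ⟨h1, h2⟩
      exact Subset.antisymm (fun z hz => ⟨h1 hz, hz.2⟩) fun z hz => ⟨h2 hz, hz.2⟩
  rw [heq]
  exact hsub.inter (measurable_swap hsub)

end

end ClosedSubset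

/-! ### Measurability of the skeleton of a sequence of weighted points -/

section

variable {d : ℕ}

lemma measurableSet_mem_laguerreCell (i : ℕ) (z : Space d) :
    MeasurableSet {w : ℕ → Space d × ℝ | z ∈ laguerreCell (w i) (range w)} := by
  rw [show {w : ℕ → Space d × ℝ | z ∈ laguerreCell (w i) (range w)} =
    ⋂ j, {w | power z (w i) ≤ power z (w j)} by ext; simp [laguerreCell]]
  refine (isClosed_iInter fun j => isClosed_le ?_ ?_).measurableSet <;> (unfold power; fun_prop)

/-- Cells are closed, so a ball lies in a cell as soon as its points from a countable dense set do.
-/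
lemma measurableSet_interior_laguerreCell (i : ℕ) :
    MeasurableSet {w : ℕ → Space d × ℝ | (interior (laguerreCell (w i) (range w))).Nonempty} := by
  let q := TopologicalSpace.denseSeq (Space d)
  have hq : DenseRange q := TopologicalSpace.denseRange_denseSeq _
  rw [show {w : ℕ → Space d × ℝ | (interior (laguerreCell (w i) (range w))).Nonempty} =
    ⋃ n : ℕ, ⋃ m : ℕ, ⋂ l : ℕ, ⋂ _ : q l ∈ Metric.ball (q n) (1 / ((m : ℝ) + 1)),
      {w : ℕ → Space d × ℝ | q l ∈ laguerreCell (w i) (range w)} by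
    ext w
    simp only [mem_ofPred_eq, mem_iUnion, mem_iInter]
    constructor
    · rintro ⟨z, hz⟩
      obtain ⟨n, m, -, h⟩ := ClosedSubset.exists_denseSeq_ball isOpen_interior hz
      exact ⟨n, m, fun l hl => interior_subset (h (Metric.ball_subset_closedBall hl))⟩
    · rintro ⟨n, m, h⟩
      have hm0 : (0 : ℝ) < 1 / ((m : ℝ) + 1) := by positivity
      refine ⟨q n, interior_maximal ?_ Metric.isOpen_ball (Metric.mem_ball_self hm0)⟩
      have h1 : Metric.ball (q n) (1 / ((m : ℝ) + 1)) ⊆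
          closure (Metric.ball (q n) (1 / ((m : ℝ) + 1)) ∩ range q) :=
        hq.open_subset_closure_inter Metric.isOpen_ball
      refine h1.trans (closure_minimal ?_ (isClosed_laguerreCell _ _))
      rintro _ ⟨hl, l, rfl⟩
      exact h l hl]
  exact MeasurableSet.iUnion fun n => MeasurableSet.iUnion fun m => MeasurableSet.iInter fun l =>
    MeasurableSet.iInter fun _ => measurableSet_mem_laguerreCell i (q l)

/-- The common point is sought in one closed ball at a time; projecting a closed condition along a
compact factor keeps it closed. -/
lemma measurableSet_common_laguerreCell (k : Fin d → ℕ) :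
    MeasurableSet {w : ℕ → Space d × ℝ |
      (⋂ i, laguerreCell (w (k i)) (range w)).Nonempty} := by
  rw [show {w : ℕ → Space d × ℝ | (⋂ i, laguerreCell (w (k i)) (range w)).Nonempty} =
    ⋃ n : ℕ, Prod.fst '' {p : (ℕ → Space d × ℝ) × Metric.closedBall (0 : Space d) n |
      ∀ i j, power p.2.1 (p.1 (k i)) ≤ power p.2.1 (p.1 j)} by
    ext w
    simp only [mem_ofPred_eq, mem_iUnion, mem_image, Prod.exists, exists_and_right, exists_eq_right]
    constructor
    · rintro ⟨z, hz⟩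
      obtain ⟨n, hn⟩ := exists_nat_ge ‖z‖
      rw [mem_iInter] at hz
      exact ⟨n, ⟨z, by simpa using hn⟩, fun i j => hz i _ ⟨j, rfl⟩⟩
    · rintro ⟨n, z, hz⟩
      refine ⟨z.1, mem_iInter.2 fun i => ?_⟩
      rintro _ ⟨j, rfl⟩
      exact hz i j]
  refine MeasurableSet.iUnion fun n => IsClosed.measurableSet ?_
  have : CompactSpace (Metric.closedBall (0 : Space d) n) :=
    isCompact_iff_compactSpace.1 (isCompact_closedBall _ _)
  refine isClosedMap_fst_of_compactSpace _ ?_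
  simp only [ofPred_forall]
  refine isClosed_iInter fun i => isClosed_iInter fun j => isClosed_le ?_ ?_ <;>
    (unfold power; fun_prop)

/-- A connected set meeting both `c` and its complement cannot avoid the frontier. The frontier is
thereby traded for hitting and containment, which are easier to control when the vertices vary. -/
lemma frontier_inter_nonempty_iff {E : Type*} [TopologicalSpace E] {c G : Set E}
    (hc : IsClosed c) (hG : IsPreconnected G) (hGo : IsOpen G) :
    (frontier c ∩ G).Nonempty ↔ (c ∩ G).Nonempty ∧ ¬ G ⊆ c := by
  constructor
  · rintro ⟨z, hz, hzG⟩
    refine ⟨⟨z, hc.frontier_subset hz, hzG⟩, fun h => ?_⟩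
    exact hz.2 (interior_maximal h hGo hzG)
  · rintro ⟨⟨z, hz, hzG⟩, h⟩
    rw [not_subset] at h
    obtain ⟨y, hyG, hy⟩ := h
    by_contra hne
    rw [not_nonempty_iff_eq_empty] at hne
    have hcov : G ⊆ interior c ∪ cᶜ := by
      intro x hx
      by_cases hxc : x ∈ c
      · left
        by_contra hxi
        exact Set.eq_empty_iff_forall_notMem.1 hne x ⟨⟨subset_closure hxc, hxi⟩, hx⟩
      · exact Or.inr hxc
    have hzi : z ∈ interior c := (hcov hzG).resolve_right (fun h => h hz)
    obtain ⟨x, -, hx1, hx2⟩ := hG _ _ isOpen_interior hc.isOpen_compl hcov ⟨z, hzG, hzi⟩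
      ⟨y, hyG, hy⟩
    exact hx2 (interior_subset hx1)

lemma mem_convexHull_range_iff {ι : Type*} [Fintype ι] (v : ι → Space d) (z : Space d) :
    z ∈ convexHull ℝ (range v) ↔ ∃ a ∈ stdSimplex ℝ ι, ∑ i, a i • v i = z := by
  classical
  have h : convexHull ℝ (range v) = Fintype.linearCombination ℝ v '' stdSimplex ℝ ι := by
    rw [← convexHull_rangle_single_eq_stdSimplex, LinearMap.image_convexHull, ← range_comp]
    congr 2
    ext1 i
    simp [Fintype.linearCombination_apply_single]
  rw [h]
  simp [Fintype.linearCombination_apply]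

/-- Hitting a ball is an open condition on the vertices, as a union over barycentric coordinates;
containing a ball is a closed one, since the coordinates range over a compact simplex. -/
lemma measurableSet_frontier_convexHull (k : Fin d → ℕ) (q : Space d) (r : ℝ) :
    MeasurableSet {w : ℕ → Space d × ℝ |
      (frontier (convexHull ℝ (range fun i => (w (k i)).1)) ∩ Metric.ball q r).Nonempty} := by
  have hcl : ∀ w : ℕ → Space d × ℝ, IsClosed (convexHull ℝ (range fun i => (w (k i)).1)) :=
    fun w => ((finite_range _).isCompact_convexHull ℝ).isClosed
  simp_rw [frontier_inter_nonempty_iff (hcl _) (convex_ball q r).isPreconnected Metric.isOpen_ball]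
  rw [ofPred_and]
  refine MeasurableSet.inter ?_ (MeasurableSet.compl (s := {w : ℕ → Space d × ℝ |
    Metric.ball q r ⊆ convexHull ℝ (range fun i => (w (k i)).1)}) ?_)
  · refine IsOpen.measurableSet ?_
    rw [show {w : ℕ → Space d × ℝ |
        (convexHull ℝ (range fun i => (w (k i)).1) ∩ Metric.ball q r).Nonempty} =
        ⋃ a ∈ stdSimplex ℝ (Fin d), {w | ∑ i, a i • (w (k i)).1 ∈ Metric.ball q r} by
      ext w
      simp only [mem_ofPred_eq, mem_iUnion, exists_prop]
      constructor
      · rintro ⟨z, hz, hzb⟩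
        obtain ⟨a, ha, rfl⟩ := (mem_convexHull_range_iff _ _).1 hz
        exact ⟨a, ha, hzb⟩
      · rintro ⟨a, ha, h⟩
        exact ⟨_, (mem_convexHull_range_iff _ _).2 ⟨a, ha, rfl⟩, h⟩]
    exact isOpen_biUnion fun a _ => Metric.isOpen_ball.preimage (by fun_prop)
  · refine IsClosed.measurableSet ?_
    rw [show {w : ℕ → Space d × ℝ |
        Metric.ball q r ⊆ convexHull ℝ (range fun i => (w (k i)).1)} =
        ⋂ z ∈ Metric.ball q r, Prod.fst '' {p : (ℕ → Space d × ℝ) × stdSimplex ℝ (Fin d) |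
          ∑ i, p.2.1 i • (p.1 (k i)).1 = z} by
      ext w
      simp only [mem_ofPred_eq, mem_iInter, subset_def, mem_convexHull_range_iff, mem_image,
        Prod.exists, exists_and_right, exists_eq_right]
      refine forall₂_congr fun z _ => ⟨?_, ?_⟩
      · rintro ⟨a, ha, h⟩; exact ⟨⟨a, ha⟩, h⟩
      · rintro ⟨a, h⟩; exact ⟨a.1, a.2, h⟩]
    refine isClosed_biInter fun z _ => ?_
    have : CompactSpace (stdSimplex ℝ (Fin d)) :=
      isCompact_iff_compactSpace.1 (isCompact_stdSimplex ℝ (Fin d))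
    refine isClosedMap_fst_of_compactSpace _ (isClosed_eq ?_ continuous_const)
    refine continuous_finsetSum _ fun i _ => Continuous.fun_smul ?_ ?_
    · exact (continuous_apply i).comp (continuous_subtype_val.comp continuous_snd)
    · fun_prop

lemma measurable_toClosed_skel : Measurable fun w : ℕ → Space d × ℝ =>
    toClosed (skel (dualLaguerre d (range w))) := by
  refine ClosedSubset.measurable_of_hit_ball fun q r => ?_
  have : {w : ℕ → Space d × ℝ | ((toClosed (skel (dualLaguerre d (range w)))).carrier ∩
      Metric.ball q r).Nonempty} = ⋃ k : Fin d → ℕ,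
      {w | Function.Injective (fun i => w (k i))} ∩
      ((⋂ i, {w | (interior (laguerreCell (w (k i)) (range w))).Nonempty}) ∩
      ({w | (⋂ i, laguerreCell (w (k i)) (range w)).Nonempty} ∩
      {w | (frontier (convexHull ℝ (range fun i => (w (k i)).1)) ∩
        Metric.ball q r).Nonempty})) := by
    ext w
    simp only [toClosed, mem_ofPred_eq, closure_inter_open_nonempty_iff Metric.isOpen_ball,
      mem_iUnion, mem_inter_iff, mem_iInter]
    constructor
    · rintro ⟨z, hz, hzb⟩
      simp only [skel, mem_iUnion] at hz
      obtain ⟨_, ⟨x, hinj, hx, hInt, hne, rfl⟩, hzc⟩ := hz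
      choose k hk using hx
      obtain rfl : (fun i => w (k i)) = x := funext hk
      exact ⟨k, hinj, hInt, hne, z, hzc, hzb⟩
    · rintro ⟨k, hinj, hInt, hne, z, hzc, hzb⟩
      refine ⟨z, ?_, hzb⟩
      simp only [skel, mem_iUnion]
      exact ⟨_, ⟨fun i => w (k i), hinj, fun i => ⟨_, rfl⟩, hInt, hne, rfl⟩, hzc⟩
  rw [this]
  refine MeasurableSet.iUnion fun k => MeasurableSet.inter ?_ (MeasurableSet.inter ?_
    ((measurableSet_common_laguerreCell k).inter (measurableSet_frontier_convexHull k q r)))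
  · rw [show {w : ℕ → Space d × ℝ | Function.Injective (fun i => w (k i))} =
      ⋂ i, ⋂ j, {w | w (k i) = w (k j) → i = j} by ext; simp [Function.Injective]]
    refine MeasurableSet.iInter fun i => MeasurableSet.iInter fun j => ?_
    by_cases hij : i = j
    · simp [hij]
    · simp only [hij, imp_false]
      exact (measurableSet_eq_fun (f := fun w : ℕ → Space d × ℝ => w (k i))
        (g := fun w => w (k j)) (measurable_pi_apply _) (measurable_pi_apply _)).compl
  · exact MeasurableSet.iInter fun i => measurableSet_interior_laguerreCell (k i)

lemma delaunaySkel_diracSeq (w : ℕ → Space d × ℝ) :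
    delaunaySkel d (diracSeq w) = skel (dualLaguerre d (range w)) := by
  rw [delaunaySkel, diracSeq, atoms_sum_dirac]

lemma measurable_toClosed_delaunaySkel :
    Measurable ((fun m => toClosed (delaunaySkel d m)) ∘ diracSeq) := by
  have : ((fun m => toClosed (delaunaySkel d m)) ∘ diracSeq) = fun w : ℕ → Space d × ℝ =>
      toClosed (skel (dualLaguerre d (range w))) := by
    ext1 w
    simp only [Function.comp_apply, delaunaySkel_diracSeq]
  rw [this]
  exact measurable_toClosed_skel

end

/-! ### Images and thinnings of Poisson processes -/

section

variable {X Y Ω : Type*} [MeasurableSpace X] [MeasurableSpace Y] [MeasurableSpace Ω]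

lemma IsDiracSum.map {m : Measure X} (hm : IsDiracSum m) {g : X → Y} (hg : Measurable g) :
    IsDiracSum (m.map g) := by
  obtain ⟨ι, _, x, rfl⟩ := hm
  refine ⟨ι, inferInstance, g ∘ x, ?_⟩
  rw [Measure.map_sum hg.aemeasurable]
  congr 1
  ext1 i
  exact Measure.map_dirac' hg _

lemma IsDiracSum.restrict {m : Measure X} (hm : IsDiracSum m) {S : Set X} (hS : MeasurableSet S) :
    IsDiracSum (m.restrict S) := by
  classical
  obtain ⟨ι, _, x, rfl⟩ := hm
  refine ⟨{i // x i ∈ S}, inferInstance, fun i => x i.1, ?_⟩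
  ext B hB
  rw [Measure.restrict_apply hB, Measure.sum_apply _ (hB.inter hS), Measure.sum_apply _ hB]
  have h1 : ∀ i, Measure.dirac (x i) (B ∩ S) =
      ({i | x i ∈ S} : Set ι).indicator (fun i => Measure.dirac (x i) B) i := by
    intro i
    rw [Measure.dirac_apply' _ (hB.inter hS)]
    by_cases hi : x i ∈ S
    · simp [hi, Measure.dirac_apply' _ hB, Set.indicator]
    · simp [hi]
  simp_rw [h1]
  exact (tsum_subtype {i | x i ∈ S} fun i => Measure.dirac (x i) B).symm

lemma IsPoissonProcess.map_equiv {η : Ω → Measure X} {μ : Measure X} {P : Measure Ω}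
    (h : IsPoissonProcess η μ P) (e : X ≃ᵐ Y) :
    IsPoissonProcess (fun ω => (η ω).map e) (μ.map e) P where
  measurable := (Measure.measurable_map _ e.measurable).comp h.measurable
  counting ω := by
    have := (h.counting ω).1
    exact ⟨e.sigmaFinite_map, (h.isDiracSum ω).map e.measurable⟩
  law B hB := by
    simp only [e.map_apply]
    exact h.law _ (e.measurable hB)
  indep n B hB hd := by
    simp only [e.map_apply]
    exact h.indep n _ (fun i => e.measurable (hB i)) fun i j hij => (hd hij).preimage _

lemma laplace_map_restrict {P : Measure Ω} {N : Ω → Measure X} {ν : Measure X}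
    (hL : ∀ f : X → ℝ≥0∞, Measurable f →
      ∫⁻ ω, expNeg (∫⁻ x, f x ∂N ω) ∂P = expNeg (∫⁻ x, (1 - expNeg (f x)) ∂ν))
    {S : Set X} (hS : MeasurableSet S) {g : X → Y} (hg : Measurable g)
    (f : Y → ℝ≥0∞) (hf : Measurable f) :
    ∫⁻ ω, expNeg (∫⁻ y, f y ∂((N ω).restrict S).map g) ∂P =
      expNeg (∫⁻ y, (1 - expNeg (f y)) ∂(ν.restrict S).map g) := by
  have h1 : ∀ m : Measure X, ∫⁻ y, f y ∂(m.restrict S).map g =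
      ∫⁻ x, S.indicator (fun x => f (g x)) x ∂m := fun m => by
    rw [lintegral_map hf hg, lintegral_indicator hS]
  simp_rw [h1]
  have hm : Measurable fun y => 1 - expNeg (f y) :=
    measurable_const.sub (measurable_expNeg.comp hf)
  rw [hL (S.indicator fun x => f (g x)) ((hf.comp hg).indicator hS),
    lintegral_map hm hg, ← lintegral_indicator hS]
  congr 2
  ext1 x
  by_cases hx : x ∈ S <;> simp [hx]

/-- The region below the graph of `f`. -/
def subgraph {X : Type*} (f : X → ℝ) : Set (X × ℝ) := {p | p.2 ∈ Ioc 0 (f p.1)}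

lemma measurableSet_subgraph {f : X → ℝ} (hf : Measurable f) : MeasurableSet (subgraph f) :=
  (measurableSet_lt measurable_const measurable_snd).inter
    (measurableSet_le measurable_snd (hf.comp measurable_fst))

/-- The points of `m` below the graph of `f`, projected to the first factor. -/
def thin (f : X → ℝ) (m : Measure (X × ℝ)) : Measure X := (m.restrict (subgraph f)).map Prod.fst

lemma thin_apply (f : X → ℝ) (m : Measure (X × ℝ)) {B : Set X}
    (hB : MeasurableSet B) : thin f m B = m (Prod.fst ⁻¹' B ∩ subgraph f) := by
  rw [thin, Measure.map_apply measurable_fst hB, Measure.restrict_apply (measurable_fst hB)]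

/-- The fibre `(0, f x]` has length `max (f x) 0`, in agreement with `ENNReal.ofReal (f x)`. -/
lemma thin_prod_volume {f : X → ℝ} (hf : Measurable f) (μ : Measure X) :
    thin f (μ.prod volume) = μ.withDensity fun x => ENNReal.ofReal (f x) := by
  ext B hB
  rw [thin_apply f _ hB, Measure.prod_apply ((measurable_fst hB).inter
    (measurableSet_subgraph hf)), withDensity_apply _ hB, ← lintegral_indicator hB]
  congr 1
  ext1 x
  by_cases hx : x ∈ B
  · have : Prod.mk x ⁻¹' (Prod.fst ⁻¹' B ∩ subgraph f) = Ioc 0 (f x) := by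
      ext y; simp [subgraph, hx]
    rw [this, Real.volume_Ioc, indicator_of_mem hx, sub_zero]
  · have : Prod.mk x ⁻¹' (Prod.fst ⁻¹' B ∩ subgraph f) = ∅ := by
      ext y; simp [hx]
    rw [this, indicator_of_notMem hx, measure_empty]

instance sigmaFinite_withDensity_ofReal' (μ : Measure X) [SigmaFinite μ] (f : X → ℝ) :
    SigmaFinite (μ.withDensity fun x => ENNReal.ofReal (f x)) :=
  SigmaFinite.withDensity_ofReal f

/-- The Poisson process with density `f` obtained from a Poisson process on the product with the
real line. -/
def thinProcess (μ : Measure X) [SigmaFinite μ] (f : X → ℝ) (N : Ω → Measure (X × ℝ)) :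
    Ω → Measure X :=
  truncProcess (fun ω => thin f (N ω)) (μ.withDensity fun x => ENNReal.ofReal (f x))

variable {μ : Measure X} {P : Measure Ω}
  {N : Ω → Measure (X × ℝ)}

lemma laplace_thin (hL : ∀ f : X × ℝ → ℝ≥0∞, Measurable f →
      ∫⁻ ω, expNeg (∫⁻ x, f x ∂N ω) ∂P =
        expNeg (∫⁻ x, (1 - expNeg (f x)) ∂(μ.prod volume)))
    {f : X → ℝ} (hf : Measurable f) (g : X → ℝ≥0∞) (hg : Measurable g) :
    ∫⁻ ω, expNeg (∫⁻ x, g x ∂thin f (N ω)) ∂P =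
      expNeg (∫⁻ x, (1 - expNeg (g x)) ∂(μ.withDensity fun x => ENNReal.ofReal (f x))) := by
  rw [← thin_prod_volume hf]
  exact laplace_map_restrict hL (measurableSet_subgraph hf) measurable_fst g hg

lemma measurable_thin (hN : Measurable N) {f : X → ℝ} (hf : Measurable f) :
    Measurable fun ω => thin f (N ω) := by
  refine Measure.measurable_of_measurable_coe _ fun B hB => ?_
  simp_rw [thin_apply f _ hB]
  exact (Measure.measurable_coe ((measurable_fst hB).inter (measurableSet_subgraph hf))).comp hN

lemma isPoissonProcess_thinProcess [SigmaFinite μ] [IsProbabilityMeasure P]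
    (hN : Measurable N) (hc : ∀ ω, IsDiracSum (N ω))
    (hL : ∀ f : X × ℝ → ℝ≥0∞, Measurable f →
      ∫⁻ ω, expNeg (∫⁻ x, f x ∂N ω) ∂P =
        expNeg (∫⁻ x, (1 - expNeg (f x)) ∂(μ.prod volume)))
    {f : X → ℝ} (hf : Measurable f) :
    IsPoissonProcess (thinProcess μ f N) (μ.withDensity fun x => ENNReal.ofReal (f x)) P :=
  isPoissonProcess_truncProcess (measurable_thin hN hf)
    (fun ω => ((hc ω).restrict (measurableSet_subgraph hf)).map measurable_fst)
    (fun _ hB => hasLaw_count_of_laplace (measurable_thin hN hf) (laplace_thin hL hf) hB)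
    (fun _ B hB hd => iIndepFun_counts_of_laplace (measurable_thin hN hf)
      (laplace_thin hL hf) B hB hd)

lemma thinProcess_ae_eq [SigmaFinite μ] [IsProbabilityMeasure P] (hN : Measurable N)
    (hL : ∀ f : X × ℝ → ℝ≥0∞, Measurable f →
      ∫⁻ ω, expNeg (∫⁻ x, f x ∂N ω) ∂P =
        expNeg (∫⁻ x, (1 - expNeg (f x)) ∂(μ.prod volume)))
    {f : X → ℝ} (hf : Measurable f) :
    ∀ᵐ ω ∂P, thinProcess μ f N ω = thin f (N ω) :=
  truncProcess_ae_eq fun _ hB =>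
    hasLaw_count_of_laplace (measurable_thin hN hf) (laplace_thin hL hf) hB

/-- The region over `A` between the graphs of `f` and `g`. -/
def betweenGraphs {X : Type*} (A : Set X) (f g : X → ℝ) : Set (X × ℝ) :=
  {p | p.1 ∈ A ∧ p.2 ∈ uIoc (f p.1) (g p.1)}

lemma measurableSet_betweenGraphs {A : Set X} (hA : MeasurableSet A) {f g : X → ℝ}
    (hf : Measurable f) (hg : Measurable g) : MeasurableSet (betweenGraphs A f g) := by
  have : betweenGraphs A f g = Prod.fst ⁻¹' A ∩
      ({p | min (f p.1) (g p.1) < p.2} ∩ {p | p.2 ≤ max (f p.1) (g p.1)}) := rfl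
  rw [this]
  exact (measurable_fst hA).inter ((measurableSet_lt ((hf.comp measurable_fst).min
    (hg.comp measurable_fst)) measurable_snd).inter (measurableSet_le measurable_snd
    ((hf.comp measurable_fst).max (hg.comp measurable_fst))))

/-- This is the expected number of marked points over `A` on which the two thinnings disagree: the
`L¹` distance of the densities. -/
lemma prod_betweenGraphs (ν : Measure X) {A : Set X} (hA : MeasurableSet A) {f g : X → ℝ}
    (hf : Measurable f) (hg : Measurable g) :
    (ν.prod volume) (betweenGraphs A f g) = ∫⁻ x in A, ENNReal.ofReal |g x - f x| ∂ν := by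
  rw [Measure.prod_apply (measurableSet_betweenGraphs hA hf hg), ← lintegral_indicator hA]
  congr 1
  ext1 x
  by_cases hx : x ∈ A
  · have : Prod.mk x ⁻¹' betweenGraphs A f g = uIoc (f x) (g x) := by
      ext y; simp [betweenGraphs, hx]
    rw [this, Real.volume_uIoc, indicator_of_mem hx]
  · have : Prod.mk x ⁻¹' betweenGraphs A f g = ∅ := by
      ext y; simp [betweenGraphs, hx]
    rw [this, indicator_of_notMem hx, measure_empty]

lemma atoms_thin_inter_subset [MeasurableSingletonClass X] {A : Set X} {f g : X → ℝ}
    {m : Measure (X × ℝ)}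
    (h : m (betweenGraphs A f g) = 0) : atoms (thin f m) ∩ A ⊆ atoms (thin g m) := by
  rintro x ⟨hx, hxA⟩
  simp only [atoms, mem_ofPred_eq, thin_apply f _ (measurableSet_singleton x),
    thin_apply g _ (measurableSet_singleton x)] at hx ⊢
  intro h0
  -- A mark over `x` under the graph of `f` either lies under the graph of `g` or falls between the
  -- graphs.
  refine hx (measure_mono_null (t := (Prod.fst ⁻¹' {x} ∩ subgraph g) ∪ betweenGraphs A f g) ?_
    (measure_union_null h0 h))
  rintro ⟨x', y⟩ ⟨hx', hy⟩
  obtain rfl : x' = x := hx'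
  by_cases hyg : y ≤ g x'
  · exact Or.inl ⟨rfl, hy.1, hyg⟩
  · refine Or.inr ⟨hxA, ?_⟩
    rw [not_le] at hyg
    exact mem_uIoc.2 (Or.inr ⟨hyg, hy.2⟩)

lemma betweenGraphs_comm {X : Type*} (A : Set X) (f g : X → ℝ) :
    betweenGraphs A f g = betweenGraphs A g f := by
  simp only [betweenGraphs, uIoc_comm]

lemma atoms_thin_inter_eq [MeasurableSingletonClass X] {A : Set X} {f g : X → ℝ}
    {m : Measure (X × ℝ)}
    (h : m (betweenGraphs A f g) = 0) : atoms (thin f m) ∩ A = atoms (thin g m) ∩ A :=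
  Subset.antisymm (subset_inter (atoms_thin_inter_subset h) inter_subset_right)
    (subset_inter (atoms_thin_inter_subset (by rwa [betweenGraphs_comm]))
      inter_subset_right)

end

/-! ### Intensities with locally finite tessellations -/

section

variable {d : ℕ}

/-- An intensity measure whose Poisson processes are almost surely admissible: the projection of
the points is dense, and the centres `w` in a ball are, with high probability, covered at a level
below which the intensity is finite. -/
structure IsTessellationIntensity (μ : Measure (Space d × ℝ)) : Prop where
  ball_prod : ∀ (q : Space d) (r : ℝ), 0 < r → μ (Metric.ball q r ×ˢ univ) = ∞
  level : ∀ r : ℝ, ∀ ε : ℝ≥0∞, ε ≠ 0 → ∃ t : ℝ, μ (powerRegion d r t) < ∞ ∧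
    ∃ (ι : Type) (J : Finset ι) (U : ι → Set (Space d)) (B : ι → Set (Space d × ℝ)),
      (∀ j ∈ J, MeasurableSet (B j)) ∧ Metric.closedBall 0 r ⊆ ⋃ j ∈ J, U j ∧
      (∀ j ∈ J, ∀ w ∈ U j, ∀ x ∈ B j, power w x ≤ t) ∧ ∑ j ∈ J, expNeg (μ (B j)) ≤ ε

lemma IsTessellationIntensity.measure_univ {μ : Measure (Space d × ℝ)}
    (h : IsTessellationIntensity μ) : μ univ = ∞ :=
  top_le_iff.1 ((h.ball_prod 0 1 one_pos).symm.le.trans (measure_mono (subset_univ _)))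

variable {Ω : Type*} [MeasurableSpace Ω] {P : Measure Ω} {μ : Measure (Space d × ℝ)}
  {η : Ω → Measure (Space d × ℝ)}

lemma IsPoissonProcess.ae_dense_fst (hη : IsPoissonProcess η μ P)
    (h : ∀ (q : Space d) (r : ℝ), 0 < r → μ (Metric.ball q r ×ˢ univ) = ∞) :
    ∀ᵐ ω ∂P, Dense (Prod.fst '' atoms (η ω)) := by
  let q := TopologicalSpace.denseSeq (Space d)
  have hm : ∀ (n m : ℕ), MeasurableSet
      (Metric.ball (q n) (1 / ((m : ℝ) + 1)) ×ˢ (univ : Set ℝ)) := fun n m =>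
    measurableSet_ball.prod MeasurableSet.univ
  have h1 : ∀ᵐ ω ∂P, ∀ n m : ℕ, η ω (Metric.ball (q n) (1 / ((m : ℝ) + 1)) ×ˢ univ) = ∞ := by
    rw [ae_all_iff]; intro n
    rw [ae_all_iff]; intro m
    exact ae_count_eq_top (hη.law _ (hm n m)) (h _ _ (by positivity))
  filter_upwards [h1] with ω hω
  rw [dense_iff_inter_open]
  rintro U hU ⟨z, hz⟩
  obtain ⟨n, m, -, hsub⟩ := ClosedSubset.exists_denseSeq_ball hU hz
  obtain ⟨x, hx, hxb⟩ := (hη.isDiracSum ω).nonempty_atoms_inter (hm n m) (by rw [hω n m]; simp)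
  exact ⟨x.1, hsub (Metric.ball_subset_closedBall hxb.1), x, hx, rfl⟩

lemma measurableSet_powerRegion (r t : ℝ) : MeasurableSet (powerRegion d r t) :=
  (isClosed_powerRegion r t).measurableSet

lemma IsPoissonProcess.ae_finite_inter_powerRegion (hη : IsPoissonProcess η μ P) {r t : ℝ}
    (h : μ (powerRegion d r t) < ∞) : ∀ᵐ ω ∂P, (atoms (η ω) ∩ powerRegion d r t).Finite := by
  filter_upwards [ae_forall_count_lt_top (hη.law _ (measurableSet_powerRegion r t)) h.ne] with ω hω
  exact (hη.isDiracSum ω).finite_atoms_inter (measurableSet_powerRegion r t) hω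

lemma powerRegion_mono {r r' t t' : ℝ} (hr : r ≤ r') (ht : t ≤ t') :
    powerRegion d r t ⊆ powerRegion d r' t' := by
  rintro x ⟨h1, h2⟩
  refine ⟨h1.trans ht, h2.trans ?_⟩
  gcongr

lemma IsPoissonProcess.ae_forall_finite_inter_powerRegion (hη : IsPoissonProcess η μ P)
    (h : ∀ r t, μ (powerRegion d r t) < ∞) :
    ∀ᵐ ω ∂P, ∀ r t, (atoms (η ω) ∩ powerRegion d r t).Finite := by
  have h1 : ∀ᵐ ω ∂P, ∀ n : ℕ, (atoms (η ω) ∩ powerRegion d n n).Finite := by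
    rw [ae_all_iff]
    exact fun n => hη.ae_finite_inter_powerRegion (h _ _)
  filter_upwards [h1] with ω hω r t
  obtain ⟨n, hn⟩ := exists_nat_ge (max r t)
  exact (hω n).subset (inter_subset_inter_right _ (powerRegion_mono
    ((le_max_left _ _).trans hn) ((le_max_right _ _).trans hn)))

/-- For each `ε` some level `t` works outside an event of probability at most `ε`, namely that one
of finitely many boxes is empty. The level may depend on `ε`, since only the existence of some level
is claimed for almost every `ω`. -/
theorem IsTessellationIntensity.ae_isAdmissible (hμ : IsTessellationIntensity μ)
    (hη : IsPoissonProcess η μ P) : ∀ᵐ ω ∂P, IsAdmissible (atoms (η ω)) := by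
  have key : ∀ n : ℕ, ∀ᵐ ω ∂P, ∃ t : ℝ,
      (∀ w : Space d, ‖w‖ ≤ n → ∃ x ∈ atoms (η ω), power w x ≤ t) ∧
      (atoms (η ω) ∩ powerRegion d n t).Finite := by
    intro n
    rw [ae_iff]
    refine le_antisymm (ENNReal.le_of_forall_pos_le_add fun ε hε _ => ?_) zero_le
    rw [zero_add]
    obtain ⟨t, ht, ι, J, U, B, hB, hU, hUB, hJ⟩ := hμ.level n ε (by simpa using hε.ne')
    have hfin := hη.ae_finite_inter_powerRegion ht
    rw [ae_iff] at hfin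
    calc P {ω | ¬∃ t : ℝ, (∀ w : Space d, ‖w‖ ≤ n → ∃ x ∈ atoms (η ω), power w x ≤ t) ∧
        (atoms (η ω) ∩ powerRegion d n t).Finite}
        ≤ P ({ω | ¬(atoms (η ω) ∩ powerRegion d n t).Finite} ∪ ⋃ j ∈ J, {ω | η ω (B j) = 0}) := by
          refine measure_mono fun ω hω => ?_
          by_contra hnot
          simp only [mem_union, mem_iUnion, not_or, not_exists, mem_ofPred_eq, not_not] at hnot
          refine hω ⟨t, fun w hw => ?_, hnot.1⟩
          obtain ⟨j, hj, hwj⟩ := mem_iUnion₂.1 (hU (mem_closedBall_zero_iff.2 hw))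
          obtain ⟨x, hx, hxB⟩ := (hη.isDiracSum ω).nonempty_atoms_inter (hB j hj) (hnot.2 j hj)
          exact ⟨x, hx, hUB j hj w hwj x hxB⟩
      _ ≤ P {ω | ¬(atoms (η ω) ∩ powerRegion d n t).Finite} +
            P (⋃ j ∈ J, {ω | η ω (B j) = 0}) := measure_union_le _ _
      _ ≤ 0 + ∑ j ∈ J, P {ω | η ω (B j) = 0} := by
          gcongr
          · exact hfin.le
          · exact measure_biUnion_finset_le _ _
      _ = ∑ j ∈ J, expNeg (μ (B j)) := by
          rw [zero_add]
          exact Finset.sum_congr rfl fun j hj => measure_count_eq_zero (hη.law _ (hB j hj))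
      _ ≤ ε := hJ
  filter_upwards [hη.ae_dense_fst hμ.ball_prod, ae_all_iff.2 key] with ω h1 h2
  refine ⟨h1, fun r => ?_⟩
  obtain ⟨n, hn⟩ := exists_nat_ge r
  obtain ⟨t, ht1, ht2⟩ := h2 n
  exact ⟨t, fun w hw => ht1 w (hw.trans hn),
    ht2.subset (inter_subset_inter_right _ (powerRegion_mono hn le_rfl))⟩

/-- One box suffices: the unit ball times `(-∞, n]` has mass tending to infinity, and its points
have power at most `(r + 1)² + n` over the ball of radius `r`. -/
lemma isTessellationIntensity_of_finite
    (h1 : ∀ (q : Space d) (r : ℝ), 0 < r → μ (Metric.ball q r ×ˢ univ) = ∞)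
    (h2 : ∀ r t, μ (powerRegion d r t) < ∞) : IsTessellationIntensity μ := by
  refine ⟨h1, fun r ε hε => ?_⟩
  let B : ℕ → Set (Space d × ℝ) := fun n => Metric.ball 0 1 ×ˢ Iic (n : ℝ)
  have hmono : Monotone B := fun n m hnm =>
    prod_mono le_rfl (Iic_subset_Iic.2 (by exact_mod_cast hnm))
  have hU : ⋃ n, B n = Metric.ball (0 : Space d) 1 ×ˢ univ := by
    ext x
    simp only [B, mem_iUnion, mem_prod, mem_Iic, mem_univ, and_true, exists_and_left]
    exact ⟨fun h => h.1, fun h => ⟨h, exists_nat_ge _⟩⟩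
  have hlim := tendsto_measure_iUnion_atTop (μ := μ) hmono
  rw [hU, h1 0 1 one_pos] at hlim
  have hlim2 := (continuous_expNeg.tendsto _).comp hlim
  rw [expNeg_top] at hlim2
  obtain ⟨n, hn⟩ := ((tendsto_order.1 hlim2).2 ε (pos_iff_ne_zero.2 hε)).exists
  refine ⟨(r + 1) ^ 2 + n, h2 _ _, Unit, {()}, fun _ => Metric.closedBall 0 r, fun _ => B n,
    fun _ _ => measurableSet_ball.prod measurableSet_Iic,
    fun w hw => mem_iUnion₂.2 ⟨(), by simp, hw⟩, ?_, by simpa using hn.le⟩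
  intro _ _ w hw x hx
  obtain ⟨hx1, hx2⟩ := hx
  refine (power_le w x).trans ?_
  have hw' : ‖w‖ ≤ r := by simpa using hw
  have hx' : ‖x.1‖ ≤ 1 := by simpa using (mem_ball_zero_iff.1 hx1).le
  have hx2' : x.2 ≤ n := hx2
  gcongr

end

/-! ### Random skeletons -/

section

variable {d : ℕ}

lemma IsTessellationIntensity.isRandomClosedSet {μ : Measure (Space d × ℝ)} [SigmaFinite μ]
    (hμ : IsTessellationIntensity μ) {Ω : Type*} [MeasurableSpace Ω] {P : Measure Ω}
    {η : Ω → Measure (Space d × ℝ)} (hη : IsPoissonProcess η μ P) :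
    IsRandomClosedSet (fun ω => delaunaySkel d (η ω)) P := by
  refine ⟨?_, hη.aemeasurable_comp hμ.measure_univ measurable_toClosed_delaunaySkel⟩
  filter_upwards [hμ.ae_isAdmissible hη] with ω hω
  exact hω.isClosed_skel

lemma localTopology_le_fellTopology :
    ClosedSubset.localTopology d ≤ ClosedSubset.fellTopology (Space d) := by
  refine le_generateFrom ?_
  rintro U (⟨K, hK, rfl⟩ | ⟨G, hG, rfl⟩)
  · intro F hF
    obtain ⟨R, hR0, hR⟩ := hK.isBounded.subset_closedBall_lt 0 (0 : Space d)
    refine ⟨R, hR0, fun B hB => ?_⟩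
    have : ∀ A : Set (Space d), A ∩ K = (A ∩ Metric.closedBall 0 R) ∩ K := fun A => by
      rw [inter_assoc, inter_eq_self_of_subset_right hR]
    rw [mem_ofPred_eq, this, hB, ← this]
    exact hF
  · rintro F ⟨x, hxF, hxG⟩
    refine ⟨‖x‖ + 1, by positivity, fun B hB => ⟨x, ?_, hxG⟩⟩
    have : x ∈ F.carrier ∩ Metric.closedBall 0 (‖x‖ + 1) := ⟨hxF, by simp⟩
    rw [← hB] at this
    exact this.1

variable {ι : Type*} {l : Filter ι}

/-! ### Convergence of the coupled skeletons -/

section Coupling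

variable {W : Type*} [MeasurableSpace W] {Pr : Measure W} [IsProbabilityMeasure Pr]
  {N : W → Measure ((Space d × ℝ) × ℝ)} {f : ι → Space d × ℝ → ℝ} {f₀ : Space d × ℝ → ℝ}

/-- Along a subsequence, the coupled skeletons almost surely coincide eventually in every ball. -/
lemma exists_subseq_ae_skel_eq (hN : Measurable N) (hc : ∀ w, IsDiracSum (N w))
    (hL : ∀ g : (Space d × ℝ) × ℝ → ℝ≥0∞, Measurable g →
      ∫⁻ w, expNeg (∫⁻ x, g x ∂N w) ∂Pr = expNeg (∫⁻ x, (1 - expNeg (g x)) ∂(volume.prod volume)))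
    (hf : ∀ i, Measurable (f i)) (hf₀ : Measurable f₀)
    (hball : ∀ (q : Space d) (r : ℝ), 0 < r →
      (volume.withDensity fun x => ENNReal.ofReal (f₀ x)) (Metric.ball q r ×ˢ univ) = ∞)
    (hfin : ∀ r t, (volume.withDensity fun x => ENNReal.ofReal (f₀ x)) (powerRegion d r t) < ∞)
    (hconv : ∀ r t, Tendsto (fun i => ∫⁻ x in powerRegion d r t, ENNReal.ofReal |f i x - f₀ x|)
      l (𝓝 0)) {s : ℕ → ι} (hs : Tendsto s atTop l) :
    ∃ n : ℕ → ℕ, ∀ᵐ w ∂Pr, ∀ R : ℝ, ∀ᶠ k in atTop,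
      delaunaySkel d (thinProcess volume (f (s (n k))) N w) ∩ Metric.closedBall 0 R =
        delaunaySkel d (thinProcess volume f₀ N w) ∩ Metric.closedBall 0 R := by
  -- The indices are chosen so that the disagreement probabilities on the regions used in
  -- `eventually_stabilizes` are summable; Borel–Cantelli then excludes disagreement for all large
  -- `k`.
  have hex : ∀ k : ℕ, ∃ n : ℕ, ∫⁻ x in powerRegion d k ((k : ℝ) ^ 3),
      ENNReal.ofReal |f (s n) x - f₀ x| ≤ (2⁻¹ : ℝ≥0∞) ^ k := fun k =>
    (((tendsto_order.1 ((hconv k ((k : ℝ) ^ 3)).comp hs)).2 _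
      (ENNReal.pow_pos (by simp) k)).exists).imp fun n hn => hn.le
  choose n hn using hex
  refine ⟨n, ?_⟩
  let Δ : ℕ → Set ((Space d × ℝ) × ℝ) := fun k =>
    betweenGraphs (powerRegion d k ((k : ℝ) ^ 3)) f₀ (f (s (n k)))
  have hΔ : ∀ k, MeasurableSet (Δ k) := fun k =>
    measurableSet_betweenGraphs (measurableSet_powerRegion _ _) hf₀ (hf _)
  have hsum : ∑' k, Pr {w | N w (Δ k) ≠ 0} ≠ ∞ := by
    refine ne_top_of_le_ne_top (b := ∑' k : ℕ, (2⁻¹ : ℝ≥0∞) ^ k) ?_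
      (ENNReal.tsum_le_tsum fun k => ?_)
    · rw [ENNReal.tsum_geometric]
      simp
    · refine (measure_count_ne_zero_le hN (hΔ k) (hasLaw_count_of_laplace hN hL (hΔ k))).trans ?_
      rw [prod_betweenGraphs _ (measurableSet_powerRegion _ _) hf₀ (hf _)]
      exact hn k
  have hP₀ := isPoissonProcess_thinProcess (μ := volume) hN hc hL hf₀
  filter_upwards [ae_eventually_notMem hsum, thinProcess_ae_eq (μ := volume) hN hL hf₀,
    ae_all_iff.2 fun k => thinProcess_ae_eq (μ := volume) hN hL (hf (s (n k))),
    hP₀.ae_dense_fst hball, hP₀.ae_forall_finite_inter_powerRegion hfin] with w h1 h2 h3 h4 h5 R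
  filter_upwards [h1, eventually_stabilizes h4 h5 R] with k hk hst
  refine (hst.skel_inter_eq ?_).symm
  rw [h2, h3]
  exact atoms_thin_inter_eq (by simpa using hk)

/-- It is enough that every sequence of indices has a subsequence along which the probabilities
vanish in the limit, and almost sure eventual coincidence provides one. -/
lemma tendsto_measure_skel_ne [l.IsCountablyGenerated] (hN : Measurable N)
    (hc : ∀ w, IsDiracSum (N w))
    (hL : ∀ g : (Space d × ℝ) × ℝ → ℝ≥0∞, Measurable g →
      ∫⁻ w, expNeg (∫⁻ x, g x ∂N w) ∂Pr = expNeg (∫⁻ x, (1 - expNeg (g x)) ∂(volume.prod volume)))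
    (hf : ∀ i, Measurable (f i)) (hf₀ : Measurable f₀)
    (hμ : ∀ i, IsTessellationIntensity (volume.withDensity fun x => ENNReal.ofReal (f i x)))
    (hball : ∀ (q : Space d) (r : ℝ), 0 < r →
      (volume.withDensity fun x => ENNReal.ofReal (f₀ x)) (Metric.ball q r ×ˢ univ) = ∞)
    (hfin : ∀ r t, (volume.withDensity fun x => ENNReal.ofReal (f₀ x)) (powerRegion d r t) < ∞)
    (hconv : ∀ r t, Tendsto (fun i => ∫⁻ x in powerRegion d r t, ENNReal.ofReal |f i x - f₀ x|)
      l (𝓝 0)) (R : ℝ) :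
    Tendsto (fun i => Pr {w | delaunaySkel d (thinProcess volume (f i) N w) ∩
      Metric.closedBall 0 R ≠ delaunaySkel d (thinProcess volume f₀ N w) ∩
        Metric.closedBall 0 R}) l (𝓝 0) := by
  have hZ : ∀ i, IsRandomClosedSet (fun w => delaunaySkel d (thinProcess volume (f i) N w)) Pr :=
    fun i => (hμ i).isRandomClosedSet (isPoissonProcess_thinProcess hN hc hL (hf i))
  have hZ₀ : IsRandomClosedSet (fun w => delaunaySkel d (thinProcess volume f₀ N w)) Pr :=
    (isTessellationIntensity_of_finite hball hfin).isRandomClosedSet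
      (isPoissonProcess_thinProcess hN hc hL hf₀)
  -- The skeletons are measurable only up to null sets, so the event of disagreement is replaced by
  -- one built from measurable representatives.
  let E : ι → Set W := fun i => {w | ((hZ i).2.mk _ w).carrier ∩ Metric.closedBall 0 R =
    ((hZ₀.2.mk _ w)).carrier ∩ Metric.closedBall 0 R}ᶜ
  have hEm : ∀ i, MeasurableSet (E i) := fun i =>
    (((hZ i).2.measurable_mk.prodMk hZ₀.2.measurable_mk)
      (ClosedSubset.measurableSet_inter_closedBall_eq 0 R)).compl
  have hiff : ∀ i, ∀ᵐ w ∂Pr, w ∈ E i ↔ delaunaySkel d (thinProcess volume (f i) N w) ∩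
      Metric.closedBall 0 R ≠ delaunaySkel d (thinProcess volume f₀ N w) ∩
        Metric.closedBall 0 R := by
    intro i
    filter_upwards [(hZ i).2.ae_eq_mk, hZ₀.2.ae_eq_mk, (hZ i).1, hZ₀.1] with w h1 h2 h3 h4
    have e1 : ((hZ i).2.mk _ w).carrier = delaunaySkel d (thinProcess volume (f i) N w) := by
      rw [← h1]; exact h3.closure_eq
    have e2 : (hZ₀.2.mk _ w).carrier = delaunaySkel d (thinProcess volume f₀ N w) := by
      rw [← h2]; exact h4.closure_eq
    rw [mem_compl_iff, mem_ofPred_eq, e1, e2]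
  have heq : ∀ i, Pr {w | delaunaySkel d (thinProcess volume (f i) N w) ∩
      Metric.closedBall 0 R ≠ delaunaySkel d (thinProcess volume f₀ N w) ∩
        Metric.closedBall 0 R} = Pr (E i) := fun i =>
    measure_congr (by filter_upwards [hiff i] with w hw using propext hw.symm)
  simp_rw [heq]
  refine tendsto_of_subseq_tendsto fun s hs => ?_
  obtain ⟨n, hn⟩ := exists_subseq_ae_skel_eq hN hc hL hf hf₀ hball hfin hconv hs
  refine ⟨n, ?_⟩
  have := tendsto_measure_of_ae_tendsto_indicator_of_isFiniteMeasure (μ := Pr) atTop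
    (A := ∅) (As := fun k => E (s (n k))) MeasurableSet.empty (fun k => hEm _) ?_
  · simpa using this
  · filter_upwards [hn, ae_all_iff.2 fun k => hiff (s (n k))] with w h1 h2
    filter_upwards [h1 R] with k hk
    rw [h2 k]
    simp [hk]

lemma tendsto_integral_thinProcess [l.IsCountablyGenerated] (hN : Measurable N)
    (hc : ∀ w, IsDiracSum (N w))
    (hL : ∀ g : (Space d × ℝ) × ℝ → ℝ≥0∞, Measurable g →
      ∫⁻ w, expNeg (∫⁻ x, g x ∂N w) ∂Pr = expNeg (∫⁻ x, (1 - expNeg (g x)) ∂(volume.prod volume)))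
    (hf : ∀ i, Measurable (f i)) (hf₀ : Measurable f₀)
    (hμ : ∀ i, IsTessellationIntensity (volume.withDensity fun x => ENNReal.ofReal (f i x)))
    (hball : ∀ (q : Space d) (r : ℝ), 0 < r →
      (volume.withDensity fun x => ENNReal.ofReal (f₀ x)) (Metric.ball q r ×ˢ univ) = ∞)
    (hfin : ∀ r t, (volume.withDensity fun x => ENNReal.ofReal (f₀ x)) (powerRegion d r t) < ∞)
    (hconv : ∀ r t, Tendsto (fun i => ∫⁻ x in powerRegion d r t, ENNReal.ofReal |f i x - f₀ x|)
      l (𝓝 0)) {F : ClosedSubset (Space d) → ℝ} (hF : Measurable F) {M : ℝ}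
    (hFM : ∀ K, |F K| ≤ M) (hFc : @Continuous _ _ (ClosedSubset.localTopology d) _ F) :
    Tendsto (fun i => ∫ w, F (toClosed (delaunaySkel d (thinProcess volume (f i) N w))) ∂Pr) l
      (𝓝 (∫ w, F (toClosed (delaunaySkel d (thinProcess volume f₀ N w))) ∂Pr)) := by
  have hZ : ∀ i, IsRandomClosedSet (fun w => delaunaySkel d (thinProcess volume (f i) N w)) Pr :=
    fun i => (hμ i).isRandomClosedSet (isPoissonProcess_thinProcess hN hc hL (hf i))
  have hZ₀ : IsRandomClosedSet (fun w => delaunaySkel d (thinProcess volume f₀ N w)) Pr :=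
    (isTessellationIntensity_of_finite hball hfin).isRandomClosedSet
      (isPoissonProcess_thinProcess hN hc hL hf₀)
  refine tendsto_of_subseq_tendsto fun s hs => ?_
  obtain ⟨n, hn⟩ := exists_subseq_ae_skel_eq hN hc hL hf hf₀ hball hfin hconv hs
  refine ⟨n, tendsto_integral_of_dominated_convergence (fun _ => M) (fun k => ?_)
    (integrable_const _) (fun k => ae_of_all _ fun w => hFM _) ?_⟩
  · exact (hF.comp_aemeasurable (hZ _).2).aestronglyMeasurable
  · filter_upwards [hn, ae_all_iff.2 fun k => (hZ (s (n k))).1, hZ₀.1] with w h1 h2 h3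
    -- The radius supplied by local continuity depends on the limiting skeleton, which is harmless
    -- because coincidence eventually holds in every ball.
    refine tendsto_def.2 fun U hU => ?_
    obtain ⟨V, hVU, hVo, hV⟩ := mem_nhds_iff.1 hU
    have hopen := @IsOpen.preimage _ _ (ClosedSubset.localTopology d) _ _ hFc _ hVo
    obtain ⟨R, -, hR⟩ := hopen _ hV
    filter_upwards [h1 R] with k hk
    refine hVU (hR _ ?_)
    simp only [toClosed, (h2 k).closure_eq, h3.closure_eq]
    exact hk

end Coupling

/-! ### Transfer to processes on arbitrary probability spaces -/

variable {Ω : ι → Type*} [∀ i, MeasurableSpace (Ω i)] {P : ∀ i, Measure (Ω i)}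
  [∀ i, IsProbabilityMeasure (P i)] {η : ∀ i, Ω i → Measure (Space d × ℝ)}
  {Ω₀ : Type*} [MeasurableSpace Ω₀] {P₀ : Measure Ω₀} [IsProbabilityMeasure P₀]
  {ζ : Ω₀ → Measure (Space d × ℝ)} {f : ι → Space d × ℝ → ℝ} {f₀ : Space d × ℝ → ℝ}

/-- If the densities converge in `L¹` on the power regions, then the skeletons converge weakly
for the topology of local coincidence. -/
theorem tendsto_integral_delaunaySkel [l.IsCountablyGenerated]
    (hη : ∀ i, IsPoissonProcess (η i) (volume.withDensity fun x => ENNReal.ofReal (f i x)) (P i))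
    (hζ : IsPoissonProcess ζ (volume.withDensity fun x => ENNReal.ofReal (f₀ x)) P₀)
    (hf : ∀ i, Measurable (f i)) (hf₀ : Measurable f₀)
    (hμ : ∀ i, IsTessellationIntensity (volume.withDensity fun x => ENNReal.ofReal (f i x)))
    (hball : ∀ (q : Space d) (r : ℝ), 0 < r →
      (volume.withDensity fun x => ENNReal.ofReal (f₀ x)) (Metric.ball q r ×ˢ univ) = ∞)
    (hfin : ∀ r t, (volume.withDensity fun x => ENNReal.ofReal (f₀ x)) (powerRegion d r t) < ∞)
    (hconv : ∀ r t, Tendsto (fun i => ∫⁻ x in powerRegion d r t, ENNReal.ofReal |f i x - f₀ x|)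
      l (𝓝 0)) {F : ClosedSubset (Space d) → ℝ} (hF : Measurable F) (hFM : ∃ M, ∀ K, |F K| ≤ M)
    (hFc : @Continuous _ _ (ClosedSubset.localTopology d) _ F) :
    Tendsto (fun i => ∫ ω, F (toClosed (delaunaySkel d (η i ω))) ∂P i) l
      (𝓝 (∫ ω, F (toClosed (delaunaySkel d (ζ ω))) ∂P₀)) := by
  obtain ⟨M, hM⟩ := hFM
  obtain ⟨W, _, Pr, _, N, hN, hc, hL⟩ :=
    exists_poisson_laplace ((volume : Measure (Space d × ℝ)).prod (volume : Measure ℝ))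
  have key := tendsto_integral_thinProcess hN hc hL hf hf₀ hμ hball hfin hconv hF hM hFc
  have hμ₀ := isTessellationIntensity_of_finite hball hfin
  -- The given processes may live on unrelated spaces. The expectations depend only on the laws of
  -- the skeletons, which equal those of the thinned versions.
  have htrans : ∀ {g : Space d × ℝ → ℝ} (hg : Measurable g)
      (hgμ : IsTessellationIntensity (volume.withDensity fun x => ENNReal.ofReal (g x)))
      (ν : Measure (ClosedSubset (Space d))),
      ν = Pr.map (fun w => toClosed (delaunaySkel d (thinProcess volume g N w))) →
      ∫ w, F (toClosed (delaunaySkel d (thinProcess volume g N w))) ∂Pr = ∫ K, F K ∂ν := by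
    rintro g hg hgμ ν rfl
    rw [integral_map (hgμ.isRandomClosedSet (isPoissonProcess_thinProcess hN hc hL hg)).2
      hF.aestronglyMeasurable]
  have h0 : ∫ w, F (toClosed (delaunaySkel d (thinProcess volume f₀ N w))) ∂Pr =
      ∫ ω, F (toClosed (delaunaySkel d (ζ ω))) ∂P₀ := by
    rw [htrans hf₀ hμ₀ _ (hζ.map_comp_eq hμ₀.measure_univ measurable_toClosed_delaunaySkel
      (isPoissonProcess_thinProcess hN hc hL hf₀))]
    exact integral_map (hμ₀.isRandomClosedSet hζ).2 hF.aestronglyMeasurable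
  have h1 : ∀ i, ∫ w, F (toClosed (delaunaySkel d (thinProcess volume (f i) N w))) ∂Pr =
      ∫ ω, F (toClosed (delaunaySkel d (η i ω))) ∂P i := by
    intro i
    rw [htrans (hf i) (hμ i) _ ((hη i).map_comp_eq (hμ i).measure_univ
      measurable_toClosed_delaunaySkel (isPoissonProcess_thinProcess hN hc hL (hf i)))]
    exact integral_map ((hμ i).isRandomClosedSet (hη i)).2 hF.aestronglyMeasurable
  simp_rw [h0, h1] at key
  exact key

/-- Weak convergence for the topology of local coincidence implies weak convergence for the Fell
topology. -/
lemma tendstoInDistribution_of_local {Z : ∀ i, Ω i → ClosedSubset (Space d)}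
    {Z₀ : Ω₀ → ClosedSubset (Space d)} (hZ : ∀ i, AEMeasurable (Z i) (P i))
    (hZ₀ : AEMeasurable Z₀ P₀)
    (h : ∀ F : ClosedSubset (Space d) → ℝ, Measurable F → (∃ M, ∀ K, |F K| ≤ M) →
      @Continuous _ _ (ClosedSubset.localTopology d) _ F →
      Tendsto (fun i => ∫ ω, F (Z i ω) ∂P i) l (𝓝 (∫ ω, F (Z₀ ω) ∂P₀))) :
    TendstoInDistribution Z l Z₀ P P₀ := by
  refine ⟨hZ, hZ₀, ?_⟩
  refine ProbabilityMeasure.tendsto_iff_forall_integral_tendsto.2 fun F => ?_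
  have h1 := h F F.continuous.measurable ⟨‖F‖, fun K => F.norm_coe_le_norm K⟩
    (continuous_le_dom localTopology_le_fellTopology F.continuous)
  have h2 : ∀ i, ∫ K, F K ∂((P i).map (Z i)) = ∫ ω, F (Z i ω) ∂P i := fun i =>
    integral_map (hZ i) F.continuous.measurable.aestronglyMeasurable
  have h3 : ∫ K, F K ∂(P₀.map Z₀) = ∫ ω, F (Z₀ ω) ∂P₀ :=
    integral_map hZ₀ F.continuous.measurable.aestronglyMeasurable
  simp only [ProbabilityMeasure.coe_mk, h2, h3]
  exact h1

lemma measurableSet_hit_compact {C : Set (Space d)} (hC : IsCompact C) :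
    MeasurableSet {K : ClosedSubset (Space d) | (K.carrier ∩ C).Nonempty} := by
  have : {K : ClosedSubset (Space d) | (K.carrier ∩ C).Nonempty} =
      {K | K.carrier ∩ C = ∅}ᶜ := by
    ext K
    simp [nonempty_iff_ne_empty]
  rw [this]
  exact (ClosedSubset.isOpen_miss hC).measurableSet.compl

lemma capacity_eq_ofReal_integral {Ω : Type*} [MeasurableSpace Ω] {P : Measure Ω}
    [IsProbabilityMeasure P] {Z : Ω → Set (Space d)} (hZ : IsRandomClosedSet Z P)
    {C : Set (Space d)} (hC : IsCompact C) :
    capacity Z P C = ENNReal.ofReal (∫ ω, ({K : ClosedSubset (Space d) |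
      (K.carrier ∩ C).Nonempty}.indicator (fun _ => (1 : ℝ))) (toClosed (Z ω)) ∂P) := by
  have hm := measurableSet_hit_compact hC
  rw [← integral_map (f := {K : ClosedSubset (Space d) |
      (K.carrier ∩ C).Nonempty}.indicator (fun _ => (1 : ℝ))) hZ.2
      (measurable_const.indicator hm).aestronglyMeasurable, integral_indicator_const _ hm,
    smul_eq_mul, mul_one, measureReal_def,
    Measure.map_apply_of_aemeasurable hZ.2 hm, ENNReal.ofReal_toReal (measure_ne_top _ _), capacity]
  refine measure_congr ?_
  filter_upwards [hZ.1] with ω hω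
  refine propext ?_
  change (Z ω ∩ C).Nonempty ↔ (closure (Z ω) ∩ C).Nonempty
  rw [hω.closure_eq]

/-- Whether a closed set hits `C` is decided inside a ball containing `C`. Capacities therefore
converge for every compact `C`, without a condition on its boundary. -/
lemma continuous_local_indicator_hit {C : Set (Space d)} (hC : IsCompact C) :
    @Continuous _ _ (ClosedSubset.localTopology d) _
      ({K : ClosedSubset (Space d) | (K.carrier ∩ C).Nonempty}.indicator (fun _ => (1 : ℝ))) := by
  refine @Continuous.mk _ _ (ClosedSubset.localTopology d) _ _ fun U _ F hF => ?_
  obtain ⟨R, hR0, hR⟩ := hC.isBounded.subset_closedBall_lt 0 (0 : Space d)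
  refine ⟨R, hR0, fun B hB => ?_⟩
  have : ∀ A : Set (Space d), A ∩ C = (A ∩ Metric.closedBall 0 R) ∩ C := fun A => by
    rw [inter_assoc, inter_eq_self_of_subset_right hR]
  have h2 : B.carrier ∩ C = F.carrier ∩ C := by rw [this, hB, ← this]
  have h3 : B ∈ {K : ClosedSubset (Space d) | (K.carrier ∩ C).Nonempty} ↔
      F ∈ {K : ClosedSubset (Space d) | (K.carrier ∩ C).Nonempty} := by
    rw [mem_ofPred_eq, mem_ofPred_eq, h2]
  rw [mem_preimage] at hF ⊢
  by_cases h : F ∈ {K : ClosedSubset (Space d) | (K.carrier ∩ C).Nonempty}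
  · rw [indicator_of_mem (h3.2 h)]
    rwa [indicator_of_mem h] at hF
  · rw [indicator_of_notMem (mt h3.1 h)]
    rwa [indicator_of_notMem h] at hF

lemma tendsto_capacity_of_local {Z : ∀ i, Ω i → Set (Space d)}
    {Z₀ : Ω₀ → Set (Space d)} (hZ : ∀ i, IsRandomClosedSet (Z i) (P i))
    (hZ₀ : IsRandomClosedSet Z₀ P₀)
    (h : ∀ F : ClosedSubset (Space d) → ℝ, Measurable F → (∃ M, ∀ K, |F K| ≤ M) →
      @Continuous _ _ (ClosedSubset.localTopology d) _ F →
      Tendsto (fun i => ∫ ω, F (toClosed (Z i ω)) ∂P i) l (𝓝 (∫ ω, F (toClosed (Z₀ ω)) ∂P₀)))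
    {C : Set (Space d)} (hC : IsCompact C) :
    Tendsto (fun i => capacity (Z i) (P i) C) l (𝓝 (capacity Z₀ P₀ C)) := by
  simp_rw [fun i => capacity_eq_ofReal_integral (hZ i) hC, capacity_eq_ofReal_integral hZ₀ hC]
  refine ENNReal.tendsto_ofReal (h _ (measurable_const.indicator (measurableSet_hit_compact hC))
    ⟨1, fun K => ?_⟩ (continuous_local_indicator_hit hC))
  by_cases hK : K ∈ {K : ClosedSubset (Space d) | (K.carrier ∩ C).Nonempty}
  · rw [indicator_of_mem hK]; simp
  · rw [indicator_of_notMem hK]; simp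

end

/-! ### Integrals of densities depending on the height only -/

section

variable {d : ℕ}

lemma volume_closedBall_space (q : Space d) {ρ : ℝ} (hρ : 0 ≤ ρ) :
    volume (Metric.closedBall q ρ) =
      ENNReal.ofReal (ρ ^ (d - 1)) * volume (Metric.ball (0 : Space d) 1) := by
  rw [Measure.addHaar_closedBall _ _ hρ, finrank_euclideanSpace_fin]

lemma volume_ball_space (q : Space d) {ρ : ℝ} (hρ : 0 < ρ) :
    volume (Metric.ball q ρ) =
      ENNReal.ofReal (ρ ^ (d - 1)) * volume (Metric.ball (0 : Space d) 1) := by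
  rw [Measure.addHaar_ball_of_pos _ _ hρ, finrank_euclideanSpace_fin]

lemma setLIntegral_powerRegion {g : ℝ → ℝ≥0∞} (hg : Measurable g) (r t : ℝ) :
    ∫⁻ x in powerRegion d r t, g x.2 =
      ∫⁻ h in Iic t, g h * volume (Metric.closedBall (0 : Space d) (r + √(t - h))) := by
  have hm : Measurable ((powerRegion d r t).indicator fun x : Space d × ℝ => g x.2) :=
    (hg.comp measurable_snd).indicator (measurableSet_powerRegion r t)
  rw [← lintegral_indicator (measurableSet_powerRegion r t), Measure.volume_eq_prod,
    lintegral_prod_symm _ hm.aemeasurable, ← lintegral_indicator measurableSet_Iic]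
  congr 1
  ext1 h
  by_cases hh : h ≤ t
  · rw [indicator_of_mem (by exact hh)]
    have : ∀ v : Space d, (powerRegion d r t).indicator (fun x => g x.2) (v, h) =
        (Metric.closedBall (0 : Space d) (r + √(t - h))).indicator (fun _ => g h) v := by
      intro v
      by_cases hv : v ∈ Metric.closedBall (0 : Space d) (r + √(t - h))
      · rw [indicator_of_mem hv, indicator_of_mem (show (v, h) ∈ powerRegion d r t from
          ⟨hh, by simpa using hv⟩)]
      · rw [indicator_of_notMem hv, indicator_of_notMem (show (v, h) ∉ powerRegion d r t from
          fun hp => hv (by simpa using hp.2))]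
    simp_rw [this]
    rw [lintegral_indicator_const measurableSet_closedBall]
  · rw [indicator_of_notMem (by exact hh)]
    have : ∀ v : Space d, (powerRegion d r t).indicator (fun x => g x.2) (v, h) = 0 := fun v =>
      indicator_of_notMem (fun hp => hh hp.1) _
    simp [this]

lemma setLIntegral_rpow_lt_top {T t a : ℝ} (ht : t < T) (ha : a < -1) :
    ∫⁻ h in Iic t, ENNReal.ofReal ((T - h) ^ a) < ∞ := by
  have h1 : ∫⁻ h in Iic t, ENNReal.ofReal ((T - h) ^ a) =
      ∫⁻ s in Ici (T - t), ENNReal.ofReal (s ^ a) := by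
    rw [← lintegral_indicator measurableSet_Iic, ← lintegral_indicator measurableSet_Ici,
      ← lintegral_sub_left_eq_self _ T]
    congr 1
    ext1 h
    by_cases hh : T - t ≤ h
    · rw [indicator_of_mem (show T - h ∈ Iic t from sub_le_comm.1 hh),
        indicator_of_mem (show h ∈ Ici (T - t) from hh), sub_sub_cancel]
    · rw [indicator_of_notMem (fun h' : T - h ∈ Iic t => hh (sub_le_comm.1 h')),
        indicator_of_notMem (show h ∉ Ici (T - t) from hh)]
  rw [h1, setLIntegral_congr Ioi_ae_eq_Ici.symm]
  have := (integrableOn_Ioi_rpow_of_lt ha (sub_pos.2 ht)).2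
  rwa [hasFiniteIntegral_iff_ofReal] at this
  filter_upwards [ae_restrict_mem measurableSet_Ioi] with s hs
  exact Real.rpow_nonneg ((sub_pos.2 ht).trans hs).le _

/-- The slice at height `h` is a ball of radius `O(√(T - h))` in dimension `d - 1`. The integrand is
thus of order `(T - h)^(-b + (d-1)/2)`, and the exponent is below `-1` exactly when `b > (d+1)/2`.
-/
lemma setLIntegral_powerRegion_rpow_lt_top (hd : 1 ≤ d) {T t b : ℝ} (ht : t < T)
    (hb : ((d : ℝ) + 1) / 2 < b) (r : ℝ) :
    ∫⁻ x in powerRegion d r t, ENNReal.ofReal ((T - x.2) ^ (-b)) < ∞ := by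
  set r' := max r 0
  have hr' : 0 ≤ r' := le_max_right _ _
  set δ := T - t
  have hδ : 0 < δ := sub_pos.2 ht
  -- As `√(T - h) ≥ √δ` for `h ≤ t`, both `r'` and `√(t - h)` are absorbed into `C * √(T - h)`.
  set C := r' / √δ + 1
  set V := volume (Metric.ball (0 : Space d) 1)
  have hg : Measurable fun h : ℝ => ENNReal.ofReal ((T - h) ^ (-b)) := by fun_prop
  calc ∫⁻ x in powerRegion d r t, ENNReal.ofReal ((T - x.2) ^ (-b))
      ≤ ∫⁻ x in powerRegion d r' t, ENNReal.ofReal ((T - x.2) ^ (-b)) :=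
        lintegral_mono_set (powerRegion_mono (le_max_left _ _) le_rfl)
    _ = ∫⁻ h in Iic t, ENNReal.ofReal ((T - h) ^ (-b)) *
          volume (Metric.closedBall (0 : Space d) (r' + √(t - h))) :=
        setLIntegral_powerRegion hg r' t
    _ ≤ ∫⁻ h in Iic t, (ENNReal.ofReal (C ^ (d - 1)) * V) *
          ENNReal.ofReal ((T - h) ^ (-b + ((d : ℝ) - 1) / 2)) := by
        refine setLIntegral_mono' measurableSet_Iic fun h hh => ?_
        have hh' : h ≤ t := hh
        have hTh : 0 < T - h := by linarith
        have hρ : r' + √(t - h) ≤ C * √(T - h) := by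
          have e1 : √(t - h) ≤ √(T - h) := Real.sqrt_le_sqrt (by linarith)
          have e2 : √δ ≤ √(T - h) := Real.sqrt_le_sqrt (by simp only [δ]; linarith)
          have e3 : r' ≤ r' / √δ * √(T - h) := by
            rw [div_mul_eq_mul_div, le_div_iff₀ (Real.sqrt_pos.2 hδ)]
            gcongr
          simp only [C]
          linarith
        have hsq : √(T - h) ^ (d - 1) = (T - h) ^ (((d : ℝ) - 1) / 2) := by
          rw [Real.sqrt_eq_rpow, ← Real.rpow_natCast, ← Real.rpow_mul hTh.le]
          congr 1
          rw [Nat.cast_sub hd]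
          push_cast
          ring
        rw [volume_closedBall_space _ (by positivity)]
        calc ENNReal.ofReal ((T - h) ^ (-b)) * (ENNReal.ofReal ((r' + √(t - h)) ^ (d - 1)) * V)
            ≤ ENNReal.ofReal ((T - h) ^ (-b)) *
                (ENNReal.ofReal ((C * √(T - h)) ^ (d - 1)) * V) := by gcongr
          _ = (ENNReal.ofReal (C ^ (d - 1)) * V) *
                ENNReal.ofReal ((T - h) ^ (-b + ((d : ℝ) - 1) / 2)) := by
              rw [mul_pow, hsq, Real.rpow_add hTh,
                ENNReal.ofReal_mul (by positivity : (0 : ℝ) ≤ C ^ (d - 1)),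
                ENNReal.ofReal_mul (by positivity : (0 : ℝ) ≤ (T - h) ^ (-b))]
              ring
    _ = (ENNReal.ofReal (C ^ (d - 1)) * V) *
          ∫⁻ h in Iic t, ENNReal.ofReal ((T - h) ^ (-b + ((d : ℝ) - 1) / 2)) :=
        lintegral_const_mul _ (by fun_prop)
    _ < ∞ := by
        refine ENNReal.mul_lt_top (ENNReal.mul_lt_top ENNReal.ofReal_lt_top measure_ball_lt_top)
          (setLIntegral_rpow_lt_top ht (by linarith))

lemma withDensity_ball_prod_eq_top {g : ℝ → ℝ≥0∞} (hg : Measurable g) (h : ∫⁻ s, g s = ∞)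
    (q : Space d) {r : ℝ} (hr : 0 < r) :
    (volume.withDensity fun x : Space d × ℝ => g x.2) (Metric.ball q r ×ˢ univ) = ∞ := by
  have hm : Measurable fun x : Space d × ℝ => g x.2 := hg.comp measurable_snd
  rw [withDensity_apply _ (measurableSet_ball.prod MeasurableSet.univ), Measure.volume_eq_prod,
    ← Measure.prod_restrict, Measure.restrict_univ, lintegral_prod_symm _ hm.aemeasurable]
  simp only [lintegral_const, Measure.restrict_apply_univ]
  rw [lintegral_mul_const _ hg, h, ENNReal.top_mul]
  exact (Metric.measure_ball_pos _ _ hr).ne'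

lemma lintegral_eq_top_of_le {g : ℝ → ℝ≥0∞} {c a : ℝ} (hc : 0 < c)
    (h : ∀ s, a ≤ s → ENNReal.ofReal c ≤ g s) : ∫⁻ s, g s = ∞ := by
  refine top_le_iff.1 ?_
  calc ∞ = ∫⁻ _ in Ici a, ENNReal.ofReal c := by
        rw [setLIntegral_const, Real.volume_Ici, ENNReal.mul_top]
        simpa using hc
    _ ≤ ∫⁻ s in Ici a, g s := setLIntegral_mono' measurableSet_Ici fun s hs => h s hs
    _ ≤ ∫⁻ s, g s := setLIntegral_le_lintegral _ _

/-! ### Densities with a singularity at a finite height -/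

/-- The function `h ↦ κ (T - h)^{-β}` on `(-∞, T)`. -/
def singularDensity (κ T β h : ℝ) : ℝ := if h < T then κ * (T - h) ^ (-β) else 0

lemma measurable_singularDensity (κ T β : ℝ) : Measurable (singularDensity κ T β) := by
  refine Measurable.ite measurableSet_Iio ?_ measurable_const
  fun_prop

lemma lintegral_singularDensity {κ T β : ℝ} (hκ : 0 < κ) (hβ : 1 ≤ β) :
    ∫⁻ h, ENNReal.ofReal (singularDensity κ T β h) = ∞ := by
  rw [← lintegral_sub_left_eq_self _ T]
  refine top_le_iff.1 ?_
  have h1 : ¬ IntegrableOn (fun s : ℝ => κ * s ^ (-β)) (Ioo 0 1) := by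
    intro h
    have h2 : IntegrableOn (fun s : ℝ => s ^ (-β)) (Ioo 0 1) := by
      have := h.const_mul κ⁻¹
      refine this.congr (ae_of_all _ fun s => ?_)
      simp only
      field_simp
    rw [intervalIntegral.integrableOn_Ioo_rpow_iff one_pos] at h2
    linarith
  have hpos : ∀ᵐ s ∂(volume.restrict (Ioo (0 : ℝ) 1)), 0 ≤ κ * s ^ (-β) := by
    filter_upwards [ae_restrict_mem measurableSet_Ioo] with s hs
    exact mul_nonneg hκ.le (Real.rpow_nonneg hs.1.le _)
  have h3 : ∫⁻ s in Ioo (0 : ℝ) 1, ENNReal.ofReal (κ * s ^ (-β)) = ∞ := by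
    by_contra hne
    refine h1 ⟨by fun_prop, ?_⟩
    rw [hasFiniteIntegral_iff_ofReal hpos]
    exact lt_top_iff_ne_top.2 hne
  calc ∞ = ∫⁻ s in Ioo (0 : ℝ) 1, ENNReal.ofReal (κ * s ^ (-β)) := h3.symm
    _ ≤ ∫⁻ s in Ioo (0 : ℝ) 1, ENNReal.ofReal (singularDensity κ T β (T - s)) := by
        refine setLIntegral_mono' measurableSet_Ioo fun s hs => ?_
        simp only [singularDensity]
        rw [if_pos (by linarith [hs.1]), sub_sub_cancel]
    _ ≤ ∫⁻ s, ENNReal.ofReal (singularDensity κ T β (T - s)) := setLIntegral_le_lintegral _ _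

/-- Rounding each coordinate down costs at most `1/n`, so the norm of the error is at most
`√(d-1)/n`; the cruder `d/n` is enough. -/
lemma exists_grid_point {n : ℕ} (hn : 0 < n) {r : ℝ} {w : Space d} (hw : ‖w‖ ≤ r) :
    ∃ k ∈ Fintype.piFinset fun _ : Fin (d - 1) => Finset.Icc (-(⌈r * n⌉)) ⌈r * n⌉,
      ‖w - WithLp.toLp 2 (fun i => (k i : ℝ) / n)‖ ≤ d / n := by
  have hn' : (0 : ℝ) < n := by exact_mod_cast hn
  have hwi : ∀ i, |w i| ≤ r := fun i => (PiLp.norm_apply_le w i).trans hw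
  refine ⟨fun i => ⌊w i * n⌋, ?_, ?_⟩
  · rw [Fintype.mem_piFinset]
    intro i
    have h1 := abs_le.1 (hwi i)
    rw [Finset.mem_Icc]
    constructor
    · rw [Int.le_floor]
      push_cast
      have := Int.le_ceil (r * n)
      nlinarith
    · have h2 : (⌊w i * n⌋ : ℝ) ≤ ⌈r * n⌉ :=
        (Int.floor_le _).trans ((mul_le_mul_of_nonneg_right h1.2 hn'.le).trans (Int.le_ceil _))
      exact_mod_cast h2
  · rw [EuclideanSpace.norm_eq]
    refine Real.sqrt_le_iff.2 ⟨by positivity, ?_⟩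
    have h1 : ∀ i : Fin (d - 1), ‖(w - WithLp.toLp 2 (fun i => ((⌊w i * n⌋ : ℤ) : ℝ) / n) :
        Space d) i‖ ^ 2 ≤ (1 / (n : ℝ)) ^ 2 := by
      intro i
      have e : (w - WithLp.toLp 2 (fun i => ((⌊w i * n⌋ : ℤ) : ℝ) / n) : Space d) i =
          (w i * n - ⌊w i * n⌋) / n := by
        rw [sub_div, mul_div_cancel_right₀ _ hn'.ne']
        rfl
      rw [e, Real.norm_eq_abs, sq_abs]
      have := Int.floor_le (w i * n)
      have := Int.lt_floor_add_one (w i * n)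
      exact pow_le_pow_left₀ (div_nonneg (by linarith) hn'.le)
        (div_le_div_of_nonneg_right (by linarith) hn'.le) 2
    calc ∑ i, ‖(w - WithLp.toLp 2 (fun i => ((⌊w i * n⌋ : ℤ) : ℝ) / n) : Space d) i‖ ^ 2
        ≤ ∑ _i : Fin (d - 1), (1 / (n : ℝ)) ^ 2 := Finset.sum_le_sum fun i _ => h1 i
      _ = ((d - 1 : ℕ) : ℝ) * (1 / (n : ℝ)) ^ 2 := by simp
      _ ≤ ((d : ℝ) ^ 2) * (1 / (n : ℝ)) ^ 2 := by
          gcongr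
          rcases Nat.eq_zero_or_pos d with h | h
          · simp [h]
          · have e1 : ((d - 1 : ℕ) : ℝ) ≤ d := by exact_mod_cast Nat.sub_le _ _
            have e2 : (1 : ℝ) ≤ d := by exact_mod_cast h
            nlinarith
      _ = (d / n) ^ 2 := by ring

lemma tendsto_rpow_mul_exp_neg_rpow (m : ℕ) {C γ : ℝ} (hC : 0 < C) (hγ : 0 < γ) :
    Tendsto (fun n : ℕ => (n : ℝ) ^ m * Real.exp (-(C * (n : ℝ) ^ γ))) atTop (𝓝 0) := by
  have h1 := (tendsto_rpow_mul_exp_neg_mul_atTop_nhds_zero ((m : ℝ) / γ) C hC).comp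
    ((tendsto_rpow_atTop hγ).comp tendsto_natCast_atTop_atTop)
  refine h1.congr fun n => ?_
  simp only [Function.comp_apply]
  rw [← Real.rpow_mul (Nat.cast_nonneg n), mul_div_cancel₀ _ hγ.ne', Real.rpow_natCast, neg_mul]

/-- Regions reaching the height `T` can have infinite mass, so the level must stay below `T`. A grid
of mesh `1/n` uses `O(n^(d-1))` boxes just under `T`, each of mass at least `C n^γ` with `γ > 0`;
the chance that one is empty is `O(n^(d-1) exp (-C n^γ))`. -/
lemma isTessellationIntensity_singularDensity (hd : 2 ≤ d) {κ T β : ℝ} (hκ : 0 < κ)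
    (hβ : ((d : ℝ) + 1) / 2 < β) :
    IsTessellationIntensity (volume.withDensity fun x : Space d × ℝ =>
      ENNReal.ofReal (singularDensity κ T β x.2)) := by
  have hd' : (2 : ℝ) ≤ d := by exact_mod_cast hd
  have hgm : Measurable fun h => ENNReal.ofReal (singularDensity κ T β h) :=
    (measurable_singularDensity κ T β).ennreal_ofReal
  refine ⟨fun q r hr => withDensity_ball_prod_eq_top hgm
    (lintegral_singularDensity hκ (by linarith)) q hr, fun r₀ ε hε => ?_⟩
  set μ := volume.withDensity fun x : Space d × ℝ => ENNReal.ofReal (singularDensity κ T β x.2)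
  set r := max r₀ 0
  have hr : 0 ≤ r := le_max_right _ _
  set V := volume (Metric.ball (0 : Space d) 1)
  have hV : 0 < V.toReal := ENNReal.toReal_pos (Metric.measure_ball_pos _ _ one_pos).ne'
    measure_ball_lt_top.ne
  -- A centre within `d/n` of a grid point is within `c/n` of every point less than `1/n` from that
  -- grid point.
  set c : ℝ := d + 1
  have hc : 0 < c := by positivity
  -- The box mass scales as `δ^(1-β) n^(-(d-1))` with `δ` of order `n^(-2)`, which is `n^(2β - d -
  -- 1)`.
  set γ : ℝ := 2 * β - d - 1
  have hγ : 0 < γ := by simp only [γ]; linarith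
  set C : ℝ := κ * (4 * c ^ 2) ^ (-β) * (2 * c ^ 2) * V.toReal
  have hC : 0 < C := by positivity
  have hlim : Tendsto (fun n : ℕ => (2 * r + 5) ^ (d - 1) *
      ((n : ℝ) ^ (d - 1) * Real.exp (-(C * (n : ℝ) ^ γ)))) atTop (𝓝 0) := by
    simpa using (tendsto_rpow_mul_exp_neg_rpow (d - 1) hC hγ).const_mul ((2 * r + 5) ^ (d - 1))
  have hlim' := (ENNReal.tendsto_ofReal hlim)
  rw [ENNReal.ofReal_zero] at hlim'
  obtain ⟨n, hnε, hn⟩ := (((tendsto_order.1 hlim').2 ε (pos_iff_ne_zero.2 hε)).and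
    (eventually_gt_atTop 0)).exists
  have hn' : (0 : ℝ) < n := by exact_mod_cast hn
  have hn1 : (1 : ℝ) ≤ n := by exact_mod_cast hn
  -- With this `δ`, points below `T - δ` have power at most `c²/n² + T - δ = T - c²/n²`, the chosen
  -- level.
  set δ : ℝ := 2 * c ^ 2 / n ^ 2
  have hδ : 0 < δ := by positivity
  refine ⟨T - c ^ 2 / n ^ 2, ?_, Fin (d - 1) → ℤ,
    Fintype.piFinset fun _ : Fin (d - 1) => Finset.Icc (-(⌈r * n⌉)) ⌈r * n⌉,
    fun k => Metric.closedBall (WithLp.toLp 2 (fun i => (k i : ℝ) / n)) (d / n),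
    fun k => Metric.ball (WithLp.toLp 2 (fun i => (k i : ℝ) / n)) (1 / n) ×ˢ
      Ioo (T - 2 * δ) (T - δ), ?_, ?_, ?_, ?_⟩
  · have hlt : T - c ^ 2 / n ^ 2 < T := by
      have : 0 < c ^ 2 / n ^ 2 := by positivity
      linarith
    rw [withDensity_apply _ (measurableSet_powerRegion _ _)]
    calc ∫⁻ x in powerRegion d r₀ (T - c ^ 2 / n ^ 2), ENNReal.ofReal (singularDensity κ T β x.2)
        ≤ ∫⁻ x in powerRegion d r₀ (T - c ^ 2 / n ^ 2),
            ENNReal.ofReal κ * ENNReal.ofReal ((T - x.2) ^ (-β)) := by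
          refine setLIntegral_mono' (measurableSet_powerRegion _ _) fun x hx => ?_
          rw [← ENNReal.ofReal_mul hκ.le, singularDensity, if_pos (hx.1.trans_lt hlt)]
      _ = ENNReal.ofReal κ * ∫⁻ x in powerRegion d r₀ (T - c ^ 2 / n ^ 2),
            ENNReal.ofReal ((T - x.2) ^ (-β)) := lintegral_const_mul _ (by fun_prop)
      _ < ∞ := ENNReal.mul_lt_top ENNReal.ofReal_lt_top
          (setLIntegral_powerRegion_rpow_lt_top (by omega) hlt hβ r₀)
  · exact fun k _ => measurableSet_ball.prod measurableSet_Ioo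
  · intro w hw
    obtain ⟨k, hk, hwk⟩ := exists_grid_point hn
      (((mem_closedBall_zero_iff.1 hw).trans (le_max_left _ _)) : ‖w‖ ≤ r)
    exact mem_iUnion₂.2 ⟨k, hk, mem_closedBall_iff_norm.2 hwk⟩
  · rintro k - w hw x ⟨hx1, hx2⟩
    have h1 : ‖w - x.1‖ ≤ c / n := by
      rw [mem_closedBall_iff_norm] at hw
      rw [mem_ball_iff_norm'] at hx1
      have := norm_add_le (w - WithLp.toLp 2 (fun i => (k i : ℝ) / n))
        (WithLp.toLp 2 (fun i => (k i : ℝ) / n) - x.1)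
      rw [sub_add_sub_cancel] at this
      calc ‖w - x.1‖ ≤ d / n + 1 / n := by linarith
        _ = c / n := by simp only [c]; ring
    have h2 : ‖w - x.1‖ ^ 2 ≤ (c / n) ^ 2 := by gcongr
    have h3 := hx2.2
    have h4 : δ = c ^ 2 / n ^ 2 + c ^ 2 / n ^ 2 := by simp only [δ]; ring
    rw [div_pow] at h2
    simp only [power]
    linarith
  · have hB : ∀ q : Space d, ENNReal.ofReal (C * (n : ℝ) ^ γ) ≤
        μ (Metric.ball q (1 / n) ×ˢ Ioo (T - 2 * δ) (T - δ)) := by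
      intro q
      rw [withDensity_apply _ (measurableSet_ball.prod measurableSet_Ioo)]
      calc ENNReal.ofReal (C * (n : ℝ) ^ γ)
          = ENNReal.ofReal (κ * (2 * δ) ^ (-β)) *
            volume (Metric.ball q (1 / n) ×ˢ Ioo (T - 2 * δ) (T - δ)) := by
            rw [Measure.volume_eq_prod, Measure.prod_prod, volume_ball_space q (by positivity),
              Real.volume_Ioo, ← ENNReal.ofReal_toReal (measure_ball_lt_top (μ := volume)
                (x := (0 : Space d)) (r := 1)).ne, ← ENNReal.ofReal_mul (by positivity),
              ← ENNReal.ofReal_mul (by positivity), ← ENNReal.ofReal_mul (by positivity)]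
            congr 1
            have e1 : T - δ - (T - 2 * δ) = δ := by ring
            have e2 : 2 * δ = 4 * c ^ 2 * ((n : ℝ) ^ (-2 : ℝ)) := by
              rw [Real.rpow_neg hn'.le, Real.rpow_ofNat]
              simp only [δ]
              ring
            have e3 : δ = 2 * c ^ 2 * ((n : ℝ) ^ (-2 : ℝ)) := by linarith
            have e4 : (1 / (n : ℝ)) ^ (d - 1) = (n : ℝ) ^ (-((d : ℝ) - 1)) := by
              rw [Real.rpow_neg hn'.le, one_div, inv_pow, ← Real.rpow_natCast,
                Nat.cast_sub (by omega)]
              simp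
            rw [e1, e2, Real.mul_rpow (by positivity) (by positivity), ← Real.rpow_mul hn'.le, e4,
              e3]
            have e5 : (n : ℝ) ^ γ = (n : ℝ) ^ (-2 * -β) * (n : ℝ) ^ (-((d : ℝ) - 1)) *
                (n : ℝ) ^ (-2 : ℝ) := by
              rw [← Real.rpow_add hn', ← Real.rpow_add hn']
              congr 1
              simp only [γ]
              ring
            rw [e5]
            simp only [C, V]
            ring
        _ = ∫⁻ _ in Metric.ball q (1 / n) ×ˢ Ioo (T - 2 * δ) (T - δ),
              ENNReal.ofReal (κ * (2 * δ) ^ (-β)) := by rw [setLIntegral_const]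
        _ ≤ ∫⁻ x in Metric.ball q (1 / n) ×ˢ Ioo (T - 2 * δ) (T - δ),
              ENNReal.ofReal (singularDensity κ T β x.2) := by
            refine setLIntegral_mono' (measurableSet_ball.prod measurableSet_Ioo) fun x hx => ?_
            have hx1 : T - 2 * δ < x.2 := hx.2.1
            have hx2 : x.2 < T - δ := hx.2.2
            rw [singularDensity, if_pos (by linarith)]
            refine ENNReal.ofReal_le_ofReal (mul_le_mul_of_nonneg_left ?_ hκ.le)
            exact Real.rpow_le_rpow_of_nonpos (by linarith) (by linarith) (by linarith)
    calc ∑ k ∈ Fintype.piFinset fun _ : Fin (d - 1) => Finset.Icc (-(⌈r * n⌉)) ⌈r * n⌉,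
          expNeg (μ (Metric.ball (WithLp.toLp 2 (fun i => (k i : ℝ) / n)) (1 / n) ×ˢ
            Ioo (T - 2 * δ) (T - δ)))
        ≤ ∑ _k ∈ Fintype.piFinset fun _ : Fin (d - 1) => Finset.Icc (-(⌈r * n⌉)) ⌈r * n⌉,
          ENNReal.ofReal (Real.exp (-(C * (n : ℝ) ^ γ))) := by
          refine Finset.sum_le_sum fun k _ => ?_
          rw [← expNeg_ofReal (by positivity)]
          exact expNeg_antitone (hB _)
      _ = ENNReal.ofReal ((((Finset.Icc (-(⌈r * n⌉)) ⌈r * n⌉).card : ℝ)) ^ (d - 1) *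
            Real.exp (-(C * (n : ℝ) ^ γ))) := by
          rw [Finset.sum_const, Fintype.card_piFinset, Finset.prod_const, Finset.card_univ,
            Fintype.card_fin, nsmul_eq_mul, ENNReal.ofReal_mul (by positivity)]
          congr 1
          rw [ENNReal.ofReal_pow (by positivity), ENNReal.ofReal_natCast]
          push_cast
          rfl
      _ ≤ ENNReal.ofReal ((2 * r + 5) ^ (d - 1) *
            ((n : ℝ) ^ (d - 1) * Real.exp (-(C * (n : ℝ) ^ γ)))) := by
          refine ENNReal.ofReal_le_ofReal ?_
          rw [← mul_assoc, ← mul_pow]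
          have hcard : ((Finset.Icc (-(⌈r * n⌉)) ⌈r * n⌉).card : ℝ) ≤ (2 * r + 5) * n := by
            rw [Int.card_Icc]
            have h0 : 0 ≤ ⌈r * n⌉ := Int.ceil_nonneg (by positivity)
            have h1 : ((⌈r * n⌉ + 1 - -⌈r * n⌉).toNat : ℝ) = 2 * (⌈r * n⌉ : ℝ) + 1 := by
              have : ((⌈r * n⌉ + 1 - -⌈r * n⌉).toNat : ℤ) = 2 * ⌈r * n⌉ + 1 := by
                rw [Int.toNat_of_nonneg (by omega)]; ring
              exact_mod_cast this
            rw [h1]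
            have := Int.ceil_lt_add_one (r * n)
            nlinarith
          gcongr
      _ ≤ ε := hnε.le

end

/-! ### Ratios of Gamma functions -/

section

/-- Log-convexity at the midpoint of `x` and `x + 1`, combined with `Γ(x + 1) = x Γ(x)`. -/
lemma Real.Gamma_add_half_le {x : ℝ} (hx : 0 < x) :
    Real.Gamma (x + 1 / 2) ≤ Real.Gamma x * √x := by
  have h := Real.Gamma_mul_add_mul_le_rpow_Gamma_mul_rpow_Gamma hx (by linarith : 0 < x + 1)
    (a := 1 / 2) (b := 1 / 2) (by norm_num) (by norm_num) (by norm_num)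
  have hG := Real.Gamma_pos_of_pos hx
  rw [← Real.sqrt_eq_rpow, ← Real.sqrt_eq_rpow, Real.Gamma_add_one hx.ne',
    ← Real.sqrt_mul hG.le] at h
  calc Real.Gamma (x + 1 / 2) = Real.Gamma (1 / 2 * x + 1 / 2 * (x + 1)) := by congr 1; ring
    _ ≤ _ := h
    _ = Real.Gamma x * √x := by
        rw [show Real.Gamma x * (x * Real.Gamma x) = Real.Gamma x ^ 2 * x by ring,
          Real.sqrt_mul (by positivity), Real.sqrt_sq hG.le]

lemma tendsto_sqrt_add_div_sqrt (c : ℝ) :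
    Tendsto (fun x : ℝ => √(x + c) / √x) atTop (𝓝 1) := by
  have h1 : Tendsto (fun x : ℝ => √(1 + c / x)) atTop (𝓝 √(1 + 0)) :=
    ((tendsto_const_nhds.add (tendsto_const_nhds.div_atTop tendsto_id))).sqrt
  rw [add_zero, Real.sqrt_one] at h1
  refine h1.congr' ?_
  filter_upwards [eventually_gt_atTop 0] with x hx
  rw [← Real.sqrt_div' _ hx.le, add_div, div_self hx.ne']

/-- `Real.Gamma_add_half_le` at `x` is the upper bound. At `x + 1/2` it bounds `Γ(x + 1) = x Γ(x)`
and so yields the lower one. -/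
lemma tendsto_Gamma_add_half_div :
    Tendsto (fun x : ℝ => Real.Gamma (x + 1 / 2) / (Real.Gamma x * √x)) atTop (𝓝 1) := by
  have hlow : Tendsto (fun x : ℝ => (√(x + 1 / 2) / √x)⁻¹) atTop (𝓝 1) := by
    simpa using (tendsto_sqrt_add_div_sqrt (1 / 2)).inv₀ one_ne_zero
  refine tendsto_of_tendsto_of_tendsto_of_le_of_le' hlow tendsto_const_nhds ?_ ?_
  · filter_upwards [eventually_gt_atTop 0] with x hx
    have hG := Real.Gamma_pos_of_pos hx
    have h := Real.Gamma_add_half_le (by linarith : 0 < x + 1 / 2)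
    rw [add_assoc, add_halves, Real.Gamma_add_one hx.ne'] at h
    have hs : 0 < √x := Real.sqrt_pos.2 hx
    have hs' : 0 < √(x + 1 / 2) := Real.sqrt_pos.2 (by linarith)
    rw [inv_div, div_le_div_iff₀ hs' (by positivity)]
    calc √x * (Real.Gamma x * √x) = √x ^ 2 * Real.Gamma x := by ring
      _ ≤ _ := by rwa [Real.sq_sqrt hx.le]
  · filter_upwards [eventually_gt_atTop 0] with x hx
    have hG := Real.Gamma_pos_of_pos hx
    exact div_le_one_of_le₀ (Real.Gamma_add_half_le hx) (by positivity)

lemma tendsto_Gamma_add_nat_half_div (n : ℕ) :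
    Tendsto (fun x : ℝ => Real.Gamma (x + n / 2) / (Real.Gamma x * √x ^ n)) atTop (𝓝 1) := by
  induction n with
  | zero =>
    refine tendsto_const_nhds.congr' ?_
    filter_upwards [eventually_gt_atTop 0] with x hx
    have hG := Real.Gamma_pos_of_pos hx
    simp [hG.ne']
  | succ n ih =>
    have h1 := tendsto_Gamma_add_half_div.comp
      (tendsto_atTop_add_const_right atTop ((n : ℝ) / 2) tendsto_id)
    have h2 := (h1.mul ih).mul (tendsto_sqrt_add_div_sqrt ((n : ℝ) / 2))
    simp only [mul_one] at h2
    refine h2.congr' ?_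
    filter_upwards [eventually_gt_atTop 0] with x hx
    have hy : 0 < x + (n : ℝ) / 2 := by positivity
    have hG := Real.Gamma_pos_of_pos hx
    have hG' := Real.Gamma_pos_of_pos hy
    have hs : 0 < √x := Real.sqrt_pos.2 hx
    have hs' : 0 < √(x + (n : ℝ) / 2) := Real.sqrt_pos.2 hy
    simp only [Function.comp_apply, id]
    have e : x + ((n + 1 : ℕ) : ℝ) / 2 = x + (n : ℝ) / 2 + 1 / 2 := by push_cast; ring
    rw [e, pow_succ]
    field_simp

end

/-! ### The rescaled densities -/

section

variable {d : ℕ}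

/-- The normalization of the rescaled `β`-density. -/
def betaConst (d : ℕ) (β : ℝ) : ℝ := cBeta d β / √(2 * β) ^ d

/-- The normalization of the rescaled `β'`-density. -/
def betaConst' (d : ℕ) (β : ℝ) : ℝ := cBeta' d β / √(2 * β) ^ d

/-- The density of the intensity measure of `ζ_β`, as a function of the height. -/
def betaDensity (d : ℕ) (β h : ℝ) : ℝ :=
  if 0 ≤ 1 + h / (2 * β) then betaConst d β * (1 + h / (2 * β)) ^ β else 0

/-- The density of the intensity measure of `ζ'_β`, as a function of the height. -/
def betaDensity' (d : ℕ) (β h : ℝ) : ℝ :=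
  singularDensity (betaConst' d β * (2 * β) ^ β) (2 * β) β h

/-- The density of the intensity measure of `ζ`, as a function of the height. -/
def gaussDensity (d : ℕ) (h : ℝ) : ℝ :=
  (2 * Real.pi) ^ (-((d : ℝ) / 2)) * Real.exp (h / 2)

lemma measurable_betaDensity (d : ℕ) (β : ℝ) : Measurable (betaDensity d β) := by
  refine Measurable.ite (measurableSet_le measurable_const (by fun_prop)) ?_ measurable_const
  fun_prop

lemma measurable_betaDensity' (d : ℕ) (β : ℝ) : Measurable (betaDensity' d β) :=
  measurable_singularDensity _ _ _

lemma measurable_gaussDensity (d : ℕ) : Measurable (gaussDensity d) := by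
  unfold gaussDensity
  fun_prop

lemma betaConst_pos (d : ℕ) {β : ℝ} (hβ : 0 < β) : 0 < betaConst d β := by
  have h1 : 0 < Real.Gamma ((d : ℝ) / 2 + β + 1) := Real.Gamma_pos_of_pos (by positivity)
  have h2 : 0 < Real.Gamma (β + 1) := Real.Gamma_pos_of_pos (by positivity)
  unfold betaConst cBeta
  positivity

lemma betaConst'_pos {β : ℝ} (hβ : (d : ℝ) / 2 < β) : 0 < betaConst' d β := by
  have hβ0 : 0 < β := lt_of_le_of_lt (by positivity) hβ
  have h1 : 0 < Real.Gamma β := Real.Gamma_pos_of_pos hβ0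
  have h2 : 0 < Real.Gamma (β - (d : ℝ) / 2) := Real.Gamma_pos_of_pos (by linarith)
  unfold betaConst' cBeta'
  positivity

lemma two_mul_pi_rpow_neg (d : ℕ) :
    (2 * Real.pi) ^ (-((d : ℝ) / 2)) = (Real.pi ^ ((d : ℝ) / 2) * √2 ^ d)⁻¹ := by
  rw [Real.rpow_neg (by positivity), Real.mul_rpow (by positivity) (by positivity), mul_comm,
    Real.sqrt_eq_rpow, ← Real.rpow_natCast, ← Real.rpow_mul (by positivity)]
  congr 4
  ring

lemma tendsto_betaConst (d : ℕ) :
    Tendsto (betaConst d) atTop (𝓝 ((2 * Real.pi) ^ (-((d : ℝ) / 2)))) := by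
  have h1 := (tendsto_Gamma_add_nat_half_div d).comp
    (tendsto_atTop_add_const_right atTop (1 : ℝ) tendsto_id)
  have h2 := (h1.mul ((tendsto_sqrt_add_div_sqrt 1).pow d)).mul_const
    ((2 * Real.pi) ^ (-((d : ℝ) / 2)))
  simp only [one_pow, mul_one, one_mul] at h2
  refine h2.congr' ?_
  filter_upwards [eventually_gt_atTop 0] with β hβ
  have hG := Real.Gamma_pos_of_pos (by positivity : 0 < β + 1)
  have hs : 0 < √β := Real.sqrt_pos.2 hβ
  have hs' : 0 < √(β + 1) := Real.sqrt_pos.2 (by positivity)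
  have hpi : 0 < Real.pi ^ ((d : ℝ) / 2) := by positivity
  simp only [Function.comp_apply, id, betaConst, cBeta]
  rw [two_mul_pi_rpow_neg, Real.sqrt_mul zero_le_two,
    show (d : ℝ) / 2 + β + 1 = β + 1 + d / 2 by ring,
    mul_pow, div_pow]
  field_simp

lemma tendsto_betaConst' (d : ℕ) :
    Tendsto (betaConst' d) atTop (𝓝 ((2 * Real.pi) ^ (-((d : ℝ) / 2)))) := by
  have h1 := (tendsto_Gamma_add_nat_half_div d).comp
    (tendsto_atTop_add_const_right atTop (-((d : ℝ) / 2)) tendsto_id)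
  have h2 := (h1.mul ((tendsto_sqrt_add_div_sqrt (-((d : ℝ) / 2))).pow d)).mul_const
    ((2 * Real.pi) ^ (-((d : ℝ) / 2)))
  simp only [one_pow, mul_one, one_mul] at h2
  refine h2.congr' ?_
  filter_upwards [eventually_gt_atTop ((d : ℝ) / 2)] with β hβ
  have hβ0 : 0 < β := lt_of_le_of_lt (by positivity) hβ
  have hx : 0 < β + -((d : ℝ) / 2) := by linarith
  have hG := Real.Gamma_pos_of_pos hx
  have hs : 0 < √β := Real.sqrt_pos.2 hβ0
  have hs' : 0 < √(β + -((d : ℝ) / 2)) := Real.sqrt_pos.2 hx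
  have hpi : 0 < Real.pi ^ ((d : ℝ) / 2) := by positivity
  simp only [Function.comp_apply, id, betaConst', cBeta']
  rw [two_mul_pi_rpow_neg, Real.sqrt_mul zero_le_two, neg_add_cancel_right, sub_eq_add_neg,
    mul_pow, div_pow]
  generalize β + -((d : ℝ) / 2) = x at hG hs'
  field_simp

lemma betaDensity'_of_lt {β h : ℝ} (hβ : 0 < β) (h' : h < 2 * β) :
    betaDensity' d β h = betaConst' d β * (1 - h / (2 * β)) ^ (-β) := by
  rw [betaDensity', singularDensity, if_pos h',
    show 1 - h / (2 * β) = (2 * β - h) / (2 * β) by field_simp,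
    Real.div_rpow (by linarith) (by positivity), Real.rpow_neg (by positivity : 0 ≤ 2 * β)]
  field_simp

lemma tendsto_betaDensity (d : ℕ) (h : ℝ) :
    Tendsto (fun β => betaDensity d β h) atTop (𝓝 (gaussDensity d h)) := by
  refine ((tendsto_betaConst d).mul (Real.tendsto_one_add_div_rpow_exp (h / 2))).congr' ?_
  filter_upwards [eventually_gt_atTop (max 0 (-h))] with β hβ
  have h0 : 0 < β := (le_max_left _ _).trans_lt hβ
  have h1 : -h < β := (le_max_right _ _).trans_lt hβ
  have h2 : 0 ≤ 1 + h / (2 * β) := by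
    rw [show 1 + h / (2 * β) = (2 * β + h) / (2 * β) by field_simp]
    exact div_nonneg (by linarith) (by linarith)
  rw [betaDensity, if_pos h2, div_div]

lemma tendsto_betaDensity' (d : ℕ) (h : ℝ) :
    Tendsto (fun β => betaDensity' d β h) atTop (𝓝 (gaussDensity d h)) := by
  have h1 := (Real.tendsto_one_add_div_rpow_exp (-(h / 2))).inv₀ (Real.exp_pos _).ne'
  rw [← Real.exp_neg, neg_neg] at h1
  refine ((tendsto_betaConst' d).mul h1).congr' ?_
  filter_upwards [eventually_gt_atTop (max 0 h)] with β hβ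
  have h0 : 0 < β := (le_max_left _ _).trans_lt hβ
  have h1 : h < β := (le_max_right _ _).trans_lt hβ
  have e : 1 - h / (2 * β) = 1 + -(h / 2) / β := by
    field_simp
    ring
  have h2 : 0 ≤ 1 + -(h / 2) / β := by
    rw [← e, sub_nonneg]
    exact div_le_one_of_le₀ (by linarith) (by linarith)
  rw [betaDensity'_of_lt h0 (by linarith), e, Real.rpow_neg h2]

/-! ### Domination -/

lemma one_sub_rpow_neg_eq {b h : ℝ} (hb : 0 < b) (h' : h < 2 * b) :
    ((1 - h / (2 * b)) ^ b)⁻¹ = (2 * b) ^ b * (2 * b - h) ^ (-b) := by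
  rw [show 1 - h / (2 * b) = (2 * b - h) / (2 * b) by field_simp,
    Real.div_rpow (by linarith) (by positivity), Real.rpow_neg (by linarith), inv_div,
    div_eq_mul_inv]

lemma one_sub_div_pos {b h : ℝ} (hb : 0 < b) (h' : h < 2 * b) : 0 < 1 - h / (2 * b) := by
  rw [sub_pos, div_lt_one (by positivity)]
  exact h'

/-- The right-hand side is `(1 - h/(2b))^(-b)`, so this is `1 - x ≤ exp (-x)` raised to the power
`b` and inverted. -/
lemma exp_half_le {b h : ℝ} (hb : 0 < b) (h' : h < 2 * b) :
    Real.exp (h / 2) ≤ (2 * b) ^ b * (2 * b - h) ^ (-b) := by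
  have h0 := one_sub_div_pos hb h'
  rw [← one_sub_rpow_neg_eq hb h', ← neg_neg (h / 2), Real.exp_neg]
  refine inv_anti₀ (by positivity) ?_
  calc (1 - h / (2 * b)) ^ b ≤ Real.exp (-(h / (2 * b))) ^ b :=
        Real.rpow_le_rpow h0.le (Real.one_sub_le_exp_neg _) hb.le
    _ = Real.exp (-(h / 2)) := by
        rw [← Real.exp_mul]
        congr 1
        field_simp

/-- Bernoulli's inequality with exponent `β/b ≥ 1` shows that `(1 - h/(2β))^(-β)` does not exceed
its value at `b`. A single function thus dominates all `β ≥ b`. -/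
lemma one_sub_div_rpow_neg_le {b β h : ℝ} (hb : 0 < b) (hβ : b ≤ β) (h' : h < 2 * b) :
    (1 - h / (2 * β)) ^ (-β) ≤ (2 * b) ^ b * (2 * b - h) ^ (-b) := by
  have hβ0 : 0 < β := hb.trans_le hβ
  have h0 := one_sub_div_pos hb h'
  have h1 := one_sub_div_pos hβ0 (by linarith : h < 2 * β)
  rw [← one_sub_rpow_neg_eq hb h', Real.rpow_neg h1.le]
  refine inv_anti₀ (by positivity) ?_
  have hB := one_add_mul_self_le_rpow_one_add (s := -(h / (2 * β))) (p := β / b) (by linarith)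
    ((one_le_div hb).2 hβ)
  calc (1 - h / (2 * b)) ^ b = (1 + β / b * -(h / (2 * β))) ^ b := by
        congr 1
        field_simp
        ring
    _ ≤ ((1 + -(h / (2 * β))) ^ (β / b)) ^ b :=
        Real.rpow_le_rpow (h0.le.trans_eq (by field_simp; ring)) hB hb.le
    _ = (1 - h / (2 * β)) ^ β := by
        rw [← sub_eq_add_neg, ← Real.rpow_mul h1.le, div_mul_cancel₀ _ hb.ne']

lemma one_add_div_rpow_le {β h : ℝ} (hβ : 0 < β) (h' : 0 ≤ 1 + h / (2 * β)) :
    (1 + h / (2 * β)) ^ β ≤ Real.exp (h / 2) := by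
  calc (1 + h / (2 * β)) ^ β ≤ Real.exp (h / (2 * β)) ^ β :=
        Real.rpow_le_rpow h' (by rw [add_comm]; exact Real.add_one_le_exp _) hβ.le
    _ = Real.exp (h / 2) := by
        rw [← Real.exp_mul]
        congr 1
        field_simp

lemma abs_betaDensity_le {b β h : ℝ} (hb : 0 < b) (hβ : 0 < β) (h' : h < 2 * b) :
    |betaDensity d β h| ≤ betaConst d β * ((2 * b) ^ b * (2 * b - h) ^ (-b)) := by
  have hK := betaConst_pos d hβ
  have hE := exp_half_le hb h'
  have hE0 := (Real.exp_pos (h / 2)).trans_le hE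
  rw [betaDensity]
  split_ifs with h0
  · rw [abs_of_nonneg (by positivity)]
    exact mul_le_mul_of_nonneg_left ((one_add_div_rpow_le hβ h0).trans hE) hK.le
  · rw [abs_zero]
    exact (mul_pos hK hE0).le

lemma abs_betaDensity'_le {b β h : ℝ} (hb : 0 < b) (hβ : b ≤ β) (hd : (d : ℝ) / 2 < β)
    (h' : h < 2 * b) :
    |betaDensity' d β h| ≤ betaConst' d β * ((2 * b) ^ b * (2 * b - h) ^ (-b)) := by
  have hK := betaConst'_pos hd
  have hβ0 : 0 < β := hb.trans_le hβ
  have h1 := one_sub_div_pos hβ0 (by linarith : h < 2 * β)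
  rw [betaDensity'_of_lt hβ0 (by linarith), abs_of_nonneg (by positivity)]
  exact mul_le_mul_of_nonneg_left (one_sub_div_rpow_neg_le hb hβ h') hK.le

lemma abs_gaussDensity_le {b h : ℝ} (hb : 0 < b) (h' : h < 2 * b) :
    |gaussDensity d h| ≤
      (2 * Real.pi) ^ (-((d : ℝ) / 2)) * ((2 * b) ^ b * (2 * b - h) ^ (-b)) := by
  rw [gaussDensity, abs_of_nonneg (by positivity)]
  exact mul_le_mul_of_nonneg_left (exp_half_le hb h') (by positivity)

lemma setLIntegral_powerRegion_mul_lt_top (hd : 1 ≤ d) {b t : ℝ} (hb : ((d : ℝ) + 1) / 2 < b)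
    (ht : t < 2 * b) (r M : ℝ) :
    ∫⁻ x in powerRegion d r t, ENNReal.ofReal (M * (2 * b - x.2) ^ (-b)) < ∞ := by
  calc ∫⁻ x in powerRegion d r t, ENNReal.ofReal (M * (2 * b - x.2) ^ (-b))
      = ∫⁻ x in powerRegion d r t, ENNReal.ofReal M * ENNReal.ofReal ((2 * b - x.2) ^ (-b)) := by
        refine setLIntegral_congr_fun (measurableSet_powerRegion r t) fun x hx => ?_
        have : x.2 ≤ t := hx.1
        exact ENNReal.ofReal_mul' (Real.rpow_nonneg (by linarith) _)
    _ = ENNReal.ofReal M * ∫⁻ x in powerRegion d r t, ENNReal.ofReal ((2 * b - x.2) ^ (-b)) :=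
        lintegral_const_mul _ (by fun_prop)
    _ < ∞ := ENNReal.mul_lt_top ENNReal.ofReal_lt_top
        (setLIntegral_powerRegion_rpow_lt_top hd ht hb r)

lemma withDensity_powerRegion_lt_top (hd : 1 ≤ d) {g : ℝ → ℝ}
    (h : ∀ t, ∃ M b, ((d : ℝ) + 1) / 2 < b ∧ t < 2 * b ∧
      ∀ s ≤ t, g s ≤ M * (2 * b - s) ^ (-b)) (r t : ℝ) :
    (volume.withDensity fun x : Space d × ℝ => ENNReal.ofReal (g x.2)) (powerRegion d r t) < ∞ := by
  obtain ⟨M, b, hb, ht, hM⟩ := h t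
  rw [withDensity_apply _ (measurableSet_powerRegion r t)]
  exact (setLIntegral_mono' (measurableSet_powerRegion r t) fun x hx =>
    ENNReal.ofReal_le_ofReal (hM x.2 hx.1)).trans_lt
      (setLIntegral_powerRegion_mul_lt_top hd hb ht r M)

lemma tendsto_setLIntegral_powerRegion (hd : 1 ≤ d) {ι : Type*} {l : Filter ι}
    [l.IsCountablyGenerated] {f : ι → ℝ → ℝ} {g : ℝ → ℝ} (hf : ∀ i, Measurable (f i))
    (hg : Measurable g) (hlim : ∀ s, Tendsto (fun i => f i s) l (𝓝 (g s)))
    (h : ∀ t, ∃ M b, ((d : ℝ) + 1) / 2 < b ∧ t < 2 * b ∧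
      ∀ᶠ i in l, ∀ s ≤ t, |f i s - g s| ≤ M * (2 * b - s) ^ (-b)) (r t : ℝ) :
    Tendsto (fun i => ∫⁻ x in powerRegion d r t, ENNReal.ofReal |f i x.2 - g x.2|) l (𝓝 0) := by
  obtain ⟨M, b, hb, ht, hM⟩ := h t
  rw [← lintegral_zero (μ := volume.restrict (powerRegion d r t))]
  refine tendsto_lintegral_filter_of_dominated_convergence
    (fun x => ENNReal.ofReal (M * (2 * b - x.2) ^ (-b))) (Eventually.of_forall fun i => ?_) ?_
    (setLIntegral_powerRegion_mul_lt_top hd hb ht r M).ne (ae_of_all _ fun x => ?_)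
  · have := hf i
    fun_prop
  · filter_upwards [hM] with i hi
    filter_upwards [ae_restrict_mem (measurableSet_powerRegion r t)] with x hx
    exact ENNReal.ofReal_le_ofReal (hi x.2 hx.1)
  · have h1 := (((hlim x.2).sub_const (g x.2)).abs)
    rw [sub_self, abs_zero] at h1
    simpa using ENNReal.tendsto_ofReal h1

/-- The parameter of the dominating function: large enough for integrability, and with its
singularity `2b` above the level in question. -/
lemma exists_level (d : ℕ) (t : ℝ) : ∃ b : ℝ, 0 < b ∧ ((d : ℝ) + 1) / 2 < b ∧ t < 2 * b := by
  refine ⟨((d : ℝ) + 1) / 2 + |t| + 1, by positivity, by linarith [abs_nonneg t], ?_⟩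
  have := le_abs_self t
  have := abs_nonneg t
  have : (0 : ℝ) ≤ d := by positivity
  linarith

lemma tendsto_setLIntegral_betaDensity (hd : 1 ≤ d) {ι : Type*} {l : Filter ι}
    [l.IsCountablyGenerated] {u : ι → ℝ} (hu : Tendsto u l atTop) (r t : ℝ) :
    Tendsto (fun i => ∫⁻ x in powerRegion d r t,
      ENNReal.ofReal |betaDensity d (u i) x.2 - gaussDensity d x.2|) l (𝓝 0) := by
  refine tendsto_setLIntegral_powerRegion hd (fun i => measurable_betaDensity d (u i))
    (measurable_gaussDensity d) (fun s => (tendsto_betaDensity d s).comp hu) (fun t => ?_) r t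
  obtain ⟨b, hb0, hb, ht⟩ := exists_level d t
  set k := (2 * Real.pi) ^ (-((d : ℝ) / 2))
  refine ⟨(k + 1 + k) * (2 * b) ^ b, b, hb, ht, ?_⟩
  filter_upwards [hu.eventually (eventually_gt_atTop 0),
    hu.eventually ((tendsto_betaConst d).eventually_lt_const (lt_add_one k))] with i hi1 hi2 s hs
  have hs' : s < 2 * b := by linarith
  have h3 : 0 ≤ (2 * b) ^ b * (2 * b - s) ^ (-b) :=
    (Real.exp_pos _).le.trans (exp_half_le hb0 hs')
  calc |betaDensity d (u i) s - gaussDensity d s|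
      ≤ |betaDensity d (u i) s| + |gaussDensity d s| := abs_sub _ _
    _ ≤ betaConst d (u i) * ((2 * b) ^ b * (2 * b - s) ^ (-b)) +
        k * ((2 * b) ^ b * (2 * b - s) ^ (-b)) :=
        add_le_add (abs_betaDensity_le hb0 hi1 hs') (abs_gaussDensity_le hb0 hs')
    _ ≤ (k + 1) * ((2 * b) ^ b * (2 * b - s) ^ (-b)) +
        k * ((2 * b) ^ b * (2 * b - s) ^ (-b)) := by gcongr
    _ = (k + 1 + k) * (2 * b) ^ b * (2 * b - s) ^ (-b) := by ring

lemma tendsto_setLIntegral_betaDensity' (hd : 1 ≤ d) {ι : Type*} {l : Filter ι}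
    [l.IsCountablyGenerated] {u : ι → ℝ} (hu : Tendsto u l atTop) (r t : ℝ) :
    Tendsto (fun i => ∫⁻ x in powerRegion d r t,
      ENNReal.ofReal |betaDensity' d (u i) x.2 - gaussDensity d x.2|) l (𝓝 0) := by
  refine tendsto_setLIntegral_powerRegion hd (fun i => measurable_betaDensity' d (u i))
    (measurable_gaussDensity d) (fun s => (tendsto_betaDensity' d s).comp hu) (fun t => ?_) r t
  obtain ⟨b, hb0, hb, ht⟩ := exists_level d t
  set k := (2 * Real.pi) ^ (-((d : ℝ) / 2))
  refine ⟨(k + 1 + k) * (2 * b) ^ b, b, hb, ht, ?_⟩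
  filter_upwards [hu.eventually (eventually_ge_atTop b),
    hu.eventually ((tendsto_betaConst' d).eventually_lt_const (lt_add_one k))] with i hi1 hi2 s hs
  have hs' : s < 2 * b := by linarith
  have h3 : 0 ≤ (2 * b) ^ b * (2 * b - s) ^ (-b) :=
    (Real.exp_pos _).le.trans (exp_half_le hb0 hs')
  calc |betaDensity' d (u i) s - gaussDensity d s|
      ≤ |betaDensity' d (u i) s| + |gaussDensity d s| := abs_sub _ _
    _ ≤ betaConst' d (u i) * ((2 * b) ^ b * (2 * b - s) ^ (-b)) +
        k * ((2 * b) ^ b * (2 * b - s) ^ (-b)) :=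
        add_le_add (abs_betaDensity'_le hb0 hi1 (by linarith) hs') (abs_gaussDensity_le hb0 hs')
    _ ≤ (k + 1) * ((2 * b) ^ b * (2 * b - s) ^ (-b)) +
        k * ((2 * b) ^ b * (2 * b - s) ^ (-b)) := by gcongr
    _ = (k + 1 + k) * (2 * b) ^ b * (2 * b - s) ^ (-b) := by ring

/-! ### The intensity measures -/

lemma withDensity_betaDensity_ball_prod {β : ℝ} (hβ : 0 < β) (q : Space d) {r : ℝ} (hr : 0 < r) :
    (volume.withDensity fun x : Space d × ℝ => ENNReal.ofReal (betaDensity d β x.2))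
      (Metric.ball q r ×ˢ univ) = ∞ := by
  refine withDensity_ball_prod_eq_top (g := fun h => ENNReal.ofReal (betaDensity d β h))
    (measurable_betaDensity d β).ennreal_ofReal
    (lintegral_eq_top_of_le (a := 0) (betaConst_pos d hβ) fun s hs => ?_) q hr
  refine ENNReal.ofReal_le_ofReal ?_
  have h1 : 1 ≤ 1 + s / (2 * β) := le_add_of_nonneg_right (by positivity)
  rw [betaDensity, if_pos (by linarith)]
  exact le_mul_of_one_le_right (betaConst_pos d hβ).le (Real.one_le_rpow h1 hβ.le)

lemma withDensity_gaussDensity_ball_prod (q : Space d) {r : ℝ} (hr : 0 < r) :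
    (volume.withDensity fun x : Space d × ℝ => ENNReal.ofReal (gaussDensity d x.2))
      (Metric.ball q r ×ˢ univ) = ∞ := by
  refine withDensity_ball_prod_eq_top (g := fun h => ENNReal.ofReal (gaussDensity d h))
    (measurable_gaussDensity d).ennreal_ofReal
    (lintegral_eq_top_of_le (c := (2 * Real.pi) ^ (-((d : ℝ) / 2))) (a := 0) (by positivity)
      fun s hs => ?_) q hr
  refine ENNReal.ofReal_le_ofReal ?_
  exact le_mul_of_one_le_right (by positivity) (Real.one_le_exp (by positivity))

lemma withDensity_gaussDensity_powerRegion_lt_top (hd : 1 ≤ d) (r t : ℝ) :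
    (volume.withDensity fun x : Space d × ℝ => ENNReal.ofReal (gaussDensity d x.2))
      (powerRegion d r t) < ∞ := by
  refine withDensity_powerRegion_lt_top hd (fun t => ?_) r t
  obtain ⟨b, hb0, hb, ht⟩ := exists_level d t
  refine ⟨(2 * Real.pi) ^ (-((d : ℝ) / 2)) * (2 * b) ^ b, b, hb, ht, fun s hs => ?_⟩
  rw [mul_assoc]
  exact (le_abs_self _).trans (abs_gaussDensity_le hb0 (by linarith))

lemma isTessellationIntensity_gaussDensity (hd : 1 ≤ d) :
    IsTessellationIntensity (volume.withDensity fun x : Space d × ℝ =>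
      ENNReal.ofReal (gaussDensity d x.2)) :=
  isTessellationIntensity_of_finite (fun q _ hr => withDensity_gaussDensity_ball_prod q hr)
    (withDensity_gaussDensity_powerRegion_lt_top hd)

lemma isTessellationIntensity_betaDensity (hd : 1 ≤ d) {β : ℝ} (hβ : 0 < β) :
    IsTessellationIntensity (volume.withDensity fun x : Space d × ℝ =>
      ENNReal.ofReal (betaDensity d β x.2)) := by
  refine isTessellationIntensity_of_finite (fun q _ hr => withDensity_betaDensity_ball_prod hβ q hr)
    (withDensity_powerRegion_lt_top hd fun t => ?_)
  obtain ⟨b, hb0, hb, ht⟩ := exists_level d t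
  refine ⟨betaConst d β * (2 * b) ^ b, b, hb, ht, fun s hs => ?_⟩
  rw [mul_assoc]
  exact (le_abs_self _).trans (abs_betaDensity_le hb0 hβ (by linarith))

lemma isTessellationIntensity_betaDensity' (hd : 2 ≤ d) {β : ℝ} (hβ : ((d : ℝ) + 1) / 2 < β) :
    IsTessellationIntensity (volume.withDensity fun x : Space d × ℝ =>
      ENNReal.ofReal (betaDensity' d β x.2)) := by
  have hβ0 : 0 < β := lt_of_le_of_lt (by positivity) hβ
  have := betaConst'_pos (d := d) (by linarith : (d : ℝ) / 2 < β)
  exact isTessellationIntensity_singularDensity hd (by positivity) hβ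

lemma volume_map_weightedScale (hd : 1 ≤ d) {s : ℝ} (hs : 0 < s) (a : ℝ) :
    (volume : Measure (Space d × ℝ)).map (weightedScale d s a hs.ne') =
      ENNReal.ofReal (s ^ (d + 1))⁻¹ • volume := by
  have h1 : (volume : Measure (Space d)).map (fun v => s • v) =
      ENNReal.ofReal (s ^ (d - 1))⁻¹ • volume := by
    rw [Measure.map_addHaar_smul _ hs.ne', finrank_euclideanSpace_fin, abs_of_pos (by positivity)]
  have h2 : (volume : Measure ℝ).map (fun h => s ^ 2 * (h + a)) =
      ENNReal.ofReal (s ^ 2)⁻¹ • volume := by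
    have : (fun h : ℝ => s ^ 2 * (h + a)) = (fun h => s ^ 2 * h) ∘ fun h => h + a := rfl
    rw [this, ← Measure.map_map (by fun_prop) (by fun_prop), map_add_right_eq_self,
      Real.map_volume_mul_left (by positivity), abs_of_pos (by positivity)]
  have h3 : (weightedScale d s a hs.ne' : Space d × ℝ → Space d × ℝ) =
      Prod.map (fun v => s • v) (fun h => s ^ 2 * (h + a)) := rfl
  rw [h3, Measure.volume_eq_prod, ← Measure.map_prod_map _ _ (by fun_prop) (by fun_prop), h1, h2,
    Measure.prod_smul_left, Measure.prod_smul_right, smul_smul,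
    ← ENNReal.ofReal_mul (by positivity),
    ← mul_inv, ← pow_add]
  congr 4
  omega

lemma map_weightedScale_withDensity (hd : 1 ≤ d) {s : ℝ} (hs : 0 < s) (a : ℝ) {g : ℝ → ℝ}
    (hg : Measurable g) :
    (volume.withDensity fun x : Space d × ℝ => ENNReal.ofReal (g x.2)).map
        (weightedScale d s a hs.ne') =
      volume.withDensity fun x : Space d × ℝ =>
        ENNReal.ofReal ((s ^ (d + 1))⁻¹ * g (x.2 / s ^ 2 - a)) := by
  have hm : Measurable (weightedScale d s a hs.ne') := (weightedScale d s a hs.ne').measurable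
  have hg' : Measurable fun x : Space d × ℝ => ENNReal.ofReal (g (x.2 / s ^ 2 - a)) := by fun_prop
  ext B hB
  rw [Measure.map_apply hm hB, withDensity_apply _ (hm hB), withDensity_apply _ hB]
  calc ∫⁻ x in weightedScale d s a hs.ne' ⁻¹' B, ENNReal.ofReal (g x.2)
      = ∫⁻ x in weightedScale d s a hs.ne' ⁻¹' B,
          ENNReal.ofReal (g ((weightedScale d s a hs.ne' x).2 / s ^ 2 - a)) := by
        refine lintegral_congr fun x => ?_
        rw [weightedScale_apply]
        congr 2
        field_simp
        ring
    _ = ∫⁻ y in B, ENNReal.ofReal (g (y.2 / s ^ 2 - a))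
          ∂(volume.map (weightedScale d s a hs.ne')) := (setLIntegral_map hB hg' hm).symm
    _ = ∫⁻ y in B, ENNReal.ofReal ((s ^ (d + 1))⁻¹ * g (y.2 / s ^ 2 - a)) := by
        rw [volume_map_weightedScale hd hs, Measure.restrict_smul, lintegral_smul_measure,
          smul_eq_mul, ← lintegral_const_mul _ hg']
        refine lintegral_congr fun x => ?_
        rw [ENNReal.ofReal_mul (by positivity)]

lemma sqrt_two_mul_pos {β : ℝ} (hβ : 0 < β) : 0 < √(2 * β) := Real.sqrt_pos.2 (by positivity)

lemma rescale_eq {β : ℝ} (hβ : 0 < β) :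
    rescale d β = weightedScale d √(2 * β) (-1) (sqrt_two_mul_pos hβ).ne' := by
  ext1 x
  rw [weightedScale_apply, Real.sq_sqrt (by positivity), ← sub_eq_add_neg, rescale]

lemma rescale'_eq {β : ℝ} (hβ : 0 < β) :
    rescale' d β = weightedScale d √(2 * β) 1 (sqrt_two_mul_pos hβ).ne' := by
  ext1 x
  rw [weightedScale_apply, Real.sq_sqrt (by positivity), rescale']

/-- The Jacobian `√(2β)^(d+1)` cancels the factor `√(2β)` of the intensity and leaves the
denominator `√(2β)^d` of `betaConst`. -/
lemma betaIntensity_map (hd : 1 ≤ d) {β : ℝ} (hβ : 0 < β) :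
    (betaIntensity d β √(2 * β)).map (weightedScale d √(2 * β) (-1) (sqrt_two_mul_pos hβ).ne') =
      volume.withDensity fun x => ENNReal.ofReal (betaDensity d β x.2) := by
  have hs := sqrt_two_mul_pos hβ
  have hg : Measurable fun h : ℝ => if 0 ≤ h then √(2 * β) * cBeta d β * h ^ β else 0 :=
    Measurable.ite measurableSet_Ici (by fun_prop) measurable_const
  rw [betaIntensity, map_weightedScale_withDensity hd hs _ hg, Real.sq_sqrt (by positivity)]
  congr 1
  ext1 x
  rw [betaDensity, sub_neg_eq_add, add_comm (x.2 / (2 * β))]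
  congr 1
  split_ifs
  · rw [betaConst, pow_succ]
    field_simp
  · rw [mul_zero]

lemma betaIntensity'_map (hd : 1 ≤ d) {β : ℝ} (hβ : 0 < β) :
    (betaIntensity' d β √(2 * β)).map (weightedScale d √(2 * β) 1 (sqrt_two_mul_pos hβ).ne') =
      volume.withDensity fun x => ENNReal.ofReal (betaDensity' d β x.2) := by
  have hs := sqrt_two_mul_pos hβ
  have hg : Measurable fun h : ℝ => if h < 0 then √(2 * β) * cBeta' d β * (-h) ^ (-β) else 0 :=
    Measurable.ite measurableSet_Iio (by fun_prop) measurable_const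
  rw [betaIntensity', map_weightedScale_withDensity hd hs _ hg, Real.sq_sqrt (by positivity)]
  congr 1
  ext1 x
  congr 1
  by_cases hx : x.2 < 2 * β
  · rw [if_pos (by rw [sub_neg, div_lt_one (by positivity)]; exact hx), betaDensity'_of_lt hβ hx,
      neg_sub, betaConst', pow_succ]
    field_simp
  · rw [if_neg (by rw [sub_neg, div_lt_one (by positivity)]; exact hx), betaDensity',
      singularDensity, if_neg hx, mul_zero]

end

/-! ### The convergence theorem -/

section

variable {d : ℕ}

lemma IsPoissonProcess.map_rescale (hd : 1 ≤ d) {β : ℝ} (hβ : 0 < β) {Ω : Type*}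
    [MeasurableSpace Ω] {P : Measure Ω} {η : Ω → Measure (Space d × ℝ)}
    (hη : IsPoissonProcess η (betaIntensity d β √(2 * β)) P) :
    IsPoissonProcess (fun ω => (η ω).map (rescale d β))
      (volume.withDensity fun x => ENNReal.ofReal (betaDensity d β x.2)) P := by
  rw [rescale_eq hβ, ← betaIntensity_map hd hβ]
  exact hη.map_equiv (weightedScale d √(2 * β) (-1) (sqrt_two_mul_pos hβ).ne').toMeasurableEquiv

lemma IsPoissonProcess.map_rescale' (hd : 1 ≤ d) {β : ℝ} (hβ : 0 < β) {Ω : Type*}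
    [MeasurableSpace Ω] {P : Measure Ω} {η : Ω → Measure (Space d × ℝ)}
    (hη : IsPoissonProcess η (betaIntensity' d β √(2 * β)) P) :
    IsPoissonProcess (fun ω => (η ω).map (rescale' d β))
      (volume.withDensity fun x => ENNReal.ofReal (betaDensity' d β x.2)) P := by
  rw [rescale'_eq hβ, ← betaIntensity'_map hd hβ]
  exact hη.map_equiv (weightedScale d √(2 * β) 1 (sqrt_two_mul_pos hβ).ne').toMeasurableEquiv

/-- A Poisson process whose intensity measure is the image of `μ` under `e` is the image under `e`
of a Poisson process with intensity measure `μ`. -/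
lemma IsPoissonProcess.exists_map_eq {X Y Ω : Type*} [MeasurableSpace X] [MeasurableSpace Y]
    [MeasurableSpace Ω] {P : Measure Ω} (e : X ≃ᵐ Y) {ξ : Ω → Measure Y} {μ : Measure X}
    (hξ : IsPoissonProcess ξ (μ.map e) P) :
    ∃ η : Ω → Measure X, IsPoissonProcess η μ P ∧ ∀ ω, (η ω).map e = ξ ω := by
  refine ⟨fun ω => (ξ ω).map e.symm, ?_, fun ω => by rw [MeasurableEquiv.map_map_symm]⟩
  have := hξ.map_equiv e.symm
  rwa [MeasurableEquiv.map_symm_map] at this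

/-- The Poisson processes of the theorem can be realized on one probability space in such a way
that the skeletons agree in a given ball with probability tending to one. -/
lemma exists_coupling (hd : 2 ≤ d) :
    ∃ (W : Type) (_ : MeasurableSpace W) (Pr : Measure W) (_ : IsProbabilityMeasure Pr)
      (ξ : Ioi (0 : ℝ) → W → Measure (Space d × ℝ))
      (ξ' : Ioi (((d : ℝ) + 1) / 2) → W → Measure (Space d × ℝ))
      (ξ₀ : W → Measure (Space d × ℝ)),
      (∀ β, IsPoissonProcess (ξ β) (betaIntensity d β √(2 * β)) Pr) ∧
      (∀ β, IsPoissonProcess (ξ' β) (betaIntensity' d β √(2 * β)) Pr) ∧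
      IsPoissonProcess ξ₀ (gaussIntensity d) Pr ∧
      ∀ R : ℝ, 0 < R →
        Tendsto (fun β => Pr {w | delaunaySkel d ((ξ β w).map (rescale d β)) ∩
          Metric.closedBall 0 R ≠ delaunaySkel d (ξ₀ w) ∩ Metric.closedBall 0 R})
          atTop (𝓝 0) ∧
        Tendsto (fun β => Pr {w | delaunaySkel d ((ξ' β w).map (rescale' d β)) ∩
          Metric.closedBall 0 R ≠ delaunaySkel d (ξ₀ w) ∩ Metric.closedBall 0 R})
          atTop (𝓝 0) := by
  have hd1 : 1 ≤ d := by omega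
  have hpos : ∀ β : Ioi (((d : ℝ) + 1) / 2), 0 < (β : ℝ) := fun β =>
    lt_of_le_of_lt (by positivity) β.2
  -- One marked process `N` serves all parameters and both families. Thinning produces the rescaled
  -- processes; the unscaled ones are recovered by inverting the rescaling.
  obtain ⟨W, _, Pr, _, N, hN, hc, hL⟩ :=
    exists_poisson_laplace ((volume : Measure (Space d × ℝ)).prod (volume : Measure ℝ))
  have hf : ∀ β, Measurable fun x : Space d × ℝ => betaDensity d β x.2 := fun β =>
    (measurable_betaDensity d β).comp measurable_snd
  have hf' : ∀ β, Measurable fun x : Space d × ℝ => betaDensity' d β x.2 := fun β =>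
    (measurable_betaDensity' d β).comp measurable_snd
  have hf₀ : Measurable fun x : Space d × ℝ => gaussDensity d x.2 :=
    (measurable_gaussDensity d).comp measurable_snd
  have h1 : ∀ β : Ioi (0 : ℝ), ∃ ξ : W → Measure (Space d × ℝ),
      IsPoissonProcess ξ (betaIntensity d β √(2 * β)) Pr ∧ ∀ w, (ξ w).map (rescale d β) =
        thinProcess volume (fun x : Space d × ℝ => betaDensity d β x.2) N w := by
    intro β
    have := isPoissonProcess_thinProcess hN hc hL (hf β)
    rw [← betaIntensity_map hd1 β.2] at this
    rw [rescale_eq β.2]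
    exact this.exists_map_eq
      (weightedScale d √(2 * β) (-1) (sqrt_two_mul_pos β.2).ne').toMeasurableEquiv
  have h2 : ∀ β : Ioi (((d : ℝ) + 1) / 2), ∃ ξ : W → Measure (Space d × ℝ),
      IsPoissonProcess ξ (betaIntensity' d β √(2 * β)) Pr ∧ ∀ w, (ξ w).map (rescale' d β) =
        thinProcess volume (fun x : Space d × ℝ => betaDensity' d β x.2) N w := by
    intro β
    have := isPoissonProcess_thinProcess hN hc hL (hf' β)
    rw [← betaIntensity'_map hd1 (hpos β)] at this
    rw [rescale'_eq (hpos β)]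
    exact this.exists_map_eq
      (weightedScale d √(2 * β) 1 (sqrt_two_mul_pos (hpos β)).ne').toMeasurableEquiv
  choose ξ hξ hξm using h1
  choose ξ' hξ' hξm' using h2
  refine ⟨W, inferInstance, Pr, inferInstance, ξ, ξ',
    thinProcess volume (fun x : Space d × ℝ => gaussDensity d x.2) N, hξ, hξ',
    isPoissonProcess_thinProcess hN hc hL hf₀, fun R _ => ⟨?_, ?_⟩⟩
  · simp_rw [hξm]
    exact tendsto_measure_skel_ne hN hc hL (fun β : Ioi (0 : ℝ) => hf β) hf₀
      (fun β => isTessellationIntensity_betaDensity hd1 β.2)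
      (fun q _ hr => withDensity_gaussDensity_ball_prod q hr)
      (withDensity_gaussDensity_powerRegion_lt_top hd1)
      (tendsto_setLIntegral_betaDensity hd1 (tendsto_comp_val_Ioi_atTop.2 tendsto_id)) R
  · simp_rw [hξm']
    exact tendsto_measure_skel_ne hN hc hL (fun β : Ioi (((d : ℝ) + 1) / 2) => hf' β) hf₀
      (fun β => isTessellationIntensity_betaDensity' hd β.2)
      (fun q _ hr => withDensity_gaussDensity_ball_prod q hr)
      (withDensity_gaussDensity_powerRegion_lt_top hd1)
      (tendsto_setLIntegral_betaDensity' hd1 (tendsto_comp_val_Ioi_atTop.2 tendsto_id)) R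

end

end

theorem theorem4p1 (d : ℕ) (hd : 2 ≤ d)
    -- the Poisson processes `η_{β,√(2β)}`, `β > 0`
    {Ω : Ioi (0 : ℝ) → Type*} [∀ β, MeasurableSpace (Ω β)]
    (P : ∀ β, Measure (Ω β)) [∀ β, IsProbabilityMeasure (P β)]
    (η : ∀ β, Ω β → Measure (Space d × ℝ))
    (hη : ∀ β, IsPoissonProcess (η β) (betaIntensity d β √(2 * β)) (P β))
    -- the Poisson processes `η'_{β,√(2β)}`, `β > (d+1)/2`
    {Ω' : Ioi (((d : ℝ) + 1) / 2) → Type*} [∀ β, MeasurableSpace (Ω' β)]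
    (P' : ∀ β, Measure (Ω' β)) [∀ β, IsProbabilityMeasure (P' β)]
    (η' : ∀ β, Ω' β → Measure (Space d × ℝ))
    (hη' : ∀ β, IsPoissonProcess (η' β) (betaIntensity' d β √(2 * β)) (P' β))
    -- the Poisson process `ζ`
    {Ω₀ : Type*} [MeasurableSpace Ω₀] (P₀ : Measure Ω₀) [IsProbabilityMeasure P₀]
    (ζ : Ω₀ → Measure (Space d × ℝ)) (hζ : IsPoissonProcess ζ (gaussIntensity d) P₀)
    -- the skeletons of the dual Laguerre tessellations of `ζ_β`, `ζ'_β` and `ζ`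
    (D : ∀ β, Ω β → Set (Space d)) (hD : ∀ β ω, D β ω = delaunaySkel d ((η β ω).map (rescale d β)))
    (D' : ∀ β, Ω' β → Set (Space d))
    (hD' : ∀ β ω, D' β ω = delaunaySkel d ((η' β ω).map (rescale' d β)))
    (D₀ : Ω₀ → Set (Space d)) (hD₀ : ∀ ω, D₀ ω = delaunaySkel d (ζ ω)) :
    -- they are random closed sets
    (∀ β, IsRandomClosedSet (D β) (P β)) ∧ (∀ β, IsRandomClosedSet (D' β) (P' β)) ∧
    IsRandomClosedSet D₀ P₀ ∧
    -- and are the dilated skeletons of the `β`- and `β'`-Delaunay tessellations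
    (∀ β ω, D β ω = (fun v => √(2 * (β : ℝ)) • v) '' delaunaySkel d (η β ω)) ∧
    (∀ β ω, D' β ω = (fun v => √(2 * (β : ℝ)) • v) '' delaunaySkel d (η' β ω)) ∧
    -- weak convergence for the Fell topology
    TendstoInDistribution (fun β ω => toClosed (D β ω)) atTop (fun ω => toClosed (D₀ ω)) P P₀ ∧
    TendstoInDistribution (fun β ω => toClosed (D' β ω)) atTop (fun ω => toClosed (D₀ ω)) P' P₀ ∧
    -- convergence of the capacity functionals
    (∀ C : Set (Space d), IsCompact C →
      Tendsto (fun β => capacity (D β) (P β) C) atTop (𝓝 (capacity D₀ P₀ C)) ∧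
      Tendsto (fun β => capacity (D' β) (P' β) C) atTop (𝓝 (capacity D₀ P₀ C))) ∧
    -- weak convergence for the topology of local coincidence
    (∀ f : ClosedSubset (Space d) → ℝ, Measurable f → (∃ M, ∀ F, |f F| ≤ M) →
      @Continuous _ _ (ClosedSubset.localTopology d) _ f →
      Tendsto (fun β => ∫ ω, f (toClosed (D β ω)) ∂P β) atTop
        (𝓝 (∫ ω, f (toClosed (D₀ ω)) ∂P₀)) ∧
      Tendsto (fun β => ∫ ω, f (toClosed (D' β ω)) ∂P' β) atTop
        (𝓝 (∫ ω, f (toClosed (D₀ ω)) ∂P₀))) ∧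
    -- on a suitable common probability space, the probability that the skeletons differ in a
    -- given ball tends to zero
    (∃ (W : Type) (_ : MeasurableSpace W) (Pr : Measure W) (_ : IsProbabilityMeasure Pr)
      (ξ : Ioi (0 : ℝ) → W → Measure (Space d × ℝ))
      (ξ' : Ioi (((d : ℝ) + 1) / 2) → W → Measure (Space d × ℝ))
      (ξ₀ : W → Measure (Space d × ℝ)),
      (∀ β, IsPoissonProcess (ξ β) (betaIntensity d β √(2 * β)) Pr) ∧
      (∀ β, IsPoissonProcess (ξ' β) (betaIntensity' d β √(2 * β)) Pr) ∧
      IsPoissonProcess ξ₀ (gaussIntensity d) Pr ∧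
      ∀ R : ℝ, 0 < R →
        Tendsto (fun β => Pr {w | delaunaySkel d ((ξ β w).map (rescale d β)) ∩
          Metric.closedBall 0 R ≠ delaunaySkel d (ξ₀ w) ∩ Metric.closedBall 0 R})
          atTop (𝓝 0) ∧
        Tendsto (fun β => Pr {w | delaunaySkel d ((ξ' β w).map (rescale' d β)) ∩
          Metric.closedBall 0 R ≠ delaunaySkel d (ξ₀ w) ∩ Metric.closedBall 0 R})
          atTop (𝓝 0)) := by
  have hd1 : 1 ≤ d := by omega
  have hpos : ∀ β : Ioi (((d : ℝ) + 1) / 2), 0 < (β : ℝ) := fun β =>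
    lt_of_le_of_lt (by positivity) β.2
  have hη₁ := fun β => (hη β).map_rescale hd1 β.2
  have hη₁' := fun β => (hη' β).map_rescale' hd1 (hpos β)
  obtain rfl : D = fun β ω => delaunaySkel d ((η β ω).map (rescale d β)) := by
    ext1 β; ext1 ω; exact hD β ω
  obtain rfl : D' = fun β ω => delaunaySkel d ((η' β ω).map (rescale' d β)) := by
    ext1 β; ext1 ω; exact hD' β ω
  obtain rfl : D₀ = fun ω => delaunaySkel d (ζ ω) := by
    ext1 ω; exact hD₀ ω
  have hZ := fun β : Ioi (0 : ℝ) =>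
    (isTessellationIntensity_betaDensity hd1 β.2).isRandomClosedSet (hη₁ β)
  have hZ' := fun β : Ioi (((d : ℝ) + 1) / 2) =>
    (isTessellationIntensity_betaDensity' hd β.2).isRandomClosedSet (hη₁' β)
  have hZ₀ : IsRandomClosedSet (fun ω => delaunaySkel d (ζ ω)) P₀ :=
    (isTessellationIntensity_gaussDensity hd1).isRandomClosedSet hζ
  -- Convergence for the local topology is the strongest of the statements in law: Fell-continuous
  -- functions and hitting indicators of compact sets are special test functions.
  have hlim : ∀ f : ClosedSubset (Space d) → ℝ, Measurable f → (∃ M, ∀ F, |f F| ≤ M) →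
      @Continuous _ _ (ClosedSubset.localTopology d) _ f →
      Tendsto (fun β => ∫ ω, f (toClosed (delaunaySkel d ((η β ω).map (rescale d β)))) ∂P β) atTop
        (𝓝 (∫ ω, f (toClosed (delaunaySkel d (ζ ω))) ∂P₀)) := fun f hf hM hfc =>
    tendsto_integral_delaunaySkel hη₁ hζ
      (fun β => (measurable_betaDensity d β).comp measurable_snd)
      ((measurable_gaussDensity d).comp measurable_snd)
      (fun β => isTessellationIntensity_betaDensity hd1 β.2)
      (fun q _ hr => withDensity_gaussDensity_ball_prod q hr)
      (withDensity_gaussDensity_powerRegion_lt_top hd1)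
      (tendsto_setLIntegral_betaDensity hd1 (tendsto_comp_val_Ioi_atTop.2 tendsto_id)) hf hM hfc
  have hlim' : ∀ f : ClosedSubset (Space d) → ℝ, Measurable f → (∃ M, ∀ F, |f F| ≤ M) →
      @Continuous _ _ (ClosedSubset.localTopology d) _ f →
      Tendsto (fun β => ∫ ω, f (toClosed (delaunaySkel d ((η' β ω).map (rescale' d β)))) ∂P' β)
        atTop (𝓝 (∫ ω, f (toClosed (delaunaySkel d (ζ ω))) ∂P₀)) := fun f hf hM hfc =>
    tendsto_integral_delaunaySkel hη₁' hζ
      (fun β => (measurable_betaDensity' d β).comp measurable_snd)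
      ((measurable_gaussDensity d).comp measurable_snd)
      (fun β => isTessellationIntensity_betaDensity' hd β.2)
      (fun q _ hr => withDensity_gaussDensity_ball_prod q hr)
      (withDensity_gaussDensity_powerRegion_lt_top hd1)
      (tendsto_setLIntegral_betaDensity' hd1 (tendsto_comp_val_Ioi_atTop.2 tendsto_id)) hf hM hfc
  refine ⟨hZ, hZ', hZ₀, fun β ω => ?_, fun β ω => ?_,
    tendstoInDistribution_of_local (fun β => (hZ β).2) hZ₀.2 hlim,
    tendstoInDistribution_of_local (fun β => (hZ' β).2) hZ₀.2 hlim',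
    fun C hC => ⟨tendsto_capacity_of_local hZ hZ₀ hlim hC,
      tendsto_capacity_of_local hZ' hZ₀ hlim' hC⟩,
    fun f hf hM hfc => ⟨hlim f hf hM hfc, hlim' f hf hM hfc⟩, exists_coupling hd⟩
  · simp only
    rw [rescale_eq β.2, delaunaySkel_map_weightedScale]
  · simp only
    rw [rescale'_eq (hpos β), delaunaySkel_map_weightedScale]
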